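/- Let $p\in(0,1/2)$ and $\rho=p/(1-p)\in(0,1)$. For a transition matrix $P=(p(x,y))$ on a countable set, the associated cat and mouse chain $(C_k,M_k)$ is the Markov chain with transitions $(x,y)\to(z,y)$ with probability $p(x,z)$ if $x\ne y$, and $(y,y)\to(z,w)$ with probability $p(y,z)p(y,w)$. Let $(C_k,M_k)$ be the cat and mouse chain of the reflected walk on $\mathbb N$: $p(x,x+1)=p$ for $x\ge 0$, $p(x,x-1)=1-p$ for $x\ge1$, $p(0,0)=1-p$. Put $$s_1=\inf\{\ell\ge0: C_\ell=M_\ell\},\quad t_1=\inf\{\ell\ge s_1: C_\ell=0\},\quad s_2=\inf\{\ell\ge t_1: C_\ell=M_\ell\}.$$ Let $(C'_k,M'_k)$ be the cat and mouse chain of the free walk on $\mathbb Z$, $p'(x,x+1)=p=1-p'(x,x-1)$, started at $(0,0)$, and let $M'_\infty=\lim_{k\to\infty}M'_k$; this limit exists almost surely. Let $E_1,E_2$ be exponential random variables with mean $(1+\rho)/(1-\rho)^2$ (that is, of rate $(1-\rho)^2/(1+\rho)$), such that $M'_\infty,E_1,E_2$ are independent. Start the first chain from $C_0=0$, $M_0=n$.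 Then $s_1,t_1,s_2$ are almost surely finite and, as $n\to\infty$: (i) $(M_{t_1}-n,\ \rho^n t_1)$ converges in distribution to $(M'_\infty,E_1)$; (ii) the process $$\left(\frac{M_{\lfloor t\rho^{-n}\rfloor}}{n}\,\mathbf 1_{\{t<\rho^n s_2\}}\right)$$ converges in distribution, for the Skorohod topology, to the process $\left(\mathbf 1_{\{t<E_1+\rho^{-M'_\infty}E_2\}}\right)$, both on $D([0,\infty),\mathbb R)$ and on $D([0,T],\mathbb R)$ for every $T>0$. -/

import Mathlib

open MeasureTheory ProbabilityTheory Filter Topology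
open scoped ENNReal

namespace CatMouse

/-! ### Markov chains and the cat and mouse dynamics -/

/-- `X` is a Markov chain on the countable space `S` with transition matrix `Q` and initial
state `x₀`: the finite-dimensional laws are the products of the transition probabilities. -/
structure IsMarkovChain {S Ω : Type*} [DecidableEq S] [MeasurableSpace S] [MeasurableSpace Ω]
    (μ : Measure Ω) (Q : S → S → ℝ) (x₀ : S) (X : ℕ → Ω → S) : Prop where
  measurable : ∀ k, Measurable (X k)
  law : ∀ (k : ℕ) (x : ℕ → S), μ.real {ω | ∀ i ≤ k, X i ω = x i} =
    (if x 0 = x₀ then 1 else 0) * ∏ i ∈ Finset.range k, Q (x i) (x (i + 1))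

/-- The transition matrix of the cat and mouse chain (first coordinate: the cat, second
coordinate: the mouse) associated with the transition matrix `P` of the cat. -/
def catMouse {S : Type*} [DecidableEq S] (P : S → S → ℝ) (a b : S × S) : ℝ :=
  if a.1 = a.2 then P a.1 b.1 * P a.1 b.2
  else if b.2 = a.2 then P a.1 b.1 else 0

/-- The simple random walk on `ℕ` reflected at `0`. -/
def reflectedWalk (p : ℝ) (x y : ℕ) : ℝ :=
  if y = x + 1 then p
  else if y + 1 = x then 1 - p
  else if x = 0 ∧ y = 0 then 1 - p
  else 0

/-- The simple random walk on `ℤ` without reflection. -/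
def freeWalk (p : ℝ) (x y : ℤ) : ℝ :=
  if y = x + 1 then p
  else if y = x - 1 then 1 - p
  else 0

/-- The ratio `ρ = p / (1 - p)`. -/
noncomputable def rho (p : ℝ) : ℝ := p / (1 - p)

theorem rho_nonneg {p : ℝ} (hp : 0 < p) (hp' : p < 1 / 2) : 0 ≤ rho p :=
  div_nonneg hp.le (by linarith)

/-- The asymptotic location `lim_k Y_k` of an integer-valued sequence of random variables. -/
noncomputable def asymptoticLocation {Ω : Type*} (Y : ℕ → Ω → ℤ) (ω : Ω) : ℤ :=
  limUnder atTop (fun k => Y k ω)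

/-! ### The successive meeting times and return times to the origin -/

/-- `inf {ℓ ≥ a : A ℓ}`, with value `∞` when there is no such `ℓ`. -/
noncomputable def firstFrom (A : ℕ → Prop) (a : ℕ∞) : ℕ∞ :=
  ⨅ (ℓ : ℕ) (_ : a ≤ (ℓ : ℕ∞) ∧ A ℓ), (ℓ : ℕ∞)

/-- `s₁ = inf {ℓ ≥ 0 : C_ℓ = M_ℓ}` for the trajectory `w = (C, M)`. -/
noncomputable def s₁ (w : ℕ → ℕ × ℕ) : ℕ∞ := firstFrom (fun ℓ => (w ℓ).1 = (w ℓ).2) 0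

/-- `t₁ = inf {ℓ ≥ s₁ : C_ℓ = 0}`. -/
noncomputable def t₁ (w : ℕ → ℕ × ℕ) : ℕ∞ := firstFrom (fun ℓ => (w ℓ).1 = 0) (s₁ w)

/-- `s₂ = inf {ℓ ≥ t₁ : C_ℓ = M_ℓ}`. -/
noncomputable def s₂ (w : ℕ → ℕ × ℕ) : ℕ∞ := firstFrom (fun ℓ => (w ℓ).1 = (w ℓ).2) (t₁ w)

/-! ### The Skorohod space -/

/-- Right-continuous functions with left limits on the time set `I ⊆ ℝ`. -/
def IsCadlag {I : Set ℝ} (x : I → ℝ) : Prop :=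
  ∀ t : I, ContinuousWithinAt x (Set.Ici t) t ∧ ∃ l : ℝ, Tendsto x (𝓝[<] t) (𝓝 l)

/-- The Skorohod space `D(I, ℝ)`. It is used for `I = [0, ∞)` and for `I = [0, T]`. -/
structure SkorohodSpace (I : Set ℝ) where
  toFun : I → ℝ
  isCadlag : IsCadlag toFun

/-- `y` is `ε`-close to `x` on the times at most `m`: for some increasing bijection `φ` of `I`
whose slopes lie between `exp (-ε)` and `exp ε`, one has `|y t - x (φ t)| ≤ ε` for all
`t ∈ I` with `t ≤ m`. -/
def SkorohodSpace.Close {I : Set ℝ} (m ε : ℝ) (x y : SkorohodSpace I) : Prop :=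
  ∃ φ : I ≃o I,
    (∀ s t : I, s < t → |Real.log (((φ t : ℝ) - φ s) / ((t : ℝ) - s))| ≤ ε) ∧
    ∀ t : I, (t : ℝ) ≤ m → |y.toFun t - x.toFun (φ t)| ≤ ε

theorem SkorohodSpace.Close.anti {I : Set ℝ} {m m' ε ε' : ℝ} (hm : m ≤ m') (hε : ε' ≤ ε)
    {x y : SkorohodSpace I} (h : SkorohodSpace.Close m' ε' x y) :
    SkorohodSpace.Close m ε x y := by
  obtain ⟨φ, h₁, h₂⟩ := h
  exact ⟨φ, fun s t hst => (h₁ s t hst).trans hε, fun t ht => (h₂ t (ht.trans hm)).trans hε⟩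

/-- The Skorohod (J1) topology: the sets `{y | Close m ε x y}`, for `m` large and `ε > 0` small,
form a basis of neighbourhoods of `x`. For `I = [0, T]` it is the topology of Billingsley's
metric, the infimum over `φ` of `sup |log slope of φ| + sup |x ∘ φ - y|`. For `I = [0, ∞)` it is
the usual topology of `D([0, ∞), ℝ)`, with uniform closeness up to a time change on each
bounded interval. -/
instance SkorohodSpace.instTopologicalSpace (I : Set ℝ) :
    TopologicalSpace (SkorohodSpace I) where
  IsOpen U := ∀ x ∈ U, ∃ m ε : ℝ, 0 < ε ∧ ∀ y, SkorohodSpace.Close m ε x y → y ∈ U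
  isOpen_univ := fun _ _ => ⟨0, 1, one_pos, fun _ _ => Set.mem_univ _⟩
  isOpen_inter := by
    rintro U V hU hV x ⟨hxU, hxV⟩
    obtain ⟨m, ε, hε, h⟩ := hU x hxU
    obtain ⟨m', ε', hε', h'⟩ := hV x hxV
    exact ⟨max m m', min ε ε', lt_min hε hε', fun y hy =>
      ⟨h y (hy.anti (le_max_left _ _) (min_le_left _ _)),
        h' y (hy.anti (le_max_right _ _) (min_le_right _ _))⟩⟩
  isOpen_sUnion := by
    rintro 𝒰 h𝒰 x ⟨U, hU, hx⟩
    obtain ⟨m, ε, hε, h⟩ := h𝒰 U hU x hx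
    exact ⟨m, ε, hε, fun y hy => ⟨U, hU, h y hy⟩⟩

instance SkorohodSpace.instMeasurableSpace (I : Set ℝ) : MeasurableSpace (SkorohodSpace I) :=
  borel _

instance SkorohodSpace.instBorelSpace (I : Set ℝ) : BorelSpace (SkorohodSpace I) := ⟨rfl⟩

/-! ### The two processes -/

theorem isCadlag_restrict {x : ℝ → ℝ}
    (hx : ∀ t, (∀ᶠ u in 𝓝[≥] t, x u = x t) ∧ ∃ l, ∀ᶠ u in 𝓝[<] t, x u = l) (I : Set ℝ) :
    IsCadlag (fun t : I => x t) := by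
  intro t
  obtain ⟨h₁, l, h₂⟩ := hx t
  have hc : Tendsto (fun u : I => (u : ℝ)) (𝓝 t) (𝓝 (t : ℝ)) := continuous_subtype_val.tendsto t
  have hr : Tendsto (fun u : I => (u : ℝ)) (𝓝[≥] t) (𝓝[≥] (t : ℝ)) :=
    tendsto_nhdsWithin_iff.2 ⟨hc.mono_left nhdsWithin_le_nhds,
      eventually_mem_nhdsWithin.mono fun u hu => hu⟩
  have hl : Tendsto (fun u : I => (u : ℝ)) (𝓝[<] t) (𝓝[<] (t : ℝ)) :=
    tendsto_nhdsWithin_iff.2 ⟨hc.mono_left nhdsWithin_le_nhds,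
      eventually_mem_nhdsWithin.mono fun u hu => hu⟩
  exact ⟨tendsto_const_nhds.congr' ((hr.eventually h₁).mono fun u hu => hu.symm),
    l, tendsto_const_nhds.congr' ((hl.eventually h₂).mono fun u hu => hu.symm)⟩

open Classical in
/-- `1{t < b}` for an extended real number `b`. -/
noncomputable def indicatorLT (b : EReal) (t : ℝ) : ℝ := if (t : EReal) < b then 1 else 0

theorem indicatorLT_locallyConstant (b : EReal) (t : ℝ) :
    (∀ᶠ u in 𝓝[≥] t, indicatorLT b u = indicatorLT b t) ∧
      ∃ l, ∀ᶠ u in 𝓝[<] t, indicatorLT b u = l := by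
  have hc : Tendsto (fun u : ℝ => (u : EReal)) (𝓝 t) (𝓝 (t : EReal)) :=
    continuous_coe_real_ereal.tendsto t
  constructor
  · by_cases h : (t : EReal) < b
    · filter_upwards [nhdsWithin_le_nhds (hc.eventually (gt_mem_nhds h))] with u hu
      simp [indicatorLT, h, hu]
    · filter_upwards [eventually_mem_nhdsWithin] with u hu
      have : ¬ (u : EReal) < b :=
        not_lt.2 ((not_lt.1 h).trans (EReal.coe_le_coe_iff.2 hu))
      simp [indicatorLT, h, this]
  · by_cases h : (t : EReal) ≤ b
    · refine ⟨1, ?_⟩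
      filter_upwards [eventually_mem_nhdsWithin] with u hu
      have : (u : EReal) < b := lt_of_lt_of_le (EReal.coe_lt_coe_iff.2 hu) h
      simp [indicatorLT, this]
    · refine ⟨0, ?_⟩
      filter_upwards [nhdsWithin_le_nhds (hc.eventually (lt_mem_nhds (not_le.1 h)))] with u hu
      simp [indicatorLT, hu.le]

theorem floor_locallyConstant {a : ℝ} (ha : 0 ≤ a) (t : ℝ) :
    (∀ᶠ u in 𝓝[≥] t, ⌊u / a⌋₊ = ⌊t / a⌋₊) ∧ ∃ k, ∀ᶠ u in 𝓝[<] t, ⌊u / a⌋₊ = k := by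
  rcases ha.eq_or_lt with rfl | ha
  · simp
  have hc : Tendsto (fun u : ℝ => u / a) (𝓝 t) (𝓝 (t / a)) :=
    (continuous_id.div_const a).tendsto t
  have hr : Tendsto (fun u : ℝ => u / a) (𝓝[≥] t) (𝓝[≥] (t / a)) :=
    tendsto_nhdsWithin_iff.2 ⟨hc.mono_left nhdsWithin_le_nhds,
      eventually_mem_nhdsWithin.mono fun u hu => div_le_div_of_nonneg_right hu ha.le⟩
  have hl : Tendsto (fun u : ℝ => u / a) (𝓝[<] t) (𝓝[<] (t / a)) :=
    tendsto_nhdsWithin_iff.2 ⟨hc.mono_left nhdsWithin_le_nhds,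
      eventually_mem_nhdsWithin.mono fun u hu => div_lt_div_of_pos_right hu ha⟩
  refine ⟨?_, (⌈t / a⌉ - 1).toNat, ?_⟩
  · filter_upwards [hr.eventually (tendsto_pure.1 (tendsto_floor_right_pure_floor (t / a)))]
      with u hu
    rw [← Int.floor_toNat, ← Int.floor_toNat, hu]
  · filter_upwards
      [hl.eventually (tendsto_pure.1 (tendsto_floor_left_pure_ceil_sub_one (t / a)))] with u hu
    rw [← Int.floor_toNat, hu]

/-- The process `t ↦ 1{t < z}` on the time set `I`. -/
noncomputable def indicatorPath (I : Set ℝ) (z : ℝ) : SkorohodSpace I where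
  toFun t := indicatorLT (z : EReal) t
  isCadlag := isCadlag_restrict (indicatorLT_locallyConstant z) I

/-- The process `t ↦ (M_{⌊t r⁻ⁿ⌋} / n) 1{t < rⁿ s₂}` on the time set `I`, for the trajectory
`w = (C, M)`. -/
noncomputable def scaledMousePath (I : Set ℝ) (r : ℝ) (hr : 0 ≤ r) (n : ℕ) (w : ℕ → ℕ × ℕ) :
    SkorohodSpace I where
  toFun t := ((w ⌊(t : ℝ) / r ^ n⌋₊).2 : ℝ) / n *
    indicatorLT (((r ^ n : ℝ) : EReal) * ((s₂ w : ℝ≥0∞) : EReal)) t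
  isCadlag := by
    refine isCadlag_restrict (x := fun t => ((w ⌊t / r ^ n⌋₊).2 : ℝ) / n *
      indicatorLT (((r ^ n : ℝ) : EReal) * ((s₂ w : ℝ≥0∞) : EReal)) t) (fun t => ?_) I
    obtain ⟨h₁, k, h₂⟩ := floor_locallyConstant (pow_nonneg hr n) t
    obtain ⟨h₃, l, h₄⟩ :=
      indicatorLT_locallyConstant (((r ^ n : ℝ) : EReal) * ((s₂ w : ℝ≥0∞) : EReal)) t
    refine ⟨?_, ((w k).2 : ℝ) / n * l, ?_⟩
    · filter_upwards [h₁, h₃] with u hu hu'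
      rw [hu, hu']
    · filter_upwards [h₂, h₄] with u hu hu'
      rw [hu, hu']

end CatMouse

set_option linter.unusedSectionVars false

/-! The cat drifts towards 0, so from 0 it needs a time of order `ρ^{-n}` to climb to a mouse at
`n`. On that scale the excursion of the cat from `s₁` to `t₁` is instantaneous, and outside it the
mouse stands still until `s₂`.

Hitting times. Let `u_k(ζ)` solve `p u_{k+1} + (1-p) u_{k-1} = ζ u_k` with reflection at 0 and `u_0
= 1`. Until the meeting `z^k u_{C_k}(1/z)` is a martingale, so `E z^{s₁} = 1/u_n(1/z)`
(`integral_hit_transform`). Summing the recursion against the reversible weights `ρ^j` shows that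
`u_n(ζ_n) → 1 + α(1+ρ)/(1-ρ)²` when `ζ_n - 1 ~ α ρ^n` (`tendsto_hitPoly`); for `α = -iθ` this is the
reciprocal of an exponential characteristic function.

Few meetings. A positive function `h` of the difference `C - M` is contracted in mean by a factor `γ
< 1` at each step, meetings included (`exists_contracted_potential`). So a meeting `k` steps after
`s₁` and before `t₁` has probability at most `γ^k`, and the free chain obeys the same bound. The cat
needs at least `n` steps to go from `n` to 0; hence, up to probability `O(γ^n)`, `M_{t₁}` is the
position of the mouse at time `s₁ + n`. During these `n` steps the reflection is not felt, so the
displacement has the law of `M'_n`, which is close to `M'_∞`. The state at `s₁` is the constant `(n,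
n)`, so the displacement is independent of `s₁`; and `t₁ - s₁`, of mean at most `n/(1-2p)`, is
negligible against `ρ^{-n}` (`norm_integral_t₁_sub_le`).

Second cycle. Given the past of `t₁`, the time `s₂ - t₁` is the hitting time of height `M_{t₁} = n +
j` from 0. Since `ρ^n = ρ^{-j} ρ^{n+j}`, rescaling by `ρ^n` yields `ρ^{-j} E₂` in the limit.
`tendsto_joint_transform` gathers the three facts, and Lévy's theorem gives convergence of `(M_{t₁}
- n, ρ^n t₁)` and of `ρ^n s₂`.

Paths. Outside an event of probability `O(γ^K)` the mouse stays within `K` of `n` until `s₂`, so the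
process is uniformly close to `1{t < ρ^n s₂}`. The map `z ↦ 1{t < z}` is Skorohod-continuous at
every `z > 0` (with `z ≠ T` on `[0, T]`), and the limit of `ρ^n s₂` has no atoms, so convergence
passes to paths (`tendstoInDistribution_indicatorPath`). -/

namespace CatMouse

/-! ### Integrals over the fibres of a discrete variable -/

section Fibers

variable {Ω ι : Type*} [MeasurableSpace Ω] {μ : Measure Ω} [Countable ι] [MeasurableSpace ι]
  [MeasurableSingletonClass ι]

theorem hasSum_setIntegral_fiber {E : Type*} [NormedAddCommGroup E] [NormedSpace ℝ E]
    {τ : Ω → ι} (hτ : Measurable τ) {F : Ω → E} (hF : Integrable F μ) :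
    HasSum (fun i => ∫ ω in τ ⁻¹' {i}, F ω ∂μ) (∫ ω, F ω ∂μ) := by
  have h := hasSum_integral_iUnion (μ := μ) (f := F) (s := fun i => τ ⁻¹' {i})
    (fun i => hτ (measurableSet_singleton i))
    (fun i j hij => Disjoint.preimage _ (by simpa using hij)) hF.integrableOn
  have hu : ⋃ i, τ ⁻¹' {i} = Set.univ := by ext; simp
  rwa [hu, setIntegral_univ] at h

/-- Plays the role of conditioning: every variable conditioned upon below is discrete, so comparing
integrals on its fibres replaces conditional expectations. -/
theorem integral_eq_of_fiber {E : Type*} [NormedAddCommGroup E] [NormedSpace ℝ E]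
    {τ : Ω → ι} (hτ : Measurable τ) {F F' : Ω → E} (hF : Integrable F μ) (hF' : Integrable F' μ)
    (h : ∀ i, ∫ ω in τ ⁻¹' {i}, F ω ∂μ = ∫ ω in τ ⁻¹' {i}, F' ω ∂μ) :
    ∫ ω, F ω ∂μ = ∫ ω, F' ω ∂μ := by
  rw [← (hasSum_setIntegral_fiber hτ hF).tsum_eq, ← (hasSum_setIntegral_fiber hτ hF').tsum_eq]
  exact tsum_congr h

theorem integral_le_of_fiber {τ : Ω → ι} (hτ : Measurable τ) {F F' : Ω → ℝ}
    (hF : Integrable F μ) (hF' : Integrable F' μ)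
    (h : ∀ i, ∫ ω in τ ⁻¹' {i}, F ω ∂μ ≤ ∫ ω in τ ⁻¹' {i}, F' ω ∂μ) :
    ∫ ω, F ω ∂μ ≤ ∫ ω, F' ω ∂μ :=
  hasSum_le h (hasSum_setIntegral_fiber hτ hF) (hasSum_setIntegral_fiber hτ hF')

end Fibers

/-! ### Functionals of finitely many coordinates -/

section Trajectories

variable {S Ω : Type*} [Countable S] [MeasurableSpace S] [MeasurableSingletonClass S]
  [MeasurableSpace Ω] {X : ℕ → Ω → S}

/-- Such a functional factors through a countable discrete space, so the σ-algebra of the target is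
irrelevant. This later covers path-valued functionals. -/
theorem measurable_of_dependsOn {β : Type*} [MeasurableSpace β] (hX : ∀ k, Measurable (X k))
    {G : (ℕ → S) → β} {a : ℕ} (hG : DependsOn G (Set.Iic a)) :
    Measurable (fun ω => G (fun k => X k ω)) := by
  -- Coordinates beyond `a` are filled with coordinate `a`; `G` does not see them.
  let g : (Fin (a + 1) → S) → β := fun v => G (fun k => v ⟨min k a, by omega⟩)
  have hg : Measurable g := Measurable.of_discrete
  have hr : Measurable (fun ω => (fun i : Fin (a + 1) => X i ω)) :=
    measurable_pi_lambda _ fun i => hX i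
  have he : (fun ω => G (fun k => X k ω)) = fun ω => g (fun i : Fin (a + 1) => X i ω) := by
    funext ω
    refine hG fun k hk => ?_
    simp [min_eq_left (Set.mem_Iic.1 hk)]
  rw [he]
  exact hg.comp hr

theorem measurableSet_of_dependsOn (hX : ∀ k, Measurable (X k))
    {A : (ℕ → S) → Prop} {a : ℕ} (hA : DependsOn A (Set.Iic a)) :
    MeasurableSet {ω | A (fun k => X k ω)} :=
  measurableSet_setOfPred.2 (measurable_of_dependsOn hX hA)

end Trajectories

/-! ### The Markov property -/

section Markov

variable {S Ω : Type*} [DecidableEq S] [Countable S] [MeasurableSpace S]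
  [MeasurableSingletonClass S] [MeasurableSpace Ω] {μ : Measure Ω} {Q : S → S → ℝ} {x₀ : S}
  {X : ℕ → Ω → S}

namespace IsMarkovChain

theorem ae_init (h : IsMarkovChain μ Q x₀ X) [IsProbabilityMeasure μ] :
    ∀ᵐ ω ∂μ, X 0 ω = x₀ := by
  have h0 := h.law 0 (fun _ => x₀)
  have hm : MeasurableSet {ω | X 0 ω = x₀} := h.measurable 0 (measurableSet_singleton x₀)
  have : {ω | ∀ i ≤ 0, X i ω = x₀} = {ω | X 0 ω = x₀} := by ext; simp
  rw [this] at h0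
  have h1 : μ.real {ω | X 0 ω = x₀} = 1 := by simpa using h0
  have h2 : μ {ω | X 0 ω = x₀} = 1 := by
    rw [← ofReal_measureReal, h1, ENNReal.ofReal_one]
  exact mem_ae_iff.2 ((prob_compl_eq_zero_iff hm).2 h2)

theorem law_succ (h : IsMarkovChain μ Q x₀ X) (k : ℕ) (x : ℕ → S) (y : S) :
    μ.real {ω | (∀ i ≤ k, X i ω = x i) ∧ X (k + 1) ω = y} =
      μ.real {ω | ∀ i ≤ k, X i ω = x i} * Q (x k) y := by
  have h1 := h.law (k + 1) (Function.update x (k + 1) y)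
  have he : {ω | ∀ i ≤ k + 1, X i ω = Function.update x (k + 1) y i} =
      {ω | (∀ i ≤ k, X i ω = x i) ∧ X (k + 1) ω = y} := by
    ext ω
    simp only [Set.mem_ofPred_eq]
    constructor
    · intro hw
      refine ⟨fun i hi => ?_, by simpa using hw (k + 1) le_rfl⟩
      simpa [Function.update_of_ne (show i ≠ k + 1 by omega)] using hw i (by omega)
    · rintro ⟨hw, hy⟩ i hi
      rcases hi.eq_or_lt with rfl | hi
      · simpa using hy
      · simpa [Function.update_of_ne hi.ne] using hw i (by omega)
  rw [he] at h1
  rw [h1, h.law k x, Finset.prod_range_succ, ← mul_assoc]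
  have hp : ∏ i ∈ Finset.range k, Q (Function.update x (k + 1) y i)
      (Function.update x (k + 1) y (i + 1)) = ∏ i ∈ Finset.range k, Q (x i) (x (i + 1)) := by
    refine Finset.prod_congr rfl fun i hi => ?_
    have := Finset.mem_range.1 hi
    rw [Function.update_of_ne (by omega), Function.update_of_ne (by omega)]
  rw [hp, Function.update_of_ne (by omega), Function.update_of_ne (by omega),
    Function.update_self]

theorem measurableSet_path (h : IsMarkovChain μ Q x₀ X) (k : ℕ) (x : ℕ → S) :
    MeasurableSet {ω | ∀ i ≤ k, X i ω = x i} := by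
  refine measurableSet_of_dependsOn (A := fun w => ∀ i ≤ k, w i = x i) (a := k) h.measurable ?_
  intro w w' hw
  simp only [eq_iff_iff]
  exact forall₂_congr fun i hi => by rw [hw i hi]

variable [IsProbabilityMeasure μ] {N : S → Finset S}

/-- The transitions into `N x` already carry total mass one, so after each finite path no
probability is left for other states. -/
theorem ae_step (h : IsMarkovChain μ Q x₀ X) (hN : ∀ x, ∑ y ∈ N x, Q x y = 1) :
    ∀ᵐ ω ∂μ, ∀ k, X (k + 1) ω ∈ N (X k ω) := by
  rw [ae_all_iff]
  intro k
  have key : ∀ v : Fin (k + 1) → S, ∀ᵐ ω ∂μ,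
      (∀ i : Fin (k + 1), X i ω = v i) → X (k + 1) ω ∈ N (X k ω) := by
    intro v
    let x : ℕ → S := fun i => v ⟨min i k, by omega⟩
    set A := {ω | ∀ i ≤ k, X i ω = x i}
    have hA : MeasurableSet A := h.measurableSet_path k x
    have hB : MeasurableSet {ω | X (k + 1) ω ∈ N (x k)} :=
      h.measurable (k + 1) (N (x k)).measurableSet
    have h1 : μ.real (A ∩ {ω | X (k + 1) ω ∈ N (x k)}) = μ.real A := by
      have : A ∩ {ω | X (k + 1) ω ∈ N (x k)} = ⋃ y ∈ N (x k),
          {ω | (∀ i ≤ k, X i ω = x i) ∧ X (k + 1) ω = y} := by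
        ext ω; simp [A]
      rw [this, measureReal_biUnion_finset]
      · simp_rw [h.law_succ k x, ← Finset.mul_sum, hN, mul_one]
        rfl
      · intro y _ y' _ hyy
        refine Set.disjoint_left.2 fun ω hω hω' => hyy (hω.2.symm.trans hω'.2)
      · exact fun y _ => hA.inter (h.measurable (k + 1) (measurableSet_singleton y))
    have h2 := measureReal_inter_add_sdiff (μ := μ) (s := A) hB
    have h3 : μ.real (A \ {ω | X (k + 1) ω ∈ N (x k)}) = 0 := by linarith
    rw [measureReal_eq_zero_iff] at h3
    refine (measure_eq_zero_iff_ae_notMem.1 h3).mono fun ω hω hv => ?_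
    have hx : ∀ i ≤ k, X i ω = x i := fun i hi => by
      have := hv ⟨i, by omega⟩
      simpa [x, min_eq_left hi] using this
    by_contra hc
    exact hω ⟨hx, by simpa [hx k le_rfl] using hc⟩
  filter_upwards [ae_all_iff.2 key] with ω hω
  exact hω (fun i => X i ω) (fun i => rfl)

/-- Finite support at each time makes every functional of the past almost surely bounded. Unbounded
test functions such as `r ^ c` or `u_c` therefore need no moment estimate. -/
theorem exists_finset (h : IsMarkovChain μ Q x₀ X) (hN : ∀ x, ∑ y ∈ N x, Q x y = 1) (k : ℕ) :
    ∃ R : Finset S, ∀ᵐ ω ∂μ, X k ω ∈ R := by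
  induction k with
  | zero => exact ⟨{x₀}, h.ae_init.mono fun ω hω => by simp [hω]⟩
  | succ k ih =>
    obtain ⟨R, hR⟩ := ih
    refine ⟨R.biUnion N, ?_⟩
    filter_upwards [hR, h.ae_step hN] with ω h1 h2
    exact Finset.mem_biUnion.2 ⟨_, h1, h2 k⟩

theorem exists_bound (h : IsMarkovChain μ Q x₀ X) (hN : ∀ x, ∑ y ∈ N x, Q x y = 1)
    {E : Type*} [NormedAddCommGroup E] {G : (ℕ → S) → E} {a : ℕ} (hG : DependsOn G (Set.Iic a)) :
    ∃ C : ℝ, ∀ᵐ ω ∂μ, ‖G (fun k => X k ω)‖ ≤ C := by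
  choose R hR using h.exists_finset hN
  let P : Finset (Fin (a + 1) → S) := Fintype.piFinset fun i => R i
  let g : (Fin (a + 1) → S) → E := fun v => G (fun k => v ⟨min k a, by omega⟩)
  refine ⟨∑ v ∈ P, ‖g v‖, ?_⟩
  filter_upwards [ae_all_iff.2 hR] with ω hω
  have he : G (fun k => X k ω) = g (fun i : Fin (a + 1) => X i ω) := by
    refine hG fun k hk => ?_
    simp [min_eq_left (Set.mem_Iic.1 hk)]
  rw [he]
  exact Finset.single_le_sum (f := fun v => ‖g v‖) (fun v _ => norm_nonneg _)
    (Fintype.mem_piFinset.2 fun i => hω i)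

theorem integrable (h : IsMarkovChain μ Q x₀ X) (hN : ∀ x, ∑ y ∈ N x, Q x y = 1)
    {E : Type*} [NormedAddCommGroup E] [MeasurableSpace E] [BorelSpace E]
    [SecondCountableTopology E] {G : (ℕ → S) → E} {a : ℕ} (hG : DependsOn G (Set.Iic a)) :
    Integrable (fun ω => G (fun k => X k ω)) μ := by
  obtain ⟨C, hC⟩ := h.exists_bound hN hG
  exact Integrable.of_bound (measurable_of_dependsOn h.measurable hG).aestronglyMeasurable C hC

variable {𝕜 : Type*} [RCLike 𝕜]

theorem setIntegral_path_succ (h : IsMarkovChain μ Q x₀ X) (hN : ∀ x, ∑ y ∈ N x, Q x y = 1)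
    (k : ℕ) (x : ℕ → S) (f : S → 𝕜) :
    ∫ ω in {ω | ∀ i ≤ k, X i ω = x i}, f (X (k + 1) ω) ∂μ =
      (μ.real {ω | ∀ i ≤ k, X i ω = x i} : 𝕜) * ∑ y ∈ N (x k), (Q (x k) y : 𝕜) * f y := by
  have hA := h.measurableSet_path k x
  set A := {ω | ∀ i ≤ k, X i ω = x i}
  have h1 : ∫ ω in A, f (X (k + 1) ω) ∂μ =
      ∫ ω in A, ∑ y ∈ N (x k), {ω | X (k + 1) ω = y}.indicator (fun _ => f y) ω ∂μ := by
    refine setIntegral_congr_ae hA ?_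
    filter_upwards [h.ae_step hN] with ω hω hωA
    have hm := hω k
    rw [hωA k le_rfl] at hm
    rw [Finset.sum_eq_single_of_mem _ hm]
    · simp
    · intro y _ hy
      simp [hy.symm]
  rw [h1, integral_finsetSum, Finset.mul_sum]
  · refine Finset.sum_congr rfl fun y _ => ?_
    have hy : MeasurableSet {ω | X (k + 1) ω = y} :=
      h.measurable (k + 1) (measurableSet_singleton y)
    rw [setIntegral_indicator hy, setIntegral_const, RCLike.real_smul_eq_coe_mul, ← mul_assoc]
    congr 1
    rw [← RCLike.ofReal_mul, ← h.law_succ k x y]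
    rfl
  · intro y _
    exact (integrable_const _).indicator (h.measurable (k + 1) (measurableSet_singleton y))

/-- The past up to `a` is discrete and `G` is constant on each of its fibres, where the claim is the
one-step law. -/
theorem integral_succ (h : IsMarkovChain μ Q x₀ X) (hN : ∀ x, ∑ y ∈ N x, Q x y = 1)
    {a : ℕ} {G : (ℕ → S) → 𝕜} (hG : DependsOn G (Set.Iic a)) (f : S → 𝕜) :
    ∫ ω, G (fun k => X k ω) * f (X (a + 1) ω) ∂μ =
      ∫ ω, G (fun k => X k ω) * ∑ y ∈ N (X a ω), (Q (X a ω) y : 𝕜) * f y ∂μ := by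
  let : MeasurableSpace 𝕜 := borel 𝕜
  have : BorelSpace 𝕜 := ⟨rfl⟩
  have hr : Measurable (fun ω => (fun i : Fin (a + 1) => X i ω)) :=
    measurable_pi_lambda _ fun i => h.measurable i
  refine integral_eq_of_fiber hr ?_ ?_ fun v => ?_
  · refine h.integrable hN (G := fun w => G w * f (w (a + 1))) (a := a + 1) fun w w' hw => ?_
    simp only
    rw [hG fun i hi => hw i (Set.mem_Iic.2 (by have := Set.mem_Iic.1 hi; omega)),
      hw (a + 1) (Set.mem_Iic.2 le_rfl)]
  · refine h.integrable hN (G := fun w => G w * ∑ y ∈ N (w a), (Q (w a) y : 𝕜) * f y) (a := a)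
      fun w w' hw => ?_
    simp only
    rw [hG hw, hw a (Set.mem_Iic.2 le_rfl)]
  · let x : ℕ → S := fun i => v ⟨min i a, by omega⟩
    have hA : (fun ω => (fun i : Fin (a + 1) => X i ω)) ⁻¹' {v} =
        {ω | ∀ i ≤ a, X i ω = x i} := by
      ext ω
      simp only [Set.mem_preimage, Set.mem_singleton_iff, Set.mem_ofPred_eq, funext_iff, x]
      constructor
      · intro hw i hi
        simpa [min_eq_left hi] using hw ⟨i, by omega⟩
      · intro hw i
        simpa [min_eq_left (show (i : ℕ) ≤ a by omega)] using hw i (by omega)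
    rw [hA]
    have hA' := h.measurableSet_path a x
    have e1 : ∫ ω in {ω | ∀ i ≤ a, X i ω = x i}, G (fun k => X k ω) * f (X (a + 1) ω) ∂μ =
        ∫ ω in {ω | ∀ i ≤ a, X i ω = x i}, G x * f (X (a + 1) ω) ∂μ := by
      refine setIntegral_congr_fun hA' fun ω hω => ?_
      rw [hG (y := x) fun i hi => hω i hi]
    have e2 : ∫ ω in {ω | ∀ i ≤ a, X i ω = x i},
        G (fun k => X k ω) * ∑ y ∈ N (X a ω), (Q (X a ω) y : 𝕜) * f y ∂μ =
        ∫ ω in {ω | ∀ i ≤ a, X i ω = x i}, G x * ∑ y ∈ N (x a), (Q (x a) y : 𝕜) * f y ∂μ := by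
      refine setIntegral_congr_fun hA' fun ω hω => ?_
      rw [hG (y := x) fun i hi => hω i hi, hω a le_rfl]
    rw [e1, e2, integral_const_mul, h.setIntegral_path_succ hN, setIntegral_const,
      RCLike.real_smul_eq_coe_mul]
    ring

end IsMarkovChain
end Markov

/-! ### First visit times -/

section FirstFrom

theorem le_firstFrom_iff {A : ℕ → Prop} {a k : ℕ∞} :
    k ≤ firstFrom A a ↔ ∀ j : ℕ, a ≤ j → A j → k ≤ j := by
  simp [firstFrom, le_iInf_iff]

theorem le_firstFrom (A : ℕ → Prop) (a : ℕ∞) : a ≤ firstFrom A a :=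
  le_firstFrom_iff.2 fun _ h _ => h

theorem firstFrom_le {A : ℕ → Prop} {a : ℕ∞} {ℓ : ℕ} (h : a ≤ ℓ) (hA : A ℓ) :
    firstFrom A a ≤ ℓ := le_firstFrom_iff.1 le_rfl ℓ h hA

theorem lt_firstFrom_iff {A : ℕ → Prop} {a : ℕ∞} {k : ℕ} :
    (k : ℕ∞) < firstFrom A a ↔ ∀ j : ℕ, a ≤ j → j ≤ k → ¬ A j := by
  rw [← ENat.add_one_le_iff (ENat.natCast_ne_top k), le_firstFrom_iff]
  refine forall₂_congr fun j _ => ?_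
  have : ((k : ℕ∞) + 1 ≤ j) ↔ k + 1 ≤ j := by exact_mod_cast Iff.rfl
  rw [this]
  constructor
  · intro h hj hA
    have := h hA
    omega
  · intro h hA
    by_contra hc
    exact h (by omega) hA

theorem firstFrom_eq_coe_iff {A : ℕ → Prop} {a : ℕ∞} {ℓ : ℕ} :
    firstFrom A a = ℓ ↔ a ≤ ℓ ∧ A ℓ ∧ ∀ j : ℕ, a ≤ j → j < ℓ → ¬ A j := by
  constructor
  · intro h
    have h1 : a ≤ ℓ := h ▸ le_firstFrom A a
    have h3 : ∀ j : ℕ, a ≤ j → j < ℓ → ¬ A j := by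
      intro j hj hjl hA
      have := firstFrom_le hj hA
      rw [h] at this
      have : ℓ ≤ j := by exact_mod_cast this
      omega
    refine ⟨h1, ?_, h3⟩
    by_contra hc
    have : (ℓ : ℕ∞) < firstFrom A a := lt_firstFrom_iff.2 fun j hj hjl hA => by
      rcases hjl.eq_or_lt with rfl | hlt
      · exact hc hA
      · exact h3 j hj hlt hA
    rw [h] at this
    exact lt_irrefl _ this
  · rintro ⟨h1, h2, h3⟩
    refine le_antisymm (firstFrom_le h1 h2) (le_firstFrom_iff.2 fun j hj hA => ?_)
    by_contra hc
    exact h3 j hj (by exact_mod_cast not_le.1 hc) hA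

end FirstFrom

/-! ### Stopping times of trajectories -/

section StoppingTimes

variable {S : Type*}

/-- A time of trajectories such that the event that it equals `ℓ` is decided by time `ℓ`. -/
def IsTrajectoryStoppingTime (T : (ℕ → S) → ℕ∞) : Prop :=
  ∀ ℓ : ℕ, DependsOn (fun w => T w = ℓ) (Set.Iic ℓ)

theorem isTrajectoryStoppingTime_const (b : ℕ∞) :
    IsTrajectoryStoppingTime (fun _ : ℕ → S => b) := fun _ _ _ _ => rfl

theorem IsTrajectoryStoppingTime.firstFrom {T : (ℕ → S) → ℕ∞} (hT : IsTrajectoryStoppingTime T)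
    (D : S → Prop) : IsTrajectoryStoppingTime (fun w => firstFrom (fun ℓ => D (w ℓ)) (T w)) := by
  have key : ∀ (ℓ : ℕ) (w w' : ℕ → S), (∀ i ∈ Set.Iic ℓ, w i = w' i) →
      CatMouse.firstFrom (fun ℓ => D (w ℓ)) (T w) = ℓ →
      CatMouse.firstFrom (fun ℓ => D (w' ℓ)) (T w') = ℓ := by
    intro ℓ w w' hw h
    rw [firstFrom_eq_coe_iff] at h ⊢
    obtain ⟨h1, h2, h3⟩ := h
    -- A visit at time `ℓ` forces the earlier time `T w` to be finite and at most `ℓ`, hence decided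
    -- by the common coordinates.
    obtain ⟨b, hb⟩ := ENat.ne_top_iff_exists.1 (ne_top_of_le_ne_top (ENat.natCast_ne_top ℓ) h1)
    have hbl : b ≤ ℓ := by rw [← hb] at h1; exact_mod_cast h1
    have hT' : T w' = b := by
      have := hT b (x := w) (y := w') fun i hi => hw i (Set.mem_Iic.2 (le_trans hi hbl))
      exact (eq_iff_iff.1 this).1 hb.symm
    rw [hT']
    rw [← hb] at h1 h3
    refine ⟨h1, hw ℓ (Set.mem_Iic.2 le_rfl) ▸ h2, fun j hj hjl => ?_⟩
    rw [← hw j (Set.mem_Iic.2 hjl.le)]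
    exact h3 j hj hjl
  intro ℓ w w' hw
  exact propext ⟨key ℓ w w' hw, key ℓ w' w fun i hi => (hw i hi).symm⟩

theorem isTrajectoryStoppingTime_s₁ : IsTrajectoryStoppingTime s₁ :=
  (isTrajectoryStoppingTime_const 0).firstFrom (fun x : ℕ × ℕ => x.1 = x.2)

theorem isTrajectoryStoppingTime_t₁ : IsTrajectoryStoppingTime t₁ :=
  isTrajectoryStoppingTime_s₁.firstFrom (fun x : ℕ × ℕ => x.1 = 0)

theorem isTrajectoryStoppingTime_s₂ : IsTrajectoryStoppingTime s₂ :=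
  isTrajectoryStoppingTime_t₁.firstFrom (fun x : ℕ × ℕ => x.1 = x.2)

theorem IsTrajectoryStoppingTime.measurable_toNat {Ω : Type*} [Countable S] [MeasurableSpace S]
    [MeasurableSingletonClass S] [MeasurableSpace Ω] {X : ℕ → Ω → S} (hX : ∀ k, Measurable (X k))
    {T : (ℕ → S) → ℕ∞} (hT : IsTrajectoryStoppingTime T) :
    Measurable (fun ω => (T (fun k => X k ω)).toNat) := by
  have hm : ∀ ℓ : ℕ, MeasurableSet {ω | T (fun k => X k ω) = ℓ} := fun ℓ =>
    measurableSet_of_dependsOn hX (hT ℓ)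
  have ht : MeasurableSet {ω | T (fun k => X k ω) = ⊤} := by
    have : {ω | T (fun k => X k ω) = ⊤} = (⋃ ℓ : ℕ, {ω | T (fun k => X k ω) = ℓ})ᶜ := by
      ext ω
      simp only [Set.mem_ofPred_eq, Set.mem_compl_iff, Set.mem_iUnion]
      rw [← not_iff_not, not_not, ← ne_eq, ENat.ne_top_iff_exists]
      exact exists_congr fun _ => eq_comm
    rw [this]
    exact (MeasurableSet.iUnion hm).compl
  refine measurable_to_countable' fun ℓ => ?_
  -- `toNat` sends `⊤` to 0, so the fibre over 0 also collects the trajectories with infinite time.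
  have : (fun ω => (T (fun k => X k ω)).toNat) ⁻¹' {ℓ} =
      {ω | T (fun k => X k ω) = ℓ} ∪ ({ω | T (fun k => X k ω) = ⊤} ∩ {_ω | ℓ = 0}) := by
    ext ω
    simp only [Set.mem_preimage, Set.mem_singleton_iff, Set.mem_union, Set.mem_ofPred_eq,
      Set.mem_inter_iff]
    rcases eq_or_ne (T (fun k => X k ω)) ⊤ with h | h
    · simp [h, eq_comm]
    · obtain ⟨b, hb⟩ := ENat.ne_top_iff_exists.1 h
      rw [← hb]
      simp
  rw [this]
  exact (hm ℓ).union (ht.inter (MeasurableSet.const _))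

/-- No visit to `D` during `[a, a + K]`. -/
def Avoids (D : S → Prop) (a K : ℕ) (w : ℕ → S) : Prop := ∀ j, a ≤ j → j ≤ a + K → ¬ D (w j)

theorem dependsOn_avoids (D : S → Prop) (a K : ℕ) : DependsOn (Avoids D a K) (Set.Iic (a + K)) := by
  intro w w' hw
  refine propext (forall₃_congr fun j _ hj => ?_)
  rw [hw j (Set.mem_Iic.2 hj)]

theorem avoids_iff_lt_firstFrom {D : S → Prop} {a K : ℕ} {w : ℕ → S} :
    Avoids D a K w ↔ ((a + K : ℕ) : ℕ∞) < firstFrom (fun ℓ => D (w ℓ)) a := by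
  rw [lt_firstFrom_iff]
  simp [Avoids]

/-- The first time of `[a, a + K]` at which `D` is visited, and `a + K` if there is none. -/
noncomputable def stoppedIndex (D : S → Prop) (a K : ℕ) (w : ℕ → S) : ℕ :=
  (min (firstFrom (fun ℓ => D (w ℓ)) a) (a + K : ℕ)).toNat

theorem stoppedIndex_zero (D : S → Prop) (a : ℕ) (w : ℕ → S) : stoppedIndex D a 0 w = a := by
  rw [stoppedIndex, min_eq_right (by simpa using le_firstFrom _ _)]
  simp

theorem stoppedIndex_of_avoids {D : S → Prop} {a K : ℕ} {w : ℕ → S} (h : Avoids D a K w) :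
    stoppedIndex D a K w = a + K := by
  rw [stoppedIndex, min_eq_right (avoids_iff_lt_firstFrom.1 h).le, ENat.toNat_natCast]

theorem stoppedIndex_succ_of_avoids {D : S → Prop} {a K : ℕ} {w : ℕ → S} (h : Avoids D a K w) :
    stoppedIndex D a (K + 1) w = a + K + 1 := by
  rw [avoids_iff_lt_firstFrom, ← ENat.add_one_le_iff (ENat.natCast_ne_top _)] at h
  rw [stoppedIndex, min_eq_right (by exact_mod_cast h), ENat.toNat_natCast, add_assoc]

theorem stoppedIndex_succ_of_not_avoids {D : S → Prop} {a K : ℕ} {w : ℕ → S}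
    (h : ¬ Avoids D a K w) : stoppedIndex D a (K + 1) w = stoppedIndex D a K w := by
  rw [avoids_iff_lt_firstFrom, not_lt] at h
  rw [stoppedIndex, stoppedIndex, min_eq_left h, min_eq_left (h.trans (by norm_cast; omega))]

theorem dependsOn_stoppedIndex (D : S → Prop) (a K : ℕ) :
    DependsOn (stoppedIndex D a K) (Set.Iic (a + K)) := by
  induction K with
  | zero => intro w w' _; simp [stoppedIndex_zero]
  | succ K ih =>
    intro w w' hw
    have hw' : ∀ i ∈ Set.Iic (a + K), w i = w' i := fun i hi =>
      hw i (Set.mem_Iic.2 (le_trans (Set.mem_Iic.1 hi) (by omega)))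
    have hA := dependsOn_avoids D a K hw'
    by_cases h : Avoids D a K w
    · rw [stoppedIndex_succ_of_avoids h, stoppedIndex_succ_of_avoids (hA ▸ h)]
    · rw [stoppedIndex_succ_of_not_avoids h, stoppedIndex_succ_of_not_avoids (hA ▸ h)]
      exact ih hw'

theorem stoppedIndex_le (D : S → Prop) (a K : ℕ) (w : ℕ → S) : stoppedIndex D a K w ≤ a + K := by
  have := ENat.toNat_le_toNat (min_le_right (firstFrom (fun ℓ => D (w ℓ)) a) (a + K : ℕ))
    (ENat.natCast_ne_top _)
  rwa [ENat.toNat_natCast] at this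

theorem le_stoppedIndex (D : S → Prop) (a K : ℕ) (w : ℕ → S) : a ≤ stoppedIndex D a K w := by
  have := ENat.toNat_le_toNat (m := (a : ℕ∞)) (le_min (le_firstFrom (fun ℓ => D (w ℓ)) a)
    (show (a : ℕ∞) ≤ (a + K : ℕ) by norm_cast; omega))
    (ne_top_of_le_ne_top (ENat.natCast_ne_top (a + K)) (min_le_right _ _))
  rwa [ENat.toNat_natCast] at this

theorem stoppedIndex_mono (D : S → Prop) (a : ℕ) (w : ℕ → S) :
    Monotone (fun K => stoppedIndex D a K w) := by
  refine monotone_nat_of_le_succ fun K => ?_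
  by_cases h : Avoids D a K w
  · rw [stoppedIndex_succ_of_avoids h, stoppedIndex_of_avoids h]; omega
  · rw [stoppedIndex_succ_of_not_avoids h]

theorem stoppedIndex_eq {D : S → Prop} {a K b : ℕ} {w : ℕ → S}
    (h : firstFrom (fun ℓ => D (w ℓ)) a = b) (hb : b ≤ a + K) : stoppedIndex D a K w = b := by
  rw [stoppedIndex, h, min_eq_left (by exact_mod_cast hb), ENat.toNat_natCast]

end StoppingTimes

/-! ### Optional stopping -/

section OptionalStopping

variable {S Ω : Type*} [DecidableEq S] [Countable S] [MeasurableSpace S]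
  [MeasurableSingletonClass S] [MeasurableSpace Ω] {μ : Measure Ω} {Q : S → S → ℝ} {x₀ : S}
  {X : ℕ → Ω → S} [IsProbabilityMeasure μ] {N : S → Finset S} {𝕜 : Type*} [RCLike 𝕜]

namespace IsMarkovChain

theorem integral_iterate (h : IsMarkovChain μ Q x₀ X) (hN : ∀ x, ∑ y ∈ N x, Q x y = 1)
    {T : (S → 𝕜) → S → 𝕜} (hT : ∀ f x, T f x = ∑ y ∈ N x, (Q x y : 𝕜) * f y)
    {a : ℕ} {G : (ℕ → S) → 𝕜} (hG : DependsOn G (Set.Iic a)) (k : ℕ) (f : S → 𝕜) :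
    ∫ ω, G (fun k => X k ω) * f (X (a + k) ω) ∂μ =
      ∫ ω, G (fun k => X k ω) * (T^[k] f) (X a ω) ∂μ := by
  induction k generalizing f with
  | zero => rfl
  | succ k ih =>
    rw [Function.iterate_succ_apply, ← ih (T f)]
    simp_rw [hT f]
    exact h.integral_succ hN (a := a + k)
      (hG.mono (Set.Iic_subset_Iic.2 (by omega))) f

theorem dependsOn_stopped {a : ℕ} {G : (ℕ → S) → 𝕜} (hG : DependsOn G (Set.Iic a))
    (D : S → Prop) (H : ℕ → S → 𝕜) (K : ℕ) :
    DependsOn (fun w => G w * H (stoppedIndex D a K w) (w (stoppedIndex D a K w)))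
      (Set.Iic (a + K)) := by
  intro w w' hw
  simp only
  rw [dependsOn_stoppedIndex D a K hw,
    hw _ (Set.mem_Iic.2 (stoppedIndex_le D a K w')),
    hG fun i hi => hw i (Set.mem_Iic.2 (le_trans (Set.mem_Iic.1 hi) (by omega)))]

-- Between `K` and `K + 1` the stopped process moves only if `D` has been avoided so far. That event
-- is decided by time `a + K`, so the Markov property turns the increment into the drift `T H - H`.
open Classical in
theorem integral_stopped_succ (h : IsMarkovChain μ Q x₀ X) (hN : ∀ x, ∑ y ∈ N x, Q x y = 1)
    {T : (S → 𝕜) → S → 𝕜} (hT : ∀ f x, T f x = ∑ y ∈ N x, (Q x y : 𝕜) * f y)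
    {a : ℕ} {G : (ℕ → S) → 𝕜} (hG : DependsOn G (Set.Iic a)) (D : S → Prop) (H : ℕ → S → 𝕜)
    (K : ℕ) :
    ∫ ω, G (fun k => X k ω) * H (stoppedIndex D a (K + 1) (fun k => X k ω))
        (X (stoppedIndex D a (K + 1) (fun k => X k ω)) ω) ∂μ =
      ∫ ω, G (fun k => X k ω) * H (stoppedIndex D a K (fun k => X k ω))
        (X (stoppedIndex D a K (fun k => X k ω)) ω) ∂μ +
      ∫ ω, (if Avoids D a K (fun k => X k ω) then G (fun k => X k ω) else 0) *
        (T (H (a + K + 1)) (X (a + K) ω) - H (a + K) (X (a + K) ω)) ∂μ := by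
  let : MeasurableSpace 𝕜 := borel 𝕜
  have : BorelSpace 𝕜 := ⟨rfl⟩
  let G' : (ℕ → S) → 𝕜 := fun w => if Avoids D a K w then G w else 0
  have hG' : DependsOn G' (Set.Iic (a + K)) := by
    intro w w' hw
    simp only [G']
    rw [dependsOn_avoids D a K hw,
      hG fun i hi => hw i (Set.mem_Iic.2 (le_trans (Set.mem_Iic.1 hi) (by omega)))]
  have hT' : ∀ f : S → 𝕜, DependsOn (fun w => G' w * f (w (a + K))) (Set.Iic (a + K)) := by
    intro f w w' hw
    simp only
    rw [hG' hw, hw _ (Set.mem_Iic.2 le_rfl)]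
  have e1 : ∀ ω, G (fun k => X k ω) * H (stoppedIndex D a (K + 1) (fun k => X k ω))
        (X (stoppedIndex D a (K + 1) (fun k => X k ω)) ω) =
      G (fun k => X k ω) * H (stoppedIndex D a K (fun k => X k ω))
        (X (stoppedIndex D a K (fun k => X k ω)) ω) +
      (G' (fun k => X k ω) * H (a + K + 1) (X (a + K + 1) ω) -
        G' (fun k => X k ω) * H (a + K) (X (a + K) ω)) := by
    intro ω
    by_cases hA : Avoids D a K (fun k => X k ω)
    · rw [stoppedIndex_succ_of_avoids hA, stoppedIndex_of_avoids hA]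
      simp [G', hA]
    · rw [stoppedIndex_succ_of_not_avoids hA]
      simp [G', hA]
  have i0 := h.integrable hN (dependsOn_stopped hG D H K)
  have i1 := h.integrable hN (hT' (H (a + K)))
  have i2 := h.integrable hN (hT' (T (H (a + K + 1))))
  have i3 : Integrable (fun ω => G' (fun k => X k ω) * H (a + K + 1) (X (a + K + 1) ω)) μ := by
    refine h.integrable hN (G := fun w => G' w * H (a + K + 1) (w (a + K + 1))) (a := a + K + 1) ?_
    intro w w' hw
    simp only
    rw [hG' fun i hi => hw i (Set.mem_Iic.2 (le_trans (Set.mem_Iic.1 hi) (by omega))),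
      hw _ (Set.mem_Iic.2 le_rfl)]
  refine (integral_congr_ae (ae_of_all _ e1)).trans ((integral_add i0 (i3.sub i1)).trans ?_)
  congr 1
  refine (integral_sub i3 i1).trans ?_
  rw [h.integral_succ hN hG' (H (a + K + 1))]
  simp_rw [← hT]
  refine (integral_sub i2 i1).symm.trans ?_
  simp_rw [← mul_sub]
  rfl

/-- The drift has to vanish only along almost every trajectory, where `G` is nonzero and `D` still
avoided; deterministic properties of trajectories can thus be used to check it. -/
theorem integral_stopped_eq (h : IsMarkovChain μ Q x₀ X) (hN : ∀ x, ∑ y ∈ N x, Q x y = 1)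
    {T : (S → 𝕜) → S → 𝕜} (hT : ∀ f x, T f x = ∑ y ∈ N x, (Q x y : 𝕜) * f y)
    {a : ℕ} {G : (ℕ → S) → 𝕜} (hG : DependsOn G (Set.Iic a)) (D : S → Prop) (H : ℕ → S → 𝕜)
    (hH : ∀ᵐ ω ∂μ, ∀ K, G (fun k => X k ω) ≠ 0 → Avoids D a K (fun k => X k ω) →
      T (H (a + K + 1)) (X (a + K) ω) = H (a + K) (X (a + K) ω)) (K : ℕ) :
    ∫ ω, G (fun k => X k ω) * H (stoppedIndex D a K (fun k => X k ω))
        (X (stoppedIndex D a K (fun k => X k ω)) ω) ∂μ =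
      ∫ ω, G (fun k => X k ω) * H a (X a ω) ∂μ := by
  classical
  induction K with
  | zero => simp_rw [stoppedIndex_zero]
  | succ K ih =>
    rw [h.integral_stopped_succ hN hT hG D H K, ih, add_eq_left, integral_eq_zero_of_ae]
    filter_upwards [hH] with ω hω
    by_cases hA : Avoids D a K (fun k => X k ω)
    · by_cases hg : G (fun k => X k ω) = 0
      · simp [hg]
      · simp [hω K hg hA]
    · simp [hA]

theorem integral_stopped_le (h : IsMarkovChain μ Q x₀ X) (hN : ∀ x, ∑ y ∈ N x, Q x y = 1)
    {T : (S → ℝ) → S → ℝ} (hT : ∀ f x, T f x = ∑ y ∈ N x, Q x y * f y)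
    {a : ℕ} {G : (ℕ → S) → ℝ} (hG : DependsOn G (Set.Iic a)) (hG0 : ∀ w, 0 ≤ G w)
    (D : S → Prop) (H : ℕ → S → ℝ)
    (hH : ∀ᵐ ω ∂μ, ∀ K, G (fun k => X k ω) ≠ 0 → Avoids D a K (fun k => X k ω) →
      T (H (a + K + 1)) (X (a + K) ω) ≤ H (a + K) (X (a + K) ω)) (K : ℕ) :
    ∫ ω, G (fun k => X k ω) * H (stoppedIndex D a K (fun k => X k ω))
        (X (stoppedIndex D a K (fun k => X k ω)) ω) ∂μ ≤
      ∫ ω, G (fun k => X k ω) * H a (X a ω) ∂μ := by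
  classical
  induction K with
  | zero => simp_rw [stoppedIndex_zero]; rfl
  | succ K ih =>
    rw [h.integral_stopped_succ hN (𝕜 := ℝ) hT hG D H K]
    refine (add_le_of_nonpos_right (integral_nonpos_of_ae ?_)).trans ih
    filter_upwards [hH] with ω hω
    by_cases hA : Avoids D a K (fun k => X k ω)
    · by_cases hg : G (fun k => X k ω) = 0
      · simp [hg]
      · simpa [hA] using mul_nonpos_of_nonneg_of_nonpos (hG0 _) (sub_nonpos.2 (hω K hg hA))
    · simp [hA]

/-- Monotone convergence in `K`: where `G` is nonzero and `D` is never visited, the stopped elapsed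
time is `K`, which is incompatible with a finite supremum. -/
theorem ae_hit_of_integral_le (h : IsMarkovChain μ Q x₀ X) (hN : ∀ x, ∑ y ∈ N x, Q x y = 1)
    {a : ℕ} {G : (ℕ → S) → ℝ} (hG : DependsOn G (Set.Iic a)) (hG0 : ∀ w, 0 ≤ G w)
    (D : S → Prop) {B : ℝ}
    (hB : ∀ K, ∫ ω, G (fun k => X k ω) *
      ((stoppedIndex D a K (fun k => X k ω) : ℝ) - a) ∂μ ≤ B) :
    (∀ᵐ ω ∂μ, G (fun k => X k ω) ≠ 0 → firstFrom (fun ℓ => D (X ℓ ω)) a < ⊤) ∧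
    Integrable (fun ω => G (fun k => X k ω) *
      (((firstFrom (fun ℓ => D (X ℓ ω)) a).toNat : ℝ) - a)) μ ∧
    ∫ ω, G (fun k => X k ω) * (((firstFrom (fun ℓ => D (X ℓ ω)) a).toNat : ℝ) - a) ∂μ ≤ B := by
  let g : ℕ → Ω → ℝ := fun K ω => G (fun k => X k ω) *
      ((stoppedIndex D a K (fun k => X k ω) : ℝ) - a)
  have hdep : ∀ K, DependsOn (fun w => G w * ((stoppedIndex D a K w : ℝ) - a))
      (Set.Iic (a + K)) := fun K =>
    dependsOn_stopped hG D (fun k _ => (k : ℝ) - a) K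
  have hint : ∀ K, Integrable (g K) μ := fun K => h.integrable hN (hdep K)
  have hmeas : ∀ K, Measurable (g K) := fun K => measurable_of_dependsOn h.measurable (hdep K)
  have hnn : ∀ K ω, 0 ≤ g K ω := fun K ω => mul_nonneg (hG0 _) (sub_nonneg.2
    (Nat.cast_le.2 (le_stoppedIndex D a K _)))
  have hmono : ∀ ω, Monotone fun K => g K ω := fun ω K K' hK =>
    mul_le_mul_of_nonneg_left (sub_le_sub_right (Nat.cast_le.2 (stoppedIndex_mono D a _ hK)) _)
      (hG0 _)
  have hB0 : 0 ≤ B := (integral_nonneg (hnn 0)).trans (hB 0)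
  have hsup : ∫⁻ ω, ⨆ K, ENNReal.ofReal (g K ω) ∂μ ≤ ENNReal.ofReal B := by
    rw [lintegral_iSup (fun K => (hmeas K).ennreal_ofReal)
      (fun K K' hK ω => ENNReal.ofReal_le_ofReal (hmono ω hK))]
    refine iSup_le fun K => ?_
    rw [← ofReal_integral_eq_lintegral_ofReal (hint K) (ae_of_all _ (hnn K))]
    exact ENNReal.ofReal_le_ofReal (hB K)
  have hfin : ∀ᵐ ω ∂μ, (⨆ K, ENNReal.ofReal (g K ω)) < ⊤ :=
    ae_lt_top (.iSup fun K => (hmeas K).ennreal_ofReal) (hsup.trans_lt ENNReal.ofReal_lt_top).ne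
  have hhit : ∀ᵐ ω ∂μ, G (fun k => X k ω) ≠ 0 → firstFrom (fun ℓ => D (X ℓ ω)) a < ⊤ := by
    filter_upwards [hfin] with ω hω hGω
    by_contra hc
    rw [not_lt_top_iff] at hc
    have hpos : 0 < G (fun k => X k ω) := lt_of_le_of_ne (hG0 _) hGω.symm
    have hg : ∀ K, g K ω = G (fun k => X k ω) * K := by
      intro K
      have : Avoids D a K (fun k => X k ω) := by
        rw [avoids_iff_lt_firstFrom, hc]; exact ENat.natCast_lt_top _
      simp [g, stoppedIndex_of_avoids this]
    obtain ⟨K, hK⟩ := exists_nat_gt ((⨆ K, ENNReal.ofReal (g K ω)).toReal / G (fun k => X k ω))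
    have h1 : ENNReal.ofReal (g K ω) ≤ ⨆ K, ENNReal.ofReal (g K ω) :=
      le_iSup (fun K => ENNReal.ofReal (g K ω)) K
    have h2 := (ENNReal.ofReal_le_iff_le_toReal hω.ne).1 h1
    rw [div_lt_iff₀ hpos] at hK
    rw [hg K] at h2
    linarith
  have hle : ∀ᵐ ω ∂μ, ENNReal.ofReal (G (fun k => X k ω) *
      (((firstFrom (fun ℓ => D (X ℓ ω)) a).toNat : ℝ) - a)) ≤ ⨆ K, ENNReal.ofReal (g K ω) := by
    filter_upwards [hhit] with ω hω
    by_cases hGω : G (fun k => X k ω) = 0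
    · simp [hGω]
    obtain ⟨b, hb⟩ := ENat.ne_top_iff_exists.1 (hω hGω).ne
    refine le_iSup_of_le b (le_of_eq ?_)
    simp only [g]
    rw [stoppedIndex_eq (D := D) (w := fun k => X k ω) hb.symm (by omega), ← hb, ENat.toNat_natCast]
  have hnn' : 0 ≤ᵐ[μ] fun ω => G (fun k => X k ω) *
      (((firstFrom (fun ℓ => D (X ℓ ω)) a).toNat : ℝ) - a) := by
    filter_upwards [hhit] with ω hω
    by_cases hGω : G (fun k => X k ω) = 0
    · simp [hGω]
    refine mul_nonneg (hG0 _) (sub_nonneg.2 (Nat.cast_le.2 ?_))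
    have := ENat.toNat_le_toNat (le_firstFrom (fun ℓ => D (X ℓ ω)) a) (hω hGω).ne
    rwa [ENat.toNat_natCast] at this
  have hm : Measurable fun ω => G (fun k => X k ω) *
      (((firstFrom (fun ℓ => D (X ℓ ω)) a).toNat : ℝ) - a) := by
    refine (measurable_of_dependsOn h.measurable hG).mul (Measurable.sub_const ?_ _)
    exact measurable_from_nat.comp
      (((isTrajectoryStoppingTime_const (S := S) a).firstFrom D).measurable_toNat h.measurable)
  have hl := (lintegral_mono_ae hle).trans hsup
  refine ⟨hhit, ⟨hm.aestronglyMeasurable, ?_⟩, ?_⟩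
  · rw [hasFiniteIntegral_iff_ofReal hnn']
    exact hl.trans_lt ENNReal.ofReal_lt_top
  · rw [integral_eq_lintegral_of_nonneg_ae hnn' hm.aestronglyMeasurable]
    exact ENNReal.toReal_le_of_le_ofReal hB0 hl

end IsMarkovChain
end OptionalStopping

/-! ### One-step operators of the two chains -/

section OneStep

variable {V : Type*} [DecidableEq V]

/-- The states that the cat and mouse chain may visit after `x` when the cat moves from `c` to
`up c` or `dn c`. -/
def nextStates (up dn : V → V) (x : V × V) : Finset (V × V) :=
  {up x.1, dn x.1} ×ˢ (if x.1 = x.2 then {up x.1, dn x.1} else {x.2})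

/-- The transition operator of the cat and mouse chain when the cat moves from `c` to `up c` with
probability `p` and to `dn c` with probability `1 - p`. -/
noncomputable def stepMean {𝕜 : Type*} [RCLike 𝕜] (p : ℝ) (up dn : V → V) (f : V × V → 𝕜)
    (x : V × V) : 𝕜 :=
  if x.1 = x.2 then
    (p : 𝕜) * ((p : 𝕜) * f (up x.1, up x.1) + (1 - p) * f (up x.1, dn x.1)) +
      (1 - p) * ((p : 𝕜) * f (dn x.1, up x.1) + (1 - p) * f (dn x.1, dn x.1))
  else (p : 𝕜) * f (up x.1, x.2) + (1 - p) * f (dn x.1, x.2)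

theorem stepMean_eq_sum {𝕜 : Type*} [RCLike 𝕜] {p : ℝ} {P : V → V → ℝ} {up dn : V → V}
    (hne : ∀ x, up x ≠ dn x) (hup : ∀ x, P x (up x) = p) (hdn : ∀ x, P x (dn x) = 1 - p)
    (f : V × V → 𝕜) (x : V × V) :
    stepMean p up dn f x = ∑ y ∈ nextStates up dn x, (catMouse P x y : 𝕜) * f y := by
  obtain ⟨c, m⟩ := x
  by_cases h : c = m
  · subst h
    simp only [stepMean, nextStates, if_true, Finset.sum_product, catMouse]
    rw [Finset.sum_pair (hne c), Finset.sum_pair (hne c), Finset.sum_pair (hne c)]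
    simp only [hup, hdn]
    push_cast
    ring
  · simp only [stepMean, nextStates, h, if_false, Finset.sum_product, catMouse,
      Finset.sum_singleton, if_true]
    rw [Finset.sum_pair (hne c)]
    simp only [hup, hdn]
    push_cast
    ring

theorem sum_catMouse_eq_one {p : ℝ} {P : V → V → ℝ} {up dn : V → V}
    (hne : ∀ x, up x ≠ dn x) (hup : ∀ x, P x (up x) = p) (hdn : ∀ x, P x (dn x) = 1 - p)
    (x : V × V) : ∑ y ∈ nextStates up dn x, catMouse P x y = 1 := by
  have h := stepMean_eq_sum (𝕜 := ℝ) hne hup hdn (fun _ => 1) x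
  simp only [RCLike.ofReal_real_eq_id, id_eq, mul_one] at h
  rw [← h]
  by_cases hx : x.1 = x.2
  · simp [stepMean, hx]
  · simp [stepMean, hx]

/-- The upward step on `ℕ`. -/
abbrev upN (x : ℕ) : ℕ := x + 1

/-- The downward step on `ℕ`, with reflection at `0`. -/
abbrev dnN (x : ℕ) : ℕ := x - 1

/-- The upward step on `ℤ`. -/
abbrev upZ (x : ℤ) : ℤ := x + 1

/-- The downward step on `ℤ`. -/
abbrev dnZ (x : ℤ) : ℤ := x - 1

theorem upN_ne_dnN (x : ℕ) : upN x ≠ dnN x := by simp only [upN, dnN]; omega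

theorem upZ_ne_dnZ (x : ℤ) : upZ x ≠ dnZ x := by simp only [upZ, dnZ]; omega

theorem reflectedWalk_upN (p : ℝ) (x : ℕ) : reflectedWalk p x (upN x) = p := by
  simp [reflectedWalk]

theorem reflectedWalk_dnN (p : ℝ) (x : ℕ) : reflectedWalk p x (dnN x) = 1 - p := by
  rcases x with _ | x
  · simp [reflectedWalk]
  · simp only [reflectedWalk, dnN]
    rw [if_neg (by omega), if_pos (by omega)]

theorem freeWalk_upZ (p : ℝ) (x : ℤ) : freeWalk p x (upZ x) = p := by
  simp [freeWalk]

theorem freeWalk_dnZ (p : ℝ) (x : ℤ) : freeWalk p x (dnZ x) = 1 - p := by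
  have : x - 1 ≠ x + 1 := by omega
  simp [freeWalk, this]

theorem sum_reflected (p : ℝ) (x : ℕ × ℕ) :
    ∑ y ∈ nextStates upN dnN x, catMouse (reflectedWalk p) x y = 1 :=
  sum_catMouse_eq_one upN_ne_dnN (reflectedWalk_upN p) (reflectedWalk_dnN p) x

theorem sum_free (p : ℝ) (x : ℤ × ℤ) :
    ∑ y ∈ nextStates upZ dnZ x, catMouse (freeWalk p) x y = 1 :=
  sum_catMouse_eq_one upZ_ne_dnZ (freeWalk_upZ p) (freeWalk_dnZ p) x

theorem stepMean_reflected {𝕜 : Type*} [RCLike 𝕜] (p : ℝ) (f : ℕ × ℕ → 𝕜) (x : ℕ × ℕ) :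
    stepMean p upN dnN f x =
      ∑ y ∈ nextStates upN dnN x, (catMouse (reflectedWalk p) x y : 𝕜) * f y :=
  stepMean_eq_sum upN_ne_dnN (reflectedWalk_upN p) (reflectedWalk_dnN p) f x

theorem stepMean_free {𝕜 : Type*} [RCLike 𝕜] (p : ℝ) (f : ℤ × ℤ → 𝕜) (x : ℤ × ℤ) :
    stepMean p upZ dnZ f x =
      ∑ y ∈ nextStates upZ dnZ x, (catMouse (freeWalk p) x y : 𝕜) * f y :=
  stepMean_eq_sum upZ_ne_dnZ (freeWalk_upZ p) (freeWalk_dnZ p) f x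

end OneStep

/-! ### Deterministic properties of trajectories -/

section Trajectories

/-- Trajectories that follow the allowed transitions of the reflected cat and mouse chain. -/
def Legal (w : ℕ → ℕ × ℕ) : Prop := ∀ k, w (k + 1) ∈ nextStates upN dnN (w k)

variable {w : ℕ → ℕ × ℕ}

theorem Legal.cat (h : Legal w) (k : ℕ) :
    (w (k + 1)).1 = (w k).1 + 1 ∨ (w (k + 1)).1 = (w k).1 - 1 := by
  have := h k
  simp only [nextStates, Finset.mem_product, Finset.mem_insert, Finset.mem_singleton] at this
  exact this.1

theorem Legal.mouse_of_ne (h : Legal w) {k : ℕ} (hk : (w k).1 ≠ (w k).2) :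
    (w (k + 1)).2 = (w k).2 := by
  have := h k
  simp only [nextStates, Finset.mem_product, hk, if_false, Finset.mem_singleton] at this
  exact this.2

theorem Legal.mouse (h : Legal w) (k : ℕ) :
    (w (k + 1)).2 ≤ (w k).2 + 1 ∧ (w k).2 ≤ (w (k + 1)).2 + 1 := by
  by_cases hk : (w k).1 = (w k).2
  · have := h k
    simp only [nextStates, Finset.mem_product, hk, if_true, Finset.mem_insert,
      Finset.mem_singleton, upN, dnN] at this
    omega
  · rw [h.mouse_of_ne hk]; omega

/-- The cat climbs by at most one per step, so it cannot jump over the mouse, which is motionless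
until they meet. -/
theorem Legal.stopped_meet (h : Legal w) {a m : ℕ} (h2 : (w a).2 = m) (h1 : (w a).1 ≤ m) (K : ℕ) :
    (w (stoppedIndex (fun x : ℕ × ℕ => x.1 = x.2) a K w)).2 = m ∧
      (w (stoppedIndex (fun x : ℕ × ℕ => x.1 = x.2) a K w)).1 ≤ m := by
  induction K with
  | zero => rw [stoppedIndex_zero]; exact ⟨h2, h1⟩
  | succ K ih =>
    by_cases hA : Avoids (fun x : ℕ × ℕ => x.1 = x.2) a K w
    · rw [stoppedIndex_of_avoids hA] at ih
      rw [stoppedIndex_succ_of_avoids hA]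
      have hne : (w (a + K)).1 ≠ (w (a + K)).2 := hA (a + K) (by omega) le_rfl
      rw [h.mouse_of_ne hne]
      refine ⟨ih.1, ?_⟩
      have := h.cat (a + K)
      omega
    · rwa [stoppedIndex_succ_of_not_avoids hA]

theorem Legal.of_avoids_meet (h : Legal w) {a m K : ℕ} (h2 : (w a).2 = m) (h1 : (w a).1 ≤ m)
    (hA : Avoids (fun x : ℕ × ℕ => x.1 = x.2) a K w) :
    (w (a + K)).2 = m ∧ (w (a + K)).1 < m := by
  have := h.stopped_meet h2 h1 K
  rw [stoppedIndex_of_avoids hA] at this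
  have hne : (w (a + K)).1 ≠ (w (a + K)).2 := hA (a + K) (by omega) le_rfl
  omega

theorem Legal.mouse_const (h : Legal w) {a b : ℕ} (hab : a ≤ b)
    (hne : ∀ j, a ≤ j → j < b → (w j).1 ≠ (w j).2) : (w b).2 = (w a).2 := by
  induction b, hab using Nat.le_induction with
  | base => rfl
  | succ b hab ih =>
    rw [h.mouse_of_ne (hne b hab (by omega)), ih fun j hj hjb => hne j hj (by omega)]

theorem Legal.mouse_near (h : Legal w) (a k : ℕ) :
    (w (a + k)).2 ≤ (w a).2 + k ∧ (w a).2 ≤ (w (a + k)).2 + k := by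
  induction k with
  | zero => simp
  | succ k ih =>
    have := h.mouse (a + k)
    rw [show a + (k + 1) = a + k + 1 by ring]
    omega

theorem Legal.cat_le (h : Legal w) (a k : ℕ) : (w a).1 ≤ (w (a + k)).1 + k := by
  induction k with
  | zero => simp
  | succ k ih =>
    have := h.cat (a + k)
    rw [show a + (k + 1) = a + k + 1 by ring]
    omega

end Trajectories

/-! ### A contracted function of the distance between cat and mouse -/

section Potential

/-- Take `h d = R ^ d` for `d ≥ 0` and `s ^ |d|` for `d < 0`, with `s < 1 < R`. To the right of the
mouse the cat drifts back, and `p R + (1-p)/R < 1` as soon as `1 < R < (1-p)/p`. To the left it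
drifts away, and `p/s + (1-p) s = 1/2 + 2p(1-p) < 1` for `s = 2p`. At a meeting the difference moves
by 0 or ±2, and contraction amounts to `R² + s² < 2`. -/
theorem exists_contracted_potential {p : ℝ} (hp : 0 < p) (hp' : p < 1 / 2) :
    ∃ (γ : ℝ) (h : ℤ → ℝ), 0 < γ ∧ γ < 1 ∧ (∀ d, 0 ≤ h d) ∧ h 0 = 1 ∧
      (∀ d ≠ 0, p * h (d + 1) + (1 - p) * h (d - 1) ≤ γ * h d) ∧
      p * (p * h 0 + (1 - p) * h 2) + (1 - p) * (p * h (-2) + (1 - p) * h 0) ≤ γ * h 0 := by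
  -- With these choices `R² + s²` is convex in `p`, equal to 25/16 at `p = 0` and to 2 at `p = 1/2`,
  -- hence below 2 in between.
  obtain ⟨R, hR⟩ : ∃ R : ℝ, R = 1 + (1 - 2 * p) / 4 := ⟨_, rfl⟩
  obtain ⟨s, hs⟩ : ∃ s : ℝ, s = 2 * p := ⟨_, rfl⟩
  have hR0 : 0 < R := by rw [hR]; linarith
  have hs0 : 0 < s := by rw [hs]; linarith
  let h : ℤ → ℝ := fun d => if 0 ≤ d then R ^ d.toNat else s ^ (-d).toNat
  set γ₁ := (p * R ^ 2 + 1 - p) / R with hγ₁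
  set γ₂ := (p + (1 - p) * s ^ 2) / s with hγ₂
  set γ₃ := p * (p + (1 - p) * R ^ 2) + (1 - p) * (p * s ^ 2 + (1 - p)) with hγ₃
  have l1 : γ₁ < 1 := by
    rw [hγ₁, div_lt_one hR0, hR]
    have h4 : 0 < 1 / 4 - p / 2 - p * (1 - 2 * p) / 16 := by nlinarith
    nlinarith [mul_pos (show 0 < 1 - 2 * p by linarith) h4]
  have l2 : γ₂ < 1 := by
    rw [hγ₂, div_lt_one hs0, hs]
    nlinarith [mul_pos hp (mul_pos (sub_pos.2 hp') (sub_pos.2 hp'))]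
  have l3 : γ₃ < 1 := by
    have : R ^ 2 + s ^ 2 < 2 := by rw [hR, hs]; nlinarith
    have h4 : γ₃ = 1 - p * (1 - p) * (2 - (R ^ 2 + s ^ 2)) := by rw [hγ₃]; ring
    rw [h4]
    have : 0 < p * (1 - p) * (2 - (R ^ 2 + s ^ 2)) :=
      mul_pos (mul_pos hp (by linarith)) (by linarith)
    linarith
  have g1 : 0 < γ₁ := div_pos (by nlinarith [sq_nonneg R]) hR0
  have e1 : γ₁ * R = p * R ^ 2 + 1 - p := div_mul_cancel₀ _ hR0.ne'
  have e2 : γ₂ * s = p + (1 - p) * s ^ 2 := div_mul_cancel₀ _ hs0.ne'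
  refine ⟨max γ₁ (max γ₂ γ₃), h, lt_max_of_lt_left g1, max_lt l1 (max_lt l2 l3), ?_, ?_, ?_, ?_⟩
  · intro d
    simp only [h]
    split_ifs <;> positivity
  · simp [h]
  · intro d hd
    rcases lt_or_gt_of_ne hd with hd | hd
    · obtain ⟨k, rfl⟩ : ∃ k : ℕ, d = -(k + 1 : ℤ) := ⟨(-d - 1).toNat, by omega⟩
      have h1 : h (-(k + 1 : ℤ) + 1) = s ^ k := by
        rcases Nat.eq_zero_or_pos k with rfl | hk
        · simp [h]
        · simp only [h]
          rw [if_neg (by omega)]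
          congr 1
          omega
      have h2 : h (-(k + 1 : ℤ) - 1) = s ^ (k + 2) := by
        simp only [h]
        rw [if_neg (by omega)]
        congr 1
      have h3 : h (-(k + 1 : ℤ)) = s ^ (k + 1) := by
        simp only [h]
        rw [if_neg (by omega)]
        congr 1
      rw [h1, h2, h3]
      calc p * s ^ k + (1 - p) * s ^ (k + 2) = γ₂ * s ^ (k + 1) := by
            rw [pow_succ s k, ← mul_assoc, mul_right_comm, e2]; ring
        _ ≤ _ := by
            gcongr
            exact (le_max_left _ _).trans (le_max_right _ _)
    · obtain ⟨k, rfl⟩ : ∃ k : ℕ, d = (k + 1 : ℤ) := ⟨(d - 1).toNat, by omega⟩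
      have h1 : h ((k + 1 : ℤ) + 1) = R ^ (k + 2) := by
        simp only [h]
        rw [if_pos (by omega)]
        congr 1
      have h2 : h ((k + 1 : ℤ) - 1) = R ^ k := by
        simp only [h]
        rw [if_pos (by omega)]
        congr 1
        omega
      have h3 : h (k + 1 : ℤ) = R ^ (k + 1) := by
        simp only [h]
        rw [if_pos (by omega)]
        congr 1
      rw [h1, h2, h3]
      calc p * R ^ (k + 2) + (1 - p) * R ^ k = γ₁ * R ^ (k + 1) := by
            rw [pow_succ R k, ← mul_assoc, mul_right_comm, e1]; ring
        _ ≤ _ := by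
            gcongr
            exact le_max_left _ _
  · have h0 : h 0 = 1 := by simp [h]
    have h2 : h 2 = R ^ 2 := by simp [h]
    have h3 : h (-2) = s ^ 2 := by simp [h]
    rw [h0, h2, h3, mul_one, mul_one, mul_one]
    exact (le_max_right _ _).trans (le_max_right _ _)

end Potential

/-- `u_k` is the reciprocal of the generating function at `ζ⁻¹` of the hitting time of `k` by the
reflected walk started at `0`. -/
noncomputable def hitPoly (p : ℝ) (ζ : ℂ) : ℕ → ℂ
  | 0 => 1
  | 1 => (ζ - (1 - p)) / p
  | k + 2 => (ζ * hitPoly p ζ (k + 1) - (1 - p) * hitPoly p ζ k) / p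

/-- Truncated subtraction encodes the reflection: at `c = 0` the identity is the equation that
defines `u_1`. -/
theorem hitPoly_mean {p : ℝ} (hp : 0 < p) (ζ : ℂ) (c : ℕ) :
    (p : ℂ) * hitPoly p ζ (c + 1) + (1 - p) * hitPoly p ζ (c - 1) = ζ * hitPoly p ζ c := by
  have hp' : (p : ℂ) ≠ 0 := by exact_mod_cast hp.ne'
  rcases c with _ | c
  · simp only [hitPoly, Nat.zero_sub]
    field_simp
    ring
  · simp only [hitPoly, Nat.add_sub_cancel]
    field_simp
    ring

/-! ### Martingales of the reflected chain -/

section Reflected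

variable {Ω : Type*} [MeasurableSpace Ω] {μ : Measure Ω} [IsProbabilityMeasure μ] {p : ℝ}
  {x₀ : ℕ × ℕ} {X : ℕ → Ω → ℕ × ℕ}

theorem ae_legal (hX : IsMarkovChain μ (catMouse (reflectedWalk p)) x₀ X) :
    ∀ᵐ ω ∂μ, Legal (fun k => X k ω) :=
  hX.ae_step (sum_reflected p)

/-- The choice `r = 1/p` makes `p r^{c+1} = r^c`, so `r ^ C` grows in mean by `(1-p) r^{c-1} ≥ 1-p`
per step. It stays below `r ^ m` until the meeting, which bounds the expected waiting time. -/
theorem ae_meets (hp : 0 < p) (hp' : p < 1 / 2)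
    (hX : IsMarkovChain μ (catMouse (reflectedWalk p)) x₀ X) {a m : ℕ} {G : (ℕ → ℕ × ℕ) → ℝ}
    (hG : DependsOn G (Set.Iic a)) (hG0 : ∀ w, 0 ≤ G w) (hGs : ∀ w, G w ≠ 0 → w a = (0, m)) :
    ∀ᵐ ω ∂μ, G (fun k => X k ω) ≠ 0 →
      firstFrom (fun ℓ => (X ℓ ω).1 = (X ℓ ω).2) a < ⊤ := by
  set r : ℝ := 1 / p with hr
  have hr1 : 1 ≤ r := by rw [hr, le_div_iff₀ hp]; linarith
  have hpr : p * r = 1 := by rw [hr]; field_simp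
  have hq : 0 < 1 - p := by linarith
  let H : ℕ → ℕ × ℕ → ℝ := fun k x => (1 - p)⁻¹ * (r ^ m - r ^ x.1) + ((k : ℝ) - a)
  have hle := hX.integral_stopped_le (sum_reflected p) (T := stepMean p upN dnN)
    (stepMean_reflected p) hG hG0 (fun x => x.1 = x.2) H (by
      filter_upwards [ae_legal hX] with ω hω K hGω hA
      have hs := hGs _ hGω
      obtain ⟨h2, h1⟩ := hω.of_avoids_meet (m := m) (by rw [hs]) (by rw [hs]; exact Nat.zero_le _) hA
      rw [stepMean, if_neg (by omega)]
      simp only [H, upN, dnN, RCLike.ofReal_real_eq_id, id_eq]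
      set c := (X (a + K) ω).1
      have h3 : (1 : ℝ) ≤ r ^ (c - 1) := one_le_pow₀ hr1
      have h4 : (1 - p)⁻¹ * (1 - p) = 1 := inv_mul_cancel₀ hq.ne'
      have h5 : p * r ^ (c + 1) = r ^ c := by rw [pow_succ, mul_left_comm, hpr, mul_one]
      push_cast
      have h6 : p * ((1 - p)⁻¹ * (r ^ m - r ^ (c + 1)) + ((a : ℝ) + K + 1 - a)) +
          (1 - p) * ((1 - p)⁻¹ * (r ^ m - r ^ (c - 1)) + ((a : ℝ) + K + 1 - a)) =
          (1 - p)⁻¹ * (r ^ m - p * r ^ (c + 1)) - ((1 - p)⁻¹ * (1 - p)) * r ^ (c - 1) +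
            ((a : ℝ) + K + 1 - a) := by ring
      rw [h6, h4, h5]
      linarith)
  refine (hX.ae_hit_of_integral_le (B := ∫ ω, G (fun k => X k ω) * H a (X a ω) ∂μ)
    (sum_reflected p) hG hG0 (fun x => x.1 = x.2) fun K => ?_).1
  refine le_trans (integral_mono_ae ?_ ?_ ?_) (hle K)
  · exact hX.integrable (sum_reflected p)
      (IsMarkovChain.dependsOn_stopped hG (fun x => x.1 = x.2) (fun k _ => (k : ℝ) - a) K)
  · exact hX.integrable (sum_reflected p)
      (IsMarkovChain.dependsOn_stopped hG (fun x => x.1 = x.2) H K)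
  · filter_upwards [ae_legal hX] with ω hω
    by_cases hGω : G (fun k => X k ω) = 0
    · simp [hGω]
    have hs := hGs _ hGω
    have h1 := (hω.stopped_meet (a := a) (m := m) (by rw [hs]) (by rw [hs]; exact Nat.zero_le _) K).2
    refine mul_le_mul_of_nonneg_left ?_ (hG0 _)
    simp only [H]
    have := pow_le_pow_right₀ hr1 h1
    have := mul_nonneg (inv_nonneg.2 hq.le) (sub_nonneg.2 this)
    linarith

/-- Away from 0 the cat loses `1 - 2p` per step in mean, whether or not it sits on the mouse, so
`C/(1-2p)` plus the elapsed time has no drift. -/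
theorem integral_returnTime_le (hp' : p < 1 / 2)
    (hX : IsMarkovChain μ (catMouse (reflectedWalk p)) x₀ X) {a c : ℕ} {G : (ℕ → ℕ × ℕ) → ℝ}
    (hG : DependsOn G (Set.Iic a)) (hG0 : ∀ w, 0 ≤ G w) (hGs : ∀ w, G w ≠ 0 → (w a).1 = c) :
    (∀ᵐ ω ∂μ, G (fun k => X k ω) ≠ 0 → firstFrom (fun ℓ => (X ℓ ω).1 = 0) a < ⊤) ∧
    Integrable (fun ω => G (fun k => X k ω) *
      (((firstFrom (fun ℓ => (X ℓ ω).1 = 0) a).toNat : ℝ) - a)) μ ∧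
    ∫ ω, G (fun k => X k ω) * (((firstFrom (fun ℓ => (X ℓ ω).1 = 0) a).toNat : ℝ) - a) ∂μ ≤
      c / (1 - 2 * p) * ∫ ω, G (fun k => X k ω) ∂μ := by
  have hq : 0 < 1 - 2 * p := by linarith
  let H : ℕ → ℕ × ℕ → ℝ := fun k x => x.1 / (1 - 2 * p) + ((k : ℝ) - a)
  have hle := hX.integral_stopped_le (sum_reflected p) (T := stepMean p upN dnN)
    (stepMean_reflected p) hG hG0 (fun x => x.1 = 0) H (by
      refine ae_of_all _ fun ω K _ hA => le_of_eq ?_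
      have hc : (X (a + K) ω).1 ≠ 0 := hA (a + K) (by omega) le_rfl
      obtain ⟨d, hd⟩ := Nat.exists_eq_succ_of_ne_zero hc
      simp only [stepMean, H, upN, dnN, RCLike.ofReal_real_eq_id, id_eq, hd, Nat.succ_eq_add_one,
        Nat.add_sub_cancel]
      push_cast
      have h1 : (1 - 2 * p) * (1 - 2 * p)⁻¹ = 1 := mul_inv_cancel₀ hq.ne'
      split_ifs <;> linear_combination -h1)
  refine hX.ae_hit_of_integral_le (sum_reflected p) hG hG0 (fun x => x.1 = 0) fun K => ?_
  have he : ∫ ω, G (fun k => X k ω) * H a (X a ω) ∂μ =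
      c / (1 - 2 * p) * ∫ ω, G (fun k => X k ω) ∂μ := by
    rw [← integral_const_mul]
    refine integral_congr_ae (ae_of_all _ fun ω => ?_)
    by_cases hGω : G (fun k => X k ω) = 0
    · simp [hGω]
    · have : ((X a ω).1 : ℝ) = c := by exact_mod_cast hGs _ hGω
      simp only [H, this, sub_self, add_zero]
      ring
  rw [← he]
  refine le_trans (integral_mono ?_ ?_ ?_) (hle K)
  · exact hX.integrable (sum_reflected p)
      (IsMarkovChain.dependsOn_stopped hG (fun x => x.1 = 0) (fun k _ => (k : ℝ) - a) K)
  · exact hX.integrable (sum_reflected p)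
      (IsMarkovChain.dependsOn_stopped hG (fun x => x.1 = 0) H K)
  · intro ω
    refine mul_le_mul_of_nonneg_left ?_ (hG0 _)
    simp only [H]
    have : (0 : ℝ) ≤ ((X (stoppedIndex (fun x : ℕ × ℕ => x.1 = 0) a K fun k => X k ω) ω).1 : ℝ) /
      (1 - 2 * p) := by positivity
    linarith

-- As long as the cat is away from 0 the reflection plays no part, and `γ^{-k} h(C - M)` is a
-- supermartingale; it equals `γ^{-K}` at a meeting after `K` steps. Markov's inequality concludes.
open Classical in
theorem measureReal_late_meeting_le
    (hX : IsMarkovChain μ (catMouse (reflectedWalk p)) x₀ X) {γ : ℝ} {h : ℤ → ℝ} (hγ : 0 < γ)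
    (h_nonneg : ∀ d, 0 ≤ h d) (h_zero : h 0 = 1)
    (h_ne : ∀ d ≠ 0, p * h (d + 1) + (1 - p) * h (d - 1) ≤ γ * h d)
    (h_eq : p * (p * h 0 + (1 - p) * h 2) + (1 - p) * (p * h (-2) + (1 - p) * h 0) ≤ γ * h 0)
    {a n : ℕ} {A : (ℕ → ℕ × ℕ) → Prop} (hA : DependsOn A (Set.Iic a))
    (hAs : ∀ w, A w → w a = (n, n)) (K : ℕ) :
    μ.real {ω | A (fun k => X k ω) ∧ Avoids (fun x : ℕ × ℕ => x.1 = 0) a K (fun k => X k ω) ∧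
      (X (a + K) ω).1 = (X (a + K) ω).2} ≤ γ ^ K * μ.real {ω | A (fun k => X k ω)} := by
  let G : (ℕ → ℕ × ℕ) → ℝ := fun w => if A w then 1 else 0
  have hG : DependsOn G (Set.Iic a) := by
    intro w w' hw
    simp only [G, hA hw]
  have hG0 : ∀ w, 0 ≤ G w := fun w => by simp only [G]; split_ifs <;> norm_num
  let H : ℕ → ℕ × ℕ → ℝ := fun k x => γ⁻¹ ^ (k - a) * h ((x.1 : ℤ) - x.2)
  have hle := hX.integral_stopped_le (sum_reflected p) (T := stepMean p upN dnN)
    (stepMean_reflected p) hG hG0 (fun x => x.1 = 0) H (by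
      refine ae_of_all _ fun ω K _ hav => ?_
      have hc : (X (a + K) ω).1 ≠ 0 := hav (a + K) (by omega) le_rfl
      obtain ⟨d, hd⟩ := Nat.exists_eq_succ_of_ne_zero hc
      set x := X (a + K) ω
      have key : stepMean p upN dnN (fun x : ℕ × ℕ => h ((x.1 : ℤ) - x.2)) x ≤
          γ * h ((x.1 : ℤ) - x.2) := by
        by_cases hx : x.1 = x.2
        · simp only [stepMean, if_pos hx, upN, dnN, RCLike.ofReal_real_eq_id, id_eq]
          rw [← hx, hd, Nat.succ_eq_add_one, Nat.add_sub_cancel]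
          refine le_trans (le_of_eq ?_) (h_eq.trans (le_of_eq ?_))
          · push_cast
            ring_nf
          · ring_nf
        · simp only [stepMean, if_neg hx, upN, dnN, RCLike.ofReal_real_eq_id, id_eq]
          refine le_trans (le_of_eq ?_) (h_ne ((x.1 : ℤ) - x.2) (by omega))
          rw [hd, Nat.succ_eq_add_one, Nat.add_sub_cancel]
          push_cast
          ring_nf
      have e : stepMean p upN dnN (H (a + K + 1)) x = γ⁻¹ ^ (K + 1) *
          stepMean p upN dnN (fun x : ℕ × ℕ => h ((x.1 : ℤ) - x.2)) x := by
        have : a + K + 1 - a = K + 1 := by omega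
        simp only [stepMean, H, this]
        split_ifs <;> ring
      rw [e]
      refine (mul_le_mul_of_nonneg_left key (by positivity)).trans (le_of_eq ?_)
      have : a + K - a = K := by omega
      simp only [H, this]
      rw [pow_succ, mul_assoc, ← mul_assoc γ⁻¹, inv_mul_cancel₀ hγ.ne', one_mul]) K
  have hmA : MeasurableSet {ω | A (fun k => X k ω)} := measurableSet_of_dependsOn hX.measurable hA
  have e1 : ∫ ω, G (fun k => X k ω) * H a (X a ω) ∂μ = μ.real {ω | A (fun k => X k ω)} := by
    rw [← integral_indicator_one hmA]
    refine integral_congr_ae (ae_of_all _ fun ω => ?_)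
    by_cases hω : A (fun k => X k ω)
    · have := hAs _ hω
      simp [G, hω, H, this, h_zero, Set.indicator]
    · simp [G, hω, Set.indicator]
  have hmB : MeasurableSet {ω | A (fun k => X k ω) ∧
      Avoids (fun x : ℕ × ℕ => x.1 = 0) a K (fun k => X k ω) ∧
      (X (a + K) ω).1 = (X (a + K) ω).2} := by
    refine measurableSet_of_dependsOn (A := fun w => A w ∧
      Avoids (fun x : ℕ × ℕ => x.1 = 0) a K w ∧ (w (a + K)).1 = (w (a + K)).2) (a := a + K)
      hX.measurable ?_
    intro w w' hw
    simp only
    rw [hA fun i hi => hw i (Set.mem_Iic.2 (le_trans (Set.mem_Iic.1 hi) (by omega))),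
      dependsOn_avoids _ a K hw, hw (a + K) (Set.mem_Iic.2 le_rfl)]
  rw [e1] at hle
  rw [← inv_mul_le_iff₀ (by positivity), ← inv_pow, ← integral_indicator_one hmB,
    ← integral_const_mul]
  refine le_trans (integral_mono ?_ ?_ ?_) hle
  · exact ((integrable_const _).indicator hmB).const_mul _
  · exact hX.integrable (sum_reflected p)
      (IsMarkovChain.dependsOn_stopped hG (fun x => x.1 = 0) H K)
  · intro ω
    simp only [Set.indicator]
    split_ifs with hω
    · obtain ⟨h1, h2, h3⟩ := hω
      simp only [Pi.one_apply, mul_one]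
      rw [stoppedIndex_of_avoids h2]
      simp [G, h1, H, h3, h_zero]
    · rw [mul_zero]
      exact mul_nonneg (hG0 _) (mul_nonneg (by positivity) (h_nonneg _))

/-- Optional stopping for `z^k u_{C_k}(1/z)`: the cat starts at 0, where `u_0 = 1`, and meets the
mouse at height `m`. Until then it stays in `[0, m]`, which gives the domination needed to let `K →
∞`. -/
theorem integral_hit_transform (hp : 0 < p) (hp' : p < 1 / 2)
    (hX : IsMarkovChain μ (catMouse (reflectedWalk p)) x₀ X) {z : ℂ} (hz : ‖z‖ = 1) {a m : ℕ}
    {G : (ℕ → ℕ × ℕ) → ℂ} (hG : DependsOn G (Set.Iic a)) (hGs : ∀ w, G w ≠ 0 → w a = (0, m)) :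
    (∫ ω, G (fun k => X k ω) *
      z ^ (firstFrom (fun ℓ => (X ℓ ω).1 = (X ℓ ω).2) a).toNat ∂μ) * hitPoly p z⁻¹ m =
      (∫ ω, G (fun k => X k ω) ∂μ) * z ^ a := by
  have hz0 : z ≠ 0 := fun h => by simp [h] at hz
  let D : ℕ × ℕ → Prop := fun x => x.1 = x.2
  let H : ℕ → ℕ × ℕ → ℂ := fun k x => z ^ k * hitPoly p z⁻¹ x.1
  have heq := hX.integral_stopped_eq (sum_reflected p) (T := stepMean p upN dnN)
    (stepMean_reflected p) hG D H (by
      filter_upwards [ae_legal hX] with ω hω K hGω hA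
      have hs := hGs _ hGω
      obtain ⟨h2, h1⟩ := hω.of_avoids_meet (m := m) (by rw [hs]) (by rw [hs]; exact Nat.zero_le _) hA
      rw [stepMean, if_neg (by omega)]
      simp only [H, upN, dnN]
      have := hitPoly_mean hp z⁻¹ (X (a + K) ω).1
      calc _ = z ^ (a + K + 1) * ((p : ℂ) * hitPoly p z⁻¹ ((X (a + K) ω).1 + 1) +
            (1 - p) * hitPoly p z⁻¹ ((X (a + K) ω).1 - 1)) := by
              simp only [RCLike.ofReal_eq_complex_ofReal]; ring
        _ = _ := by rw [this, pow_succ]; field_simp)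
  have hmeet := ae_meets hp hp' hX (a := a) (m := m) (G := fun w => ‖G w‖)
    (fun w w' hw => by simp only [hG hw]) (fun w => norm_nonneg _)
    (fun w hw => hGs w (by simpa using hw))
  obtain ⟨C, hC⟩ := hX.exists_bound (sum_reflected p) hG
  have e1 : ∫ ω, G (fun k => X k ω) * H a (X a ω) ∂μ = (∫ ω, G (fun k => X k ω) ∂μ) * z ^ a := by
    rw [← integral_mul_const]
    refine integral_congr_ae (ae_of_all _ fun ω => ?_)
    by_cases hGω : G (fun k => X k ω) = 0
    · simp [hGω]
    · have := hGs _ hGω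
      simp [H, this, hitPoly]
  have hlim := tendsto_integral_of_dominated_convergence (μ := μ)
    (F := fun K ω => G (fun k => X k ω) * H (stoppedIndex D a K (fun k => X k ω))
        (X (stoppedIndex D a K (fun k => X k ω)) ω))
    (f := fun ω => G (fun k => X k ω) *
      z ^ (firstFrom (fun ℓ => (X ℓ ω).1 = (X ℓ ω).2) a).toNat * hitPoly p z⁻¹ m)
    (bound := fun _ => C * ∑ c ∈ Finset.range (m + 1), ‖hitPoly p z⁻¹ c‖)
    (fun K => (hX.integrable (sum_reflected p)
      (IsMarkovChain.dependsOn_stopped hG D H K)).aestronglyMeasurable)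
    (integrable_const _) (fun K => by
      filter_upwards [ae_legal hX, hC] with ω hω hCω
      by_cases hGω : G (fun k => X k ω) = 0
      · rw [hGω, zero_mul, norm_zero]
        exact mul_nonneg ((norm_nonneg _).trans hCω) (Finset.sum_nonneg fun _ _ => norm_nonneg _)
      have hs := hGs _ hGω
      have h1 := (hω.stopped_meet (a := a) (m := m) (by rw [hs])
        (by rw [hs]; exact Nat.zero_le _) K).2
      rw [norm_mul]
      refine mul_le_mul hCω ?_ (norm_nonneg _) ((norm_nonneg _).trans hCω)
      simp only [H, norm_mul, norm_pow, hz, one_pow, one_mul]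
      exact Finset.single_le_sum (f := fun c => ‖hitPoly p z⁻¹ c‖) (fun _ _ => norm_nonneg _)
        (Finset.mem_range.2 (Nat.lt_succ_of_le h1))) (by
      filter_upwards [ae_legal hX, hmeet] with ω hω hmω
      by_cases hGω : G (fun k => X k ω) = 0
      · simp [hGω]
      have hs := hGs _ hGω
      obtain ⟨b, hb⟩ := ENat.ne_top_iff_exists.1 (hmω (by simpa using hGω)).ne
      refine tendsto_const_nhds.congr' ?_
      filter_upwards [eventually_ge_atTop b] with K hK
      have hst := hω.stopped_meet (a := a) (m := m) (by rw [hs])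
        (by rw [hs]; exact Nat.zero_le _) K
      have hi : stoppedIndex D a K (fun k => X k ω) = b := stoppedIndex_eq hb.symm (by omega)
      have hi' : stoppedIndex (fun x : ℕ × ℕ => x.1 = x.2) a K (fun k => X k ω) = b := hi
      rw [hi'] at hst
      have hD := (firstFrom_eq_coe_iff.1 hb.symm).2.1
      have hbm : (X b ω).1 = m := hD.trans hst.1
      rw [hi, ← hb, ENat.toNat_natCast]
      simp only [H, hbm]
      ring)
  rw [← integral_mul_const, ← e1]
  refine tendsto_nhds_unique hlim ?_
  simp_rw [heq]
  exact tendsto_const_nhds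

end Reflected

/-! ### Meetings of the free chain -/

section Free

variable {Ω : Type*} [MeasurableSpace Ω] {μ : Measure Ω} [IsProbabilityMeasure μ] {p : ℝ}
  {X : ℕ → Ω → ℤ × ℤ}

/-- The supermartingale of the reflected case; without a boundary no stopping is needed. -/
theorem measureReal_free_meeting_le
    (hX : IsMarkovChain μ (catMouse (freeWalk p)) (0, 0) X) {γ : ℝ} {h : ℤ → ℝ} (hγ : 0 < γ)
    (h_nonneg : ∀ d, 0 ≤ h d) (h_zero : h 0 = 1)
    (h_ne : ∀ d ≠ 0, p * h (d + 1) + (1 - p) * h (d - 1) ≤ γ * h d)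
    (h_eq : p * (p * h 0 + (1 - p) * h 2) + (1 - p) * (p * h (-2) + (1 - p) * h 0) ≤ γ * h 0)
    (K : ℕ) :
    μ.real {ω | (X K ω).1 = (X K ω).2} ≤ γ ^ K := by
  let F : ℤ × ℤ → ℝ := fun x => h (x.1 - x.2)
  have hdep : ∀ K, DependsOn (fun w : ℕ → ℤ × ℤ => F (w K)) (Set.Iic K) := fun K w w' hw => by
    simp only [hw K (Set.mem_Iic.2 le_rfl)]
  have key : ∀ x, stepMean p upZ dnZ F x ≤ γ * F x := by
    intro x
    by_cases hx : x.1 = x.2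
    · simp only [stepMean, if_pos hx, upZ, dnZ, RCLike.ofReal_real_eq_id, id_eq, F]
      rw [← hx]
      refine le_trans (le_of_eq ?_) (h_eq.trans (le_of_eq ?_)) <;> ring_nf
    · simp only [stepMean, if_neg hx, upZ, dnZ, RCLike.ofReal_real_eq_id, id_eq, F]
      refine le_trans (le_of_eq ?_) (h_ne (x.1 - x.2) (by omega))
      ring_nf
  have hF : ∀ K, ∫ ω, F (X K ω) ∂μ ≤ γ ^ K := by
    intro K
    induction K with
    | zero =>
      have : ∫ ω, F (X 0 ω) ∂μ = ∫ _, 1 ∂μ := by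
        refine integral_congr_ae ?_
        filter_upwards [hX.ae_init] with ω hω
        simp [hω, F, h_zero]
      rw [this]
      simp
    | succ K ih =>
      have e := hX.integral_succ (sum_free p) (𝕜 := ℝ) (a := K) (G := fun _ => 1)
        (fun _ _ _ => rfl) F
      simp_rw [← stepMean_free (𝕜 := ℝ) p, one_mul] at e
      rw [e]
      calc ∫ ω, stepMean p upZ dnZ F (X K ω) ∂μ ≤ ∫ ω, γ * F (X K ω) ∂μ := by
            refine integral_mono ?_ ((hX.integrable (sum_free p) (hdep K)).const_mul _)
              fun ω => key _
            exact hX.integrable (sum_free p) (G := fun w => stepMean p upZ dnZ F (w K)) (a := K)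
              fun w w' hw => by simp only [hw K (Set.mem_Iic.2 le_rfl)]
        _ ≤ γ ^ (K + 1) := by
            rw [integral_const_mul, pow_succ, mul_comm]
            gcongr
  have hm : MeasurableSet {ω | (X K ω).1 = (X K ω).2} :=
    measurableSet_of_dependsOn (A := fun w : ℕ → ℤ × ℤ => (w K).1 = (w K).2) (a := K)
      hX.measurable fun w w' hw => by simp only [hw K (Set.mem_Iic.2 le_rfl)]
  refine le_trans ?_ (hF K)
  rw [← integral_indicator_one hm]
  refine integral_mono ((integrable_const _).indicator hm)
    (hX.integrable (sum_free p) (hdep K)) fun ω => ?_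
  simp only [Set.indicator]
  split_ifs with hω
  · have : (X K ω).1 = (X K ω).2 := hω
    simp [F, this, h_zero]
  · exact h_nonneg _

end Free

theorem rho_pos {p : ℝ} (hp : 0 < p) (hp' : p < 1 / 2) : 0 < rho p :=
  div_pos hp (by linarith)

theorem rho_lt_one {p : ℝ} (hp' : p < 1 / 2) : rho p < 1 := by
  rw [rho, div_lt_one (by linarith)]
  linarith

/-! ### Asymptotics of the hitting transforms -/

section HitPoly

variable {p : ℝ}

/-- With `d_k = u_{k+1} - u_k` the recursion reads `p d_k = (1-p) d_{k-1} + (ζ-1) u_k`, so `ρ^k d_k`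
telescopes. The weights `ρ^j` form the reversible measure of the walk. -/
theorem hitPoly_succ_sub (hp : 0 < p) (hp' : p < 1 / 2) (ζ : ℂ) (k : ℕ) :
    hitPoly p ζ (k + 1) - hitPoly p ζ k =
      (ζ - 1) / p * ((rho p : ℂ) ^ k)⁻¹ *
        ∑ j ∈ Finset.range (k + 1), (rho p : ℂ) ^ j * hitPoly p ζ j := by
  have hpc : (p : ℂ) ≠ 0 := by exact_mod_cast hp.ne'
  have hρ : (rho p : ℂ) ≠ 0 := by exact_mod_cast (rho_pos hp hp').ne'
  have hρ' : (rho p : ℂ) * (1 - p) = p := by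
    have : rho p * (1 - p) = p := div_mul_cancel₀ _ (by linarith)
    exact_mod_cast this
  induction k with
  | zero =>
    rw [Finset.sum_range_one]
    simp only [hitPoly, pow_zero]
    field_simp
    ring
  | succ k ih =>
    rw [Finset.sum_range_succ, mul_add]
    have h1 := hitPoly_mean hp ζ (k + 1)
    rw [Nat.add_sub_cancel] at h1
    have h2 : (rho p : ℂ) * ((ζ - 1) / p * ((rho p : ℂ) ^ (k + 1))⁻¹ *
        ∑ j ∈ Finset.range (k + 1), (rho p : ℂ) ^ j * hitPoly p ζ j) =
        hitPoly p ζ (k + 1) - hitPoly p ζ k := by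
      rw [ih, pow_succ]
      field_simp
    have h3 : (ζ - 1) / p * ((rho p : ℂ) ^ (k + 1))⁻¹ *
        ((rho p : ℂ) ^ (k + 1) * hitPoly p ζ (k + 1)) = (ζ - 1) / p * hitPoly p ζ (k + 1) := by
      field_simp
    rw [h3]
    set W := (ζ - 1) / p * ((rho p : ℂ) ^ (k + 1))⁻¹ *
        ∑ j ∈ Finset.range (k + 1), (rho p : ℂ) ^ j * hitPoly p ζ j
    have h4 : (p : ℂ) * W = (1 - p) * (hitPoly p ζ (k + 1) - hitPoly p ζ k) := by
      rw [← h2]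
      linear_combination -W * hρ'
    have h5 : (p : ℂ) * ((ζ - 1) / p * hitPoly p ζ (k + 1)) = (ζ - 1) * hitPoly p ζ (k + 1) := by
      field_simp
    refine mul_left_cancel₀ hpc ?_
    rw [mul_add, h4, h5]
    linear_combination h1

theorem sum_range_pow_sub {ρ : ℝ} (hρ : ρ < 1) (n : ℕ) :
    ∑ j ∈ Finset.range n, ρ ^ (n - j) = ρ * (1 - ρ ^ n) / (1 - ρ) := by
  have h1 : 1 - ρ ≠ 0 := by linarith
  have h : ∑ j ∈ Finset.range n, ρ ^ (n - j) = ∑ j ∈ Finset.range n, ρ * ρ ^ j := by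
    rw [← Finset.sum_range_reflect]
    refine Finset.sum_congr rfl fun j hj => ?_
    have := Finset.mem_range.1 hj
    rw [← pow_succ']
    congr 1
    omega
  have hg := geom_sum_mul ρ n
  rw [h, ← Finset.mul_sum, eq_div_iff h1]
  linear_combination -ρ * hg

theorem geom_sum_le_inv {ρ : ℝ} (hρ0 : 0 ≤ ρ) (hρ : ρ < 1) (n : ℕ) :
    ∑ j ∈ Finset.range n, ρ ^ j ≤ (1 - ρ)⁻¹ := by
  rw [geom_sum_eq hρ.ne, inv_eq_one_div, ← neg_div_neg_eq, neg_sub, neg_sub]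
  have := pow_nonneg hρ0 n
  exact div_le_div_of_nonneg_right (by linarith) (by linarith)

theorem norm_hitPoly_succ_sub_le (hp : 0 < p) (hp' : p < 1 / 2) {ζ : ℂ} {K V : ℝ} {n k : ℕ}
    (hζ : ‖ζ - 1‖ ≤ K * rho p ^ n) (hk : k ≤ n) (hV : ∀ i ≤ k, ‖hitPoly p ζ i‖ ≤ V) :
    ‖hitPoly p ζ (k + 1) - hitPoly p ζ k‖ ≤ K / p * (1 - rho p)⁻¹ * V * rho p ^ (n - k) := by
  have hρ := rho_pos hp hp'
  have hρ1 := rho_lt_one hp'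
  have hV0 : 0 ≤ V := (norm_nonneg _).trans (hV k le_rfl)
  rw [hitPoly_succ_sub hp hp', norm_mul, norm_mul, norm_div, norm_inv, norm_pow,
    Complex.norm_of_nonneg hp.le, Complex.norm_of_nonneg hρ.le]
  have h1 : ‖∑ j ∈ Finset.range (k + 1), (rho p : ℂ) ^ j * hitPoly p ζ j‖ ≤ (1 - rho p)⁻¹ * V := by
    refine (norm_sum_le _ _).trans ?_
    refine le_trans (Finset.sum_le_sum (g := fun j => rho p ^ j * V) fun j hj => ?_) ?_
    · rw [norm_mul, norm_pow, Complex.norm_of_nonneg hρ.le]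
      exact mul_le_mul_of_nonneg_left (hV j (Nat.lt_succ_iff.1 (Finset.mem_range.1 hj)))
        (by positivity)
    · rw [← Finset.sum_mul]
      exact mul_le_mul_of_nonneg_right (geom_sum_le_inv hρ.le hρ1 _) hV0
  have h2 : ‖ζ - 1‖ / p * (rho p ^ k)⁻¹ ≤ K / p * rho p ^ (n - k) := by
    rw [← div_eq_mul_inv, div_le_iff₀ (by positivity), mul_assoc, ← pow_add, Nat.sub_add_cancel hk,
      div_mul_eq_mul_div]
    exact div_le_div_of_nonneg_right hζ hp.le
  calc _ ≤ (K / p * rho p ^ (n - k)) * ((1 - rho p)⁻¹ * V) :=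
        mul_le_mul h2 h1 (norm_nonneg _) (le_trans (by positivity) h2)
    _ = _ := by ring

/-- A discrete Grönwall argument: one step multiplies the bound by at most `1 + B ρ^{n-k}`, and
these exponents have a sum bounded independently of `n`. -/
theorem norm_hitPoly_le (hp : 0 < p) (hp' : p < 1 / 2) {ζ : ℂ} {K : ℝ} (hK : 0 ≤ K) {n k : ℕ}
    (hζ : ‖ζ - 1‖ ≤ K * rho p ^ n) (hk : k ≤ n) :
    ‖hitPoly p ζ k‖ ≤ Real.exp (K / p * (1 - rho p)⁻¹ * (rho p / (1 - rho p))) := by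
  have hρ := rho_pos hp hp'
  have hρ1 := rho_lt_one hp'
  have hq : 0 < 1 - rho p := by linarith
  set B := K / p * (1 - rho p)⁻¹ with hB
  have hB0 : 0 ≤ B := by positivity
  let E : ℕ → ℝ := fun k => Real.exp (B * ∑ j ∈ Finset.range k, rho p ^ (n - j))
  have hEmono : Monotone E := by
    refine monotone_nat_of_le_succ fun k => Real.exp_le_exp.2 ?_
    rw [Finset.sum_range_succ]
    exact mul_le_mul_of_nonneg_left (by simp; positivity) hB0
  have key : ∀ k ≤ n, ∀ i ≤ k, ‖hitPoly p ζ i‖ ≤ E i := by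
    intro k
    induction k with
    | zero =>
      intro _ i hi
      obtain rfl : i = 0 := by omega
      simp [E, hitPoly]
    | succ k ih =>
      intro hk i hi
      rcases hi.lt_or_eq with hi | rfl
      · exact ih (by omega) i (by omega)
      have hik := ih (by omega)
      have h1 := norm_hitPoly_succ_sub_le hp hp' hζ (k := k) (by omega) (V := E k)
        fun i hi => (hik i hi).trans (hEmono hi)
      calc ‖hitPoly p ζ (k + 1)‖ =
            ‖hitPoly p ζ k + (hitPoly p ζ (k + 1) - hitPoly p ζ k)‖ := by congr 1; ring
        _ ≤ E k + B * E k * rho p ^ (n - k) :=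
            (norm_add_le _ _).trans (add_le_add (hik k le_rfl) h1)
        _ = E k * (B * rho p ^ (n - k) + 1) := by ring
        _ ≤ E k * Real.exp (B * rho p ^ (n - k)) :=
            mul_le_mul_of_nonneg_left (Real.add_one_le_exp _) (Real.exp_pos _).le
        _ = E (k + 1) := by
            simp only [E]
            rw [← Real.exp_add, Finset.sum_range_succ, mul_add]
  refine (key k hk k le_rfl).trans ((hEmono hk).trans (Real.exp_le_exp.2 ?_))
  rw [sum_range_pow_sub hρ1]
  refine mul_le_mul_of_nonneg_left (div_le_div_of_nonneg_right ?_ hq.le) hB0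
  have := pow_pos hρ n
  nlinarith

/-- The factor `ρ^{n-k}` matters: against the weight `ρ^k` it becomes `ρ^n`, so that replacing `u_j`
by 1 in the double sum costs only `O(n³ ρ^n)`. -/
theorem norm_hitPoly_sub_one_le (hp : 0 < p) (hp' : p < 1 / 2) {ζ : ℂ} {K V : ℝ} (hK : 0 ≤ K)
    {n k : ℕ} (hζ : ‖ζ - 1‖ ≤ K * rho p ^ n) (hk : k ≤ n)
    (hV : ∀ i ≤ n, ‖hitPoly p ζ i‖ ≤ V) :
    ‖hitPoly p ζ k - 1‖ ≤ n * (K / p * (1 - rho p)⁻¹ * V) * rho p ^ (n - k) := by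
  have hρ := rho_pos hp hp'
  have hρ1 := rho_lt_one hp'
  have hq : 0 < 1 - rho p := by linarith
  have hV0 : 0 ≤ V := (norm_nonneg _).trans (hV 0 (Nat.zero_le _))
  have h1 : hitPoly p ζ k - 1 =
      ∑ j ∈ Finset.range k, (hitPoly p ζ (j + 1) - hitPoly p ζ j) := by
    rw [Finset.sum_range_sub]
    rfl
  rw [h1]
  refine (norm_sum_le _ _).trans ((Finset.sum_le_sum
    (g := fun _ => K / p * (1 - rho p)⁻¹ * V * rho p ^ (n - k)) fun j hj => ?_).trans ?_)
  · have hj' := Finset.mem_range.1 hj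
    refine (norm_hitPoly_succ_sub_le hp hp' hζ (by omega) fun i hi => hV i (by omega)).trans ?_
    refine mul_le_mul_of_nonneg_left (pow_le_pow_of_le_one hρ.le hρ1.le (by omega)) (by positivity)
  · rw [Finset.sum_const, Finset.card_range, nsmul_eq_mul, ← mul_assoc]
    gcongr

theorem hitPoly_sub_one_eq (hp : 0 < p) (hp' : p < 1 / 2) (ζ : ℂ) (n : ℕ) :
    hitPoly p ζ n - 1 = (ζ - 1) / (rho p : ℂ) ^ n / p *
      ∑ k ∈ Finset.range n, (rho p : ℂ) ^ (n - k) *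
        ∑ j ∈ Finset.range (k + 1), (rho p : ℂ) ^ j * hitPoly p ζ j := by
  have hρ : (rho p : ℂ) ≠ 0 := by exact_mod_cast (rho_pos hp hp').ne'
  have h1 : hitPoly p ζ n - 1 =
      ∑ j ∈ Finset.range n, (hitPoly p ζ (j + 1) - hitPoly p ζ j) := by
    rw [Finset.sum_range_sub]
    rfl
  rw [h1, Finset.mul_sum]
  refine Finset.sum_congr rfl fun k hk => ?_
  have hk' := Finset.mem_range.1 hk
  rw [hitPoly_succ_sub hp hp', ← mul_assoc]
  congr 1
  have : (rho p : ℂ) ^ n = (rho p : ℂ) ^ (n - k) * (rho p : ℂ) ^ k := by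
    rw [← pow_add, Nat.sub_add_cancel hk'.le]
  rw [this]
  field_simp

theorem sum_sum_pow {ρ : ℝ} (hρ1 : ρ < 1) (n : ℕ) :
    ∑ k ∈ Finset.range n, ρ ^ (n - k) * ∑ j ∈ Finset.range (k + 1), ρ ^ j =
      (1 - ρ)⁻¹ * (ρ * (1 - ρ ^ n) / (1 - ρ) - n * ρ ^ n * ρ) := by
  have hq : 1 - ρ ≠ 0 := by linarith
  have h : ∀ k ∈ Finset.range n, ρ ^ (n - k) * ∑ j ∈ Finset.range (k + 1), ρ ^ j =
      (1 - ρ)⁻¹ * (ρ ^ (n - k) - ρ ^ n * ρ) := by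
    intro k hk
    have hk' := Finset.mem_range.1 hk
    have hg := geom_sum_mul ρ (k + 1)
    have h2 : ρ ^ n = ρ ^ (n - k) * ρ ^ k := by
      rw [← pow_add, Nat.sub_add_cancel hk'.le]
    rw [inv_mul_eq_div, eq_div_iff hq, h2]
    rw [pow_succ] at hg
    linear_combination -ρ ^ (n - k) * hg
  rw [Finset.sum_congr rfl h, ← Finset.mul_sum, Finset.sum_sub_distrib, sum_range_pow_sub hρ1,
    Finset.sum_const, Finset.card_range, nsmul_eq_mul, mul_assoc]

/-- With `u_j` replaced by 1, the double sum of `hitPoly_sub_one_eq` tends to `ρ/(1-ρ)²`. Its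
prefactor tends to `α/p`, and `ρ = p(1+ρ)` gives the constant. -/
theorem tendsto_hitPoly (hp : 0 < p) (hp' : p < 1 / 2) {ζ : ℕ → ℂ} {α : ℂ}
    (hζ : Tendsto (fun n => (ζ n - 1) / (rho p : ℂ) ^ n) atTop (𝓝 α)) :
    Tendsto (fun n => hitPoly p (ζ n) n) atTop
      (𝓝 (1 + α * ((1 + rho p) / (1 - rho p) ^ 2 : ℝ))) := by
  have hρ := rho_pos hp hp'
  have hρ1 := rho_lt_one hp'
  have hq : 0 < 1 - rho p := by linarith
  obtain ⟨K, hK⟩ := hζ.norm.bddAbove_range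
  have hK' : ∀ n, ‖ζ n - 1‖ ≤ K * rho p ^ n := by
    intro n
    have := hK (Set.mem_range_self n)
    rwa [norm_div, norm_pow, Complex.norm_of_nonneg hρ.le, div_le_iff₀ (by positivity)] at this
  have hK0 : 0 ≤ K := (norm_nonneg _).trans (hK (Set.mem_range_self 0))
  set V := Real.exp (K / p * (1 - rho p)⁻¹ * (rho p / (1 - rho p)))
  have hV : ∀ n, ∀ i ≤ n, ‖hitPoly p (ζ n) i‖ ≤ V := fun n i hi =>
    norm_hitPoly_le hp hp' hK0 (hK' n) hi
  set B := K / p * (1 - rho p)⁻¹ * V with hB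
  have hB0 : 0 ≤ B := by positivity
  let R : ℕ → ℂ := fun n => ∑ k ∈ Finset.range n, (rho p : ℂ) ^ (n - k) *
        ∑ j ∈ Finset.range (k + 1), (rho p : ℂ) ^ j * (hitPoly p (ζ n) j - 1)
  have hR : ∀ n, ‖R n‖ ≤ B * (n ^ 3 * rho p ^ n) := by
    intro n
    have h1 : ∀ k ∈ Finset.range n, ‖(rho p : ℂ) ^ (n - k) *
        ∑ j ∈ Finset.range (k + 1), (rho p : ℂ) ^ j * (hitPoly p (ζ n) j - 1)‖ ≤
        n * (n * B * rho p ^ n) := by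
      intro k hk
      have hk' := Finset.mem_range.1 hk
      rw [norm_mul, norm_pow, Complex.norm_of_nonneg hρ.le]
      refine (mul_le_of_le_one_left (norm_nonneg _) (pow_le_one₀ hρ.le hρ1.le)).trans ?_
      refine (norm_sum_le _ _).trans ((Finset.sum_le_sum (g := fun _ => n * B * rho p ^ n)
        fun j hj => ?_).trans ?_)
      · have hj' := Finset.mem_range.1 hj
        rw [norm_mul, norm_pow, Complex.norm_of_nonneg hρ.le]
        refine (mul_le_mul_of_nonneg_left (norm_hitPoly_sub_one_le hp hp' hK0 (hK' n) (k := j)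
          (by omega) (hV n)) (by positivity)).trans (le_of_eq ?_)
        rw [mul_left_comm, ← pow_add]
        congr 2
        omega
      · rw [Finset.sum_const, Finset.card_range, nsmul_eq_mul]
        gcongr
        omega
    refine (norm_sum_le _ _).trans ((Finset.sum_le_sum h1).trans (le_of_eq ?_))
    rw [Finset.sum_const, Finset.card_range, nsmul_eq_mul]
    ring
  have hR0 : Tendsto R atTop (𝓝 0) := by
    refine squeeze_zero_norm hR ?_
    simpa using (tendsto_pow_const_mul_const_pow_of_lt_one 3 hρ.le hρ1).const_mul B
  have hA : Tendsto (fun n : ℕ => (1 - rho p)⁻¹ * (rho p * (1 - rho p ^ n) / (1 - rho p) -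
      n * rho p ^ n * rho p)) atTop
      (𝓝 ((1 - rho p)⁻¹ * (rho p * (1 - 0) / (1 - rho p) - 0 * rho p))) := by
    refine Tendsto.const_mul _ (Tendsto.sub ?_ ?_)
    · exact ((tendsto_const_nhds.sub (tendsto_pow_atTop_nhds_zero_of_lt_one hρ.le hρ1)).const_mul
        _).div_const _
    · exact (tendsto_self_mul_const_pow_of_lt_one hρ.le hρ1).mul_const _
  have hA' := (Complex.continuous_ofReal.tendsto _).comp hA
  have hmain := ((hζ.div_const (p : ℂ)).mul (hA'.add hR0)).const_add 1
  have hval : (1 : ℂ) + α / p * (((1 - rho p)⁻¹ * (rho p * (1 - 0) / (1 - rho p) -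
      0 * rho p) : ℝ) + 0) = 1 + α * ((1 + rho p) / (1 - rho p) ^ 2 : ℝ) := by
    have h1 : (1 - rho p)⁻¹ * (rho p * (1 - 0) / (1 - rho p) - 0 * rho p) =
        p * ((1 + rho p) / (1 - rho p) ^ 2) := by
      have h2 : rho p = p * (1 + rho p) := by
        have : 1 - p ≠ 0 := by linarith
        rw [rho]
        field_simp
        ring
      rw [mul_div_assoc', ← h2]
      field_simp
      ring
    have hpc : (p : ℂ) ≠ 0 := by exact_mod_cast hp.ne'
    rw [h1]
    push_cast
    field_simp
    ring
  rw [hval] at hmain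
  refine hmain.congr fun n => ?_
  have h1 := hitPoly_sub_one_eq hp hp' (ζ n) n
  have h2 : ∑ k ∈ Finset.range n, (rho p : ℂ) ^ (n - k) *
        ∑ j ∈ Finset.range (k + 1), (rho p : ℂ) ^ j * hitPoly p (ζ n) j =
      ((1 - rho p)⁻¹ * (rho p * (1 - rho p ^ n) / (1 - rho p) - n * rho p ^ n * rho p) : ℝ) +
        R n := by
    rw [← sum_sum_pow hρ1]
    push_cast
    rw [← Finset.sum_add_distrib]
    refine Finset.sum_congr rfl fun k _ => ?_
    rw [← mul_add, ← Finset.sum_add_distrib]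
    congr 1
    refine Finset.sum_congr rfl fun j _ => ?_
    ring
  simp only [Function.comp_apply]
  rw [← h2, ← h1]
  ring

theorem tendsto_exp_sub_one_div {r : ℕ → ℝ} (hr : Tendsto r atTop (𝓝 0)) (hr0 : ∀ n, r n ≠ 0)
    (a : ℂ) : Tendsto (fun n => (Complex.exp (a * r n) - 1) / r n) atTop (𝓝 a) := by
  have h : HasDerivAt (fun x : ℂ => Complex.exp (a * x)) a 0 := by
    simpa using ((hasDerivAt_id (0 : ℂ)).const_mul a).cexp
  have h1 := hasDerivAt_iff_tendsto_slope_zero.1 h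
  have h2 : Tendsto (fun n => (r n : ℂ)) atTop (𝓝[≠] 0) :=
    tendsto_nhdsWithin_iff.2 ⟨by simpa [Function.comp_def] using (Complex.continuous_ofReal.tendsto 0).comp hr,
      Eventually.of_forall fun n => by simpa using hr0 n⟩
  refine (h1.comp h2).congr fun n => ?_
  simp [div_eq_inv_mul]

end HitPoly

theorem measurable_eval {S Ω : Type*} [MeasurableSpace S] [MeasurableSpace Ω] {X : ℕ → Ω → S}
    (hX : ∀ k, Measurable (X k)) {T : Ω → ℕ} (hT : Measurable T) :
    Measurable (fun ω => X (T ω) ω) := by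
  have : Measurable (fun q : Ω × ℕ => X q.2 q.1) := measurable_from_prod_countable_left hX
  exact this.comp (measurable_id.prodMk hT)

theorem measure_exists_ge_le {Ω : Type*} [MeasurableSpace Ω] {μ : Measure Ω} [IsFiniteMeasure μ]
    {A : ℕ → Set Ω} {γ : ℝ} (hγ : 0 < γ) (hγ1 : γ < 1) (hA : ∀ k, μ.real (A k) ≤ γ ^ k) (K : ℕ) :
    μ {ω | ∃ k, K ≤ k ∧ ω ∈ A k} ≤ ENNReal.ofReal (γ ^ K / (1 - γ)) := by
  have h1 : {ω | ∃ k, K ≤ k ∧ ω ∈ A k} = ⋃ k, A (K + k) := by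
    ext ω
    simp only [Set.mem_ofPred_eq, Set.mem_iUnion]
    constructor
    · rintro ⟨k, hk, h⟩
      exact ⟨k - K, by rwa [Nat.add_sub_cancel' hk]⟩
    · rintro ⟨k, h⟩
      exact ⟨K + k, by omega, h⟩
  have h2 : HasSum (fun k => γ ^ K * γ ^ k) (γ ^ K / (1 - γ)) := by
    rw [div_eq_mul_inv]
    exact (hasSum_geometric_of_lt_one hγ.le hγ1).mul_left _
  rw [h1, ← h2.tsum_eq, ENNReal.ofReal_tsum_of_nonneg (fun k => by positivity) h2.summable]
  refine (measure_iUnion_le _).trans (ENNReal.tsum_le_tsum fun k => ?_)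
  rw [← ofReal_measureReal, ← pow_add]
  exact ENNReal.ofReal_le_ofReal (hA _)

/-! ### The first meeting and finiteness of the times -/

section FirstMeeting

variable {Ω : Type*} [MeasurableSpace Ω] {μ : Measure Ω} [IsProbabilityMeasure μ] {p : ℝ}
  {n : ℕ} {X : ℕ → Ω → ℕ × ℕ}

theorem Legal.eq_of_s₁ {w : ℕ → ℕ × ℕ} (h : Legal w) (h0 : w 0 = (0, n)) {b : ℕ}
    (hb : s₁ w = b) : w b = (n, n) := by
  have hi : stoppedIndex (fun x : ℕ × ℕ => x.1 = x.2) 0 b w = b := by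
    refine stoppedIndex_eq (b := b) ?_ (by omega)
    rw [Nat.cast_zero]
    exact hb
  have h1 := h.stopped_meet (a := 0) (m := n) (by rw [h0]) (by rw [h0]; exact Nat.zero_le _) b
  rw [hi] at h1
  have h2 : (w b).1 = (w b).2 := (firstFrom_eq_coe_iff.1 hb).2.1
  exact Prod.ext (h2.trans h1.1) h1.1

theorem ae_s₁_lt_top (hp : 0 < p) (hp' : p < 1 / 2)
    (hX : IsMarkovChain μ (catMouse (reflectedWalk p)) (0, n) X) :
    ∀ᵐ ω ∂μ, s₁ (fun k => X k ω) < ⊤ := by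
  -- The initial state is `(0, n)` only almost surely, so it is imposed through `G`.
  have h := ae_meets hp hp' hX (a := 0) (m := n) (G := fun w => if w 0 = (0, n) then 1 else 0)
    (fun w w' hw => by simp only [hw 0 (Set.mem_Iic.2 le_rfl)])
    (fun w => by positivity) (fun w hw => by
      by_contra hc
      simp [hc] at hw)
  filter_upwards [h, hX.ae_init] with ω hω h0
  have := hω (by simp [h0])
  rwa [Nat.cast_zero] at this

open Classical in
theorem ae_t₁_lt_top (hp : 0 < p) (hp' : p < 1 / 2)
    (hX : IsMarkovChain μ (catMouse (reflectedWalk p)) (0, n) X) :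
    ∀ᵐ ω ∂μ, t₁ (fun k => X k ω) < ⊤ := by
  have h : ∀ b c : ℕ, ∀ᵐ ω ∂μ, (s₁ (fun k => X k ω) = b ∧ (X b ω).1 = c) →
      firstFrom (fun ℓ => (X ℓ ω).1 = 0) b < ⊤ := by
    intro b c
    refine (integral_returnTime_le hp' hX (a := b) (c := c)
      (G := fun w => if s₁ w = b ∧ (w b).1 = c then 1 else 0)
      (fun w w' hw => by
        simp only [isTrajectoryStoppingTime_s₁ b hw, hw b (Set.mem_Iic.2 le_rfl)])
      (fun w => by positivity) (fun w hw => by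
        by_contra hc
        simp [hc] at hw)).1.mono fun ω hω hc => hω ?_
    simp [hc]
  filter_upwards [ae_all_iff.2 fun b => ae_all_iff.2 (h b), ae_s₁_lt_top hp hp' hX] with ω hω h1
  obtain ⟨b, hb⟩ := ENat.ne_top_iff_exists.1 h1.ne
  have := hω b _ ⟨hb.symm, rfl⟩
  rwa [hb] at this

open Classical in
theorem ae_s₂_lt_top (hp : 0 < p) (hp' : p < 1 / 2)
    (hX : IsMarkovChain μ (catMouse (reflectedWalk p)) (0, n) X) :
    ∀ᵐ ω ∂μ, s₂ (fun k => X k ω) < ⊤ := by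
  have h : ∀ b m : ℕ, ∀ᵐ ω ∂μ, (t₁ (fun k => X k ω) = b ∧ X b ω = (0, m)) →
      firstFrom (fun ℓ => (X ℓ ω).1 = (X ℓ ω).2) b < ⊤ := by
    intro b m
    refine (ae_meets hp hp' hX (a := b) (m := m)
      (G := fun w => if t₁ w = b ∧ w b = (0, m) then 1 else 0)
      (fun w w' hw => by
        simp only [isTrajectoryStoppingTime_t₁ b hw, hw b (Set.mem_Iic.2 le_rfl)])
      (fun w => by positivity) (fun w hw => by
        by_contra hc
        simp [hc] at hw)).mono fun ω hω hc => hω ?_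
    simp [hc]
  filter_upwards [ae_all_iff.2 fun b => ae_all_iff.2 (h b), ae_t₁_lt_top hp hp' hX] with ω hω h1
  obtain ⟨b, hb⟩ := ENat.ne_top_iff_exists.1 h1.ne
  have h0 : (X b ω).1 = 0 := (firstFrom_eq_coe_iff.1 hb.symm).2.1
  have := hω b (X b ω).2 ⟨hb.symm, Prod.ext h0 rfl⟩
  rwa [hb] at this

theorem integral_pow_s₁ (hp : 0 < p) (hp' : p < 1 / 2)
    (hX : IsMarkovChain μ (catMouse (reflectedWalk p)) (0, n) X) {z : ℂ} (hz : ‖z‖ = 1) :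
    (∫ ω, z ^ (s₁ (fun k => X k ω)).toNat ∂μ) * hitPoly p z⁻¹ n = 1 := by
  have h := integral_hit_transform hp hp' hX hz (a := 0) (m := n)
    (G := fun w => if w 0 = (0, n) then 1 else 0)
    (fun w w' hw => by simp only [hw 0 (Set.mem_Iic.2 le_rfl)])
    (fun w hw => by
      by_contra hc
      simp [hc] at hw)
  have e1 : ∫ ω, (if X 0 ω = (0, n) then (1 : ℂ) else 0) ∂μ = 1 := by
    rw [integral_congr_ae (g := fun _ => 1) (hX.ae_init.mono fun ω hω => by simp [hω])]
    simp
  have e2 : ∫ ω, (if X 0 ω = (0, n) then (1 : ℂ) else 0) *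
      z ^ (firstFrom (fun ℓ => (X ℓ ω).1 = (X ℓ ω).2) (0 : ℕ)).toNat ∂μ =
      ∫ ω, z ^ (s₁ (fun k => X k ω)).toNat ∂μ := by
    refine integral_congr_ae (hX.ae_init.mono fun ω hω => ?_)
    simp only [hω, if_true, one_mul, Nat.cast_zero]
    rfl
  rw [e1, e2] at h
  simpa using h

theorem norm_integral_pow_s₁_le (z : ℂ) (hz : ‖z‖ = 1) :
    ‖∫ ω, z ^ (s₁ (fun k => X k ω)).toNat ∂μ‖ ≤ 1 := by
  refine (norm_integral_le_of_norm_le_const (C := 1) (ae_of_all _ fun ω => ?_)).trans (by simp)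
  simp [hz]

theorem hitPoly_ne_zero (hp : 0 < p) (hp' : p < 1 / 2)
    (hX : IsMarkovChain μ (catMouse (reflectedWalk p)) (0, n) X) {z : ℂ} (hz : ‖z‖ = 1) :
    hitPoly p z⁻¹ n ≠ 0 := fun h => by
  have := integral_pow_s₁ hp hp' hX hz
  simp [h] at this

/-- `1/u_n(1/z)` is the transform of a probability law. Applied to the chain started from each
height, this controls all the `u_m` on the unit circle. -/
theorem norm_inv_hitPoly_le (hp : 0 < p) (hp' : p < 1 / 2)
    (hX : IsMarkovChain μ (catMouse (reflectedWalk p)) (0, n) X) {z : ℂ} (hz : ‖z‖ = 1) :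
    ‖(hitPoly p z⁻¹ n)⁻¹‖ ≤ 1 := by
  rw [← eq_inv_of_mul_eq_one_left (integral_pow_s₁ hp hp' hX hz)]
  exact norm_integral_pow_s₁_le z hz

end FirstMeeting

/-! ### The transform of the second cycle -/

section SecondMeeting

variable {Ω : Type*} [MeasurableSpace Ω] {μ : Measure Ω} [IsProbabilityMeasure μ] {p : ℝ}
  {n : ℕ} {X : ℕ → Ω → ℕ × ℕ}

theorem measurable_s₁ (hX : ∀ k, Measurable (X k)) :
    Measurable (fun ω => (s₁ (fun k => X k ω)).toNat) :=
  isTrajectoryStoppingTime_s₁.measurable_toNat hX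

theorem measurable_t₁ (hX : ∀ k, Measurable (X k)) :
    Measurable (fun ω => (t₁ (fun k => X k ω)).toNat) :=
  isTrajectoryStoppingTime_t₁.measurable_toNat hX

theorem measurable_s₂ (hX : ∀ k, Measurable (X k)) :
    Measurable (fun ω => (s₂ (fun k => X k ω)).toNat) :=
  isTrajectoryStoppingTime_s₂.measurable_toNat hX

theorem integrable_of_discrete {ι : Type*} [Countable ι] [MeasurableSpace ι]
    [MeasurableSingletonClass ι] {E : Type*} [NormedAddCommGroup E] {τ : Ω → ι} (hτ : Measurable τ)
    (g : ι → E) {C : ℝ} (hg : ∀ i, ‖g i‖ ≤ C) : Integrable (fun ω => g (τ ω)) μ := by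
  refine Integrable.of_bound ?_ C (ae_of_all _ fun ω => hg _)
  exact ((StronglyMeasurable.of_discrete (f := g)).comp_measurable hτ).aestronglyMeasurable

-- On a fibre of `(t₁, X_{t₁})` the cat restarts from 0 at a fixed time with the mouse at a fixed
-- height `m`, so `z'^{s₂ - t₁}` integrates to the factor `1/u_m(1/z')`.
open Classical in
theorem integral_second_meeting (hp : 0 < p) (hp' : p < 1 / 2)
    (hX : IsMarkovChain μ (catMouse (reflectedWalk p)) (0, n) X) {z z' : ℂ} (hz : ‖z‖ = 1)
    (hz' : ‖z'‖ = 1) (hu : ∀ m, hitPoly p z'⁻¹ m ≠ 0) (hu1 : ∀ m, ‖(hitPoly p z'⁻¹ m)⁻¹‖ ≤ 1)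
    (Φ : ℕ → ℂ) (hΦ : ∀ m, ‖Φ m‖ ≤ 1) :
    ∫ ω, Φ (X (t₁ (fun k => X k ω)).toNat ω).2 * z ^ (t₁ (fun k => X k ω)).toNat *
        z' ^ ((s₂ (fun k => X k ω)).toNat - (t₁ (fun k => X k ω)).toNat) ∂μ =
      ∫ ω, Φ (X (t₁ (fun k => X k ω)).toNat ω).2 *
        (hitPoly p z'⁻¹ (X (t₁ (fun k => X k ω)).toNat ω).2)⁻¹ *
        z ^ (t₁ (fun k => X k ω)).toNat ∂μ := by
  have hz0 : z' ≠ 0 := fun h => by simp [h] at hz'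
  have hmt := measurable_t₁ hX.measurable
  have hms := measurable_s₂ hX.measurable
  have hme := measurable_eval hX.measurable hmt
  have i1 : Integrable (fun ω => Φ (X (t₁ (fun k => X k ω)).toNat ω).2 *
      z ^ (t₁ (fun k => X k ω)).toNat *
        z' ^ ((s₂ (fun k => X k ω)).toNat - (t₁ (fun k => X k ω)).toNat)) μ :=
    integrable_of_discrete ((hmt.prodMk hms).prodMk hme)
      (fun i : (ℕ × ℕ) × (ℕ × ℕ) => Φ i.2.2 * z ^ i.1.1 * z' ^ (i.1.2 - i.1.1)) (C := 1)
      fun i => by simpa [hz, hz'] using hΦ _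
  have i2 : Integrable (fun ω => Φ (X (t₁ (fun k => X k ω)).toNat ω).2 *
        (hitPoly p z'⁻¹ (X (t₁ (fun k => X k ω)).toNat ω).2)⁻¹ *
        z ^ (t₁ (fun k => X k ω)).toNat) μ :=
    integrable_of_discrete (hmt.prodMk hme)
      (fun i : ℕ × (ℕ × ℕ) => Φ i.2.2 * (hitPoly p z'⁻¹ i.2.2)⁻¹ * z ^ i.1) (C := 1)
      fun i => by
        rw [norm_mul, norm_mul, norm_pow, hz, one_pow, mul_one]
        exact mul_le_one₀ (hΦ _) (norm_nonneg _) (hu1 _)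
  refine integral_eq_of_fiber (hmt.prodMk hme) i1 i2 ?_
  rintro ⟨b, c, m⟩
  have hset : MeasurableSet ((fun ω => ((t₁ (fun k => X k ω)).toNat,
      X (t₁ (fun k => X k ω)).toNat ω)) ⁻¹' {(b, c, m)}) :=
    (hmt.prodMk hme) (measurableSet_singleton _)
  -- The factor `(z' ^ b)⁻¹` removes the time before `t₁ = b` from `z' ^ s₂`. The condition `c = 0`,
  -- automatic at `t₁`, makes the support of `G` visible.
  let G : (ℕ → ℕ × ℕ) → ℂ := fun w =>
    if t₁ w = b ∧ w b = (c, m) ∧ c = 0 then Φ m * z ^ b * (z' ^ b)⁻¹ else 0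
  have hG : DependsOn G (Set.Iic b) := fun w w' hw => by
    simp only [G, isTrajectoryStoppingTime_t₁ b hw, hw b (Set.mem_Iic.2 le_rfl)]
  have hGs : ∀ w, G w ≠ 0 → w b = (0, m) := fun w hw => by
    by_contra hc
    refine hw (if_neg ?_)
    rintro ⟨-, h1, rfl⟩
    exact hc h1
  have key := integral_hit_transform hp hp' hX hz' hG hGs
  have hiff : ∀ᵐ ω ∂μ, (t₁ (fun k => X k ω) = b ∧ X b ω = (c, m) ∧ c = 0) ↔
      ω ∈ (fun ω => ((t₁ (fun k => X k ω)).toNat,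
        X (t₁ (fun k => X k ω)).toNat ω)) ⁻¹' {(b, c, m)} := by
    filter_upwards [ae_t₁_lt_top hp hp' hX] with ω hω
    obtain ⟨t, ht⟩ := ENat.ne_top_iff_exists.1 hω.ne
    have h0 : (X t ω).1 = 0 := (firstFrom_eq_coe_iff.1 ht.symm).2.1
    simp only [Set.mem_preimage, Set.mem_singleton_iff, Prod.mk.injEq, ← ht, ENat.toNat_natCast,
      Nat.cast_inj]
    constructor
    · rintro ⟨rfl, h1, -⟩
      exact ⟨rfl, h1⟩
    · rintro ⟨rfl, h1⟩
      refine ⟨rfl, h1, ?_⟩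
      rw [h1] at h0
      exact h0
  have e1 : ∫ ω in (fun ω => ((t₁ (fun k => X k ω)).toNat,
        X (t₁ (fun k => X k ω)).toNat ω)) ⁻¹' {(b, c, m)},
        Φ (X (t₁ (fun k => X k ω)).toNat ω).2 * z ^ (t₁ (fun k => X k ω)).toNat *
        z' ^ ((s₂ (fun k => X k ω)).toNat - (t₁ (fun k => X k ω)).toNat) ∂μ =
      ∫ ω, G (fun k => X k ω) *
        z' ^ (firstFrom (fun ℓ => (X ℓ ω).1 = (X ℓ ω).2) b).toNat ∂μ := by
    rw [← integral_indicator hset]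
    refine integral_congr_ae ?_
    filter_upwards [hiff, ae_s₂_lt_top hp hp' hX] with ω hω hs
    by_cases h : t₁ (fun k => X k ω) = b ∧ X b ω = (c, m) ∧ c = 0
    · rw [Set.indicator_of_mem (hω.1 h)]
      have h2 : s₂ (fun k => X k ω) = firstFrom (fun ℓ => (X ℓ ω).1 = (X ℓ ω).2) b := by
        rw [s₂, h.1]
      rw [h2] at hs
      have hle : b ≤ (firstFrom (fun ℓ => (X ℓ ω).1 = (X ℓ ω).2) b).toNat := by
        have := ENat.toNat_le_toNat (le_firstFrom (fun ℓ => (X ℓ ω).1 = (X ℓ ω).2) b) hs.ne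
        rwa [ENat.toNat_natCast] at this
      simp only [h2, h.1, ENat.toNat_natCast, h.2.1, G, h.2.2, and_self, if_true]
      rw [pow_sub₀ _ hz0 hle]
      ring
    · rw [Set.indicator_of_notMem (fun h' => h (hω.2 h'))]
      simp [G, h]
  have e2 : ∫ ω in (fun ω => ((t₁ (fun k => X k ω)).toNat,
        X (t₁ (fun k => X k ω)).toNat ω)) ⁻¹' {(b, c, m)},
        Φ (X (t₁ (fun k => X k ω)).toNat ω).2 *
        (hitPoly p z'⁻¹ (X (t₁ (fun k => X k ω)).toNat ω).2)⁻¹ *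
        z ^ (t₁ (fun k => X k ω)).toNat ∂μ =
      (∫ ω, G (fun k => X k ω) ∂μ) * z' ^ b * (hitPoly p z'⁻¹ m)⁻¹ := by
    rw [← integral_indicator hset, ← integral_mul_const, ← integral_mul_const]
    refine integral_congr_ae ?_
    filter_upwards [hiff] with ω hω
    by_cases h : t₁ (fun k => X k ω) = b ∧ X b ω = (c, m) ∧ c = 0
    · rw [Set.indicator_of_mem (hω.1 h)]
      simp only [h.1, ENat.toNat_natCast, h.2.1, G, h.2.2, and_self, if_true]
      field_simp
    · rw [Set.indicator_of_notMem (fun h' => h (hω.2 h'))]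
      simp [G, h]
  rw [e1, e2, ← key, mul_inv_cancel_right₀ (hu m)]

end SecondMeeting

/-! ### Meetings between `s₁` and `t₁` -/

section LateMeetings

variable {Ω : Type*} [MeasurableSpace Ω] {μ : Measure Ω} [IsProbabilityMeasure μ] {p : ℝ}
  {n : ℕ} {X : ℕ → Ω → ℕ × ℕ}

/-- The cat and the mouse meet at time `s₁ + k`, before the return of the cat to the origin. -/
def MeetsAfter (w : ℕ → ℕ × ℕ) (k : ℕ) : Prop :=
  (((s₁ w).toNat + k : ℕ) : ℕ∞) < t₁ w ∧
    (w ((s₁ w).toNat + k)).1 = (w ((s₁ w).toNat + k)).2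

/-- Decompose over the value of `s₁`: on each fibre the chain restarts from `(n, n)` and the
supermartingale bound applies with the mass of that fibre. -/
theorem measureReal_meetsAfter_le (hp : 0 < p) (hp' : p < 1 / 2)
    (hX : IsMarkovChain μ (catMouse (reflectedWalk p)) (0, n) X) {γ : ℝ} {h : ℤ → ℝ} (hγ : 0 < γ)
    (h_nonneg : ∀ d, 0 ≤ h d) (h_zero : h 0 = 1)
    (h_ne : ∀ d ≠ 0, p * h (d + 1) + (1 - p) * h (d - 1) ≤ γ * h d)
    (h_eq : p * (p * h 0 + (1 - p) * h 2) + (1 - p) * (p * h (-2) + (1 - p) * h 0) ≤ γ * h 0)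
    (k : ℕ) : μ.real {ω | MeetsAfter (fun k => X k ω) k} ≤ γ ^ k := by
  have hms := measurable_s₁ hX.measurable
  let B : ℕ → Set Ω := fun b => {ω | (s₁ (fun k => X k ω) = b ∧ X b ω = (n, n)) ∧
    Avoids (fun x : ℕ × ℕ => x.1 = 0) b k (fun k => X k ω) ∧ (X (b + k) ω).1 = (X (b + k) ω).2}
  have hdepA : ∀ b : ℕ, DependsOn (fun w : ℕ → ℕ × ℕ => s₁ w = b ∧ w b = (n, n)) (Set.Iic b) :=
    fun b w w' hw => by simp only [isTrajectoryStoppingTime_s₁ b hw, hw b (Set.mem_Iic.2 le_rfl)]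
  have hB : ∀ b, μ.real (B b) ≤ γ ^ k * μ.real {ω | s₁ (fun k => X k ω) = b ∧ X b ω = (n, n)} :=
    fun b => measureReal_late_meeting_le hX hγ h_nonneg h_zero h_ne h_eq (hdepA b)
      (fun w hw => hw.2) k
  have hBm : ∀ b, MeasurableSet (B b) := by
    intro b
    refine measurableSet_of_dependsOn (A := fun w => (s₁ w = b ∧ w b = (n, n)) ∧
      Avoids (fun x : ℕ × ℕ => x.1 = 0) b k w ∧ (w (b + k)).1 = (w (b + k)).2) (a := b + k)
      hX.measurable ?_
    intro w w' hw
    have hw' : ∀ i ∈ Set.Iic b, w i = w' i := fun i hi =>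
      hw i (Set.mem_Iic.2 (le_trans (Set.mem_Iic.1 hi) (by omega)))
    have e1 := hdepA b hw'
    simp only at e1 ⊢
    rw [e1, dependsOn_avoids _ b k hw, hw (b + k) (Set.mem_Iic.2 le_rfl)]
  have hae : {ω | MeetsAfter (fun k => X k ω) k} =ᵐ[μ] ⋃ b, B b := by
    refine Filter.eventuallyEq_set.2 ?_
    filter_upwards [ae_s₁_lt_top hp hp' hX, ae_legal hX, hX.ae_init] with ω hω hl h0
    obtain ⟨s, hs⟩ := ENat.ne_top_iff_exists.1 hω.ne
    have hst : t₁ (fun k => X k ω) = firstFrom (fun ℓ => (X ℓ ω).1 = 0) s := by rw [t₁, ← hs]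
    have hnn := hl.eq_of_s₁ h0 hs.symm
    simp only [Set.mem_ofPred_eq, Set.mem_iUnion, MeetsAfter, B, ← hs, ENat.toNat_natCast,
      Nat.cast_inj, avoids_iff_lt_firstFrom]
    rw [hst]
    constructor
    · rintro ⟨h1, h2⟩
      exact ⟨s, ⟨rfl, hnn⟩, h1, h2⟩
    · rintro ⟨b, ⟨rfl, -⟩, h1, h2⟩
      exact ⟨h1, h2⟩
  have hBu : MeasurableSet (⋃ b, B b) := MeasurableSet.iUnion hBm
  rw [measureReal_congr hae, ← integral_indicator_one hBu]
  calc ∫ ω, (⋃ b, B b).indicator 1 ω ∂μ ≤ ∫ _, γ ^ k ∂μ := by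
        refine integral_le_of_fiber hms ((integrable_const _).indicator hBu)
          (integrable_const _) fun b => ?_
        have hf : MeasurableSet ((fun ω => (s₁ (fun k => X k ω)).toNat) ⁻¹' {b}) :=
          hms (measurableSet_singleton b)
        rw [setIntegral_indicator hBu, setIntegral_const, smul_eq_mul]
        simp only [Pi.one_apply, integral_const, smul_eq_mul, mul_one, measureReal_restrict_apply,
          MeasurableSet.univ, Set.univ_inter]
        have h1 : (fun ω => (s₁ (fun k => X k ω)).toNat) ⁻¹' {b} ∩ ⋃ b, B b ⊆ B b := by
          rintro ω ⟨h1, h2⟩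
          obtain ⟨b', hb'⟩ := Set.mem_iUnion.1 h2
          have h3 : (s₁ (fun k => X k ω)).toNat = b := h1
          rw [hb'.1.1, ENat.toNat_natCast] at h3
          rwa [← h3]
        have h2 : {ω | s₁ (fun k => X k ω) = b ∧ X b ω = (n, n)} ⊆
            (fun ω => (s₁ (fun k => X k ω)).toNat) ⁻¹' {b} := by
          rintro ω ⟨h1, -⟩
          simp [h1]
        calc _ ≤ μ.real (B b) := measureReal_mono h1
          _ ≤ _ := hB b
          _ ≤ _ := by
            rw [mul_comm]
            exact mul_le_mul_of_nonneg_right (measureReal_mono h2) (by positivity)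
    _ = γ ^ k := by simp

/-- From `n` the cat takes at least `n` steps to reach 0, so `s + n ≤ t`, and without meetings in
between the mouse does not move. -/
theorem Legal.mouse_t₁_eq {w : ℕ → ℕ × ℕ} (hl : Legal w) (h0 : w 0 = (0, n)) {s t : ℕ}
    (hs : s₁ w = s) (ht : t₁ w = t) (hm : ∀ k, n ≤ k → ¬ MeetsAfter w k) :
    (w t).2 = (w (s + n)).2 := by
  have hnn := hl.eq_of_s₁ h0 hs
  have ht' := ht
  rw [t₁, hs, firstFrom_eq_coe_iff] at ht'
  obtain ⟨hst, htz, -⟩ := ht'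
  have hst : s ≤ t := by exact_mod_cast hst
  have hc := hl.cat_le s (t - s)
  rw [Nat.add_sub_cancel' hst, hnn, htz] at hc
  refine hl.mouse_const (by simp at hc; omega) fun j hj hjt heq => ?_
  refine hm (j - s) (by omega) ?_
  have : s + (j - s) = j := by omega
  rw [MeetsAfter, hs, ht, ENat.toNat_natCast, this]
  exact ⟨by exact_mod_cast hjt, heq⟩

/-- The mouse moves, by at most one, only at meetings. Before `s₂` these occur only in `[s₁, t₁)`,
and there only during the first `K` steps. -/
theorem Legal.abs_mouse_sub_le {w : ℕ → ℕ × ℕ} (hl : Legal w) (h0 : w 0 = (0, n)) {s t k K : ℕ}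
    (hs : s₁ w = s) (ht : t₁ w = t) (hm : ∀ k, K ≤ k → ¬ MeetsAfter w k)
    (hk : (k : ℕ∞) < s₂ w) : |((w k).2 : ℝ) - n| ≤ K := by
  have hnn := hl.eq_of_s₁ h0 hs
  have hst : s ≤ t := by
    have := le_firstFrom (fun ℓ => (w ℓ).1 = 0) (s₁ w)
    have h2 : s₁ w ≤ t₁ w := this
    rw [hs, ht] at h2
    exact_mod_cast h2
  have hmid : ∀ j, s ≤ j → j ≤ t → (w j).2 ≤ n + K ∧ n ≤ (w j).2 + K := by
    intro j hsj hjt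
    have hnear : ∀ i, i ≤ K → (w (s + i)).2 ≤ n + K ∧ n ≤ (w (s + i)).2 + K := by
      intro i hi
      have := hl.mouse_near s i
      rw [hnn] at this
      simp only at this
      omega
    rcases le_total j (s + K) with h1 | h1
    · have := hnear (j - s) (by omega)
      rwa [Nat.add_sub_cancel' hsj] at this
    · have hj : (w j).2 = (w (s + K)).2 := hl.mouse_const h1 fun i hi hij heq => by
        refine hm (i - s) (by omega) ?_
        have : s + (i - s) = i := by omega
        rw [MeetsAfter, hs, ht, ENat.toNat_natCast, this]
        exact ⟨by exact_mod_cast lt_of_lt_of_le hij hjt, heq⟩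
      rw [hj]
      exact hnear K le_rfl
  have hfin : (w k).2 ≤ n + K ∧ n ≤ (w k).2 + K := by
    rcases lt_or_ge k s with h1 | h1
    · have hj : (w k).2 = (w 0).2 := hl.mouse_const (Nat.zero_le k) fun i _ hik heq => by
        exact (firstFrom_eq_coe_iff.1 hs).2.2 i (zero_le) (by omega) heq
      rw [hj, h0]
      simp
    · rcases le_total k t with h2 | h2
      · exact hmid k h1 h2
      · have hj : (w k).2 = (w t).2 := hl.mouse_const h2 fun i hti hik heq => by
          rw [s₂, ht, lt_firstFrom_iff] at hk
          exact hk i (by exact_mod_cast hti) hik.le heq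
        rw [hj]
        exact hmid t hst le_rfl
  rw [abs_le]
  have h1 : ((w k).2 : ℝ) ≤ n + K := by exact_mod_cast hfin.1
  have h2 : (n : ℝ) ≤ (w k).2 + K := by exact_mod_cast hfin.2
  constructor <;> linarith

end LateMeetings

/-! ### Comparison of the reflected and free operators -/

section Shift

variable {p : ℝ}

/-- In `K` steps from height at least `K` no step is taken downwards from 0, so truncated and true
subtraction agree. -/
theorem iterate_stepMean_shift {𝕜 : Type*} [RCLike 𝕜] (n : ℕ) (f : ℤ × ℤ → 𝕜) (K c m : ℕ)
    (hc : K ≤ c) (hm : K ≤ m) :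
    ((stepMean p upN dnN)^[K] fun x : ℕ × ℕ => f ((x.1 : ℤ) - n, (x.2 : ℤ) - n)) (c, m) =
      ((stepMean p upZ dnZ)^[K] f) ((c : ℤ) - n, (m : ℤ) - n) := by
  induction K generalizing c m with
  | zero => rfl
  | succ K ih =>
    rw [Function.iterate_succ_apply', Function.iterate_succ_apply']
    have h1 : ((c + 1 : ℕ) : ℤ) - n = (c : ℤ) - n + 1 := by push_cast; ring
    have h2 : ((c - 1 : ℕ) : ℤ) - n = (c : ℤ) - n - 1 := by omega
    by_cases h : c = m
    · subst h
      simp only [stepMean, if_true, upN, dnN, upZ, dnZ]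
      rw [ih _ _ (by omega) (by omega), ih _ _ (by omega) (by omega), ih _ _ (by omega) (by omega),
        ih _ _ (by omega) (by omega), h1, h2]
    · have h' : ¬ ((c : ℤ) - n = (m : ℤ) - n) := by omega
      simp only [stepMean, h, h', if_false, upN, dnN, upZ, dnZ]
      rw [ih _ _ (by omega) (by omega), ih _ _ (by omega) (by omega), h1, h2]

end Shift

/-! ### The asymptotic location of the free mouse -/

section FreeChain

variable {Ω : Type*} [MeasurableSpace Ω] {ν : Measure Ω} [IsProbabilityMeasure ν] {p : ℝ}
  {X : ℕ → Ω → ℤ × ℤ}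

theorem free_mouse_const {w : ℕ → ℤ × ℤ} (hl : ∀ k, w (k + 1) ∈ nextStates upZ dnZ (w k)) {K : ℕ}
    (hK : ∀ k, K ≤ k → (w k).1 ≠ (w k).2) {k : ℕ} (hk : K ≤ k) : (w k).2 = (w K).2 := by
  induction k, hk using Nat.le_induction with
  | base => rfl
  | succ k hk ih =>
    have h1 := hl k
    simp only [nextStates, Finset.mem_product, hK k hk, if_false, Finset.mem_singleton] at h1
    rw [h1.2, ih]

theorem asymptoticLocation_eq {w : ℕ → ℤ × ℤ} {K : ℕ}
    (hK : ∀ k, K ≤ k → (w k).2 = (w K).2) :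
    Tendsto (fun k => (w k).2) atTop (𝓝 (w K).2) := by
  refine tendsto_const_nhds.congr' ?_
  filter_upwards [eventually_ge_atTop K] with k hk
  exact (hK k hk).symm

theorem free_mouse_tail (hX : IsMarkovChain ν (catMouse (freeWalk p)) (0, 0) X)
    {γ : ℝ} (hγ : 0 < γ) (hγ1 : γ < 1) (hmeet : ∀ K, ν.real {ω | (X K ω).1 = (X K ω).2} ≤ γ ^ K)
    (K : ℕ) :
    ν {ω | ¬ ∀ k, K ≤ k → (X k ω).2 = (X K ω).2} ≤ ENNReal.ofReal (γ ^ K / (1 - γ)) := by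
  refine le_trans (measure_mono_ae ?_) (measure_exists_ge_le hγ hγ1 hmeet K)
  filter_upwards [hX.ae_step (sum_free p)] with ω hω h
  by_contra hc
  refine h fun k hk => free_mouse_const hω (fun j hj hne => hc ⟨j, hj, hne⟩) hk

/-- After its last meeting with the cat the mouse is fixed, and the probability that it still moves
after time `K` is at most `γ^K/(1-γ)`, which tends to 0. -/
theorem ae_tendsto_asymptoticLocation (hX : IsMarkovChain ν (catMouse (freeWalk p)) (0, 0) X)
    {γ : ℝ} (hγ : 0 < γ) (hγ1 : γ < 1)
    (hmeet : ∀ K, ν.real {ω | (X K ω).1 = (X K ω).2} ≤ γ ^ K) :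
    ∀ᵐ ω ∂ν, Tendsto (fun k => (X k ω).2) atTop
      (𝓝 (asymptoticLocation (fun k ω => (X k ω).2) ω)) := by
  have h0 : ν {ω | ∀ K, ¬ ∀ k, K ≤ k → (X k ω).2 = (X K ω).2} = 0 := by
    have hlim : Tendsto (fun K : ℕ => ENNReal.ofReal (γ ^ K / (1 - γ))) atTop (𝓝 0) := by
      have := ENNReal.tendsto_ofReal
        ((tendsto_pow_atTop_nhds_zero_of_lt_one hγ.le hγ1).div_const (1 - γ))
      simpa using this
    refine le_antisymm (ge_of_tendsto' hlim fun K => ?_) (zero_le)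
    exact (measure_mono (Set.ofPred_subset_ofPred.2 fun ω hω => hω K)).trans
      (free_mouse_tail hX hγ hγ1 hmeet K)
  have h1 : ∀ᵐ ω ∂ν, ¬ ∀ K, ¬ ∀ k, K ≤ k → (X k ω).2 = (X K ω).2 := by
    rw [ae_iff]
    simpa using h0
  filter_upwards [h1] with ω hω
  push Not at hω
  obtain ⟨K, hK⟩ := hω
  exact tendsto_nhds_limUnder ⟨_, asymptoticLocation_eq (w := fun k => X k ω) hK⟩

theorem aemeasurable_asymptoticLocation (hX : IsMarkovChain ν (catMouse (freeWalk p)) (0, 0) X)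
    {M : Ω → ℤ} (hM : ∀ᵐ ω ∂ν, Tendsto (fun k => (X k ω).2) atTop (𝓝 (M ω))) :
    AEMeasurable M ν :=
  aemeasurable_of_tendsto_metrizable_ae atTop
    (fun k => (measurable_snd.comp (hX.measurable k)).aemeasurable) hM

theorem norm_integral_sub_le_of_ae_eq_off {Ω : Type*} [MeasurableSpace Ω] {ν : Measure Ω}
    [IsProbabilityMeasure ν] {f g : Ω → ℂ} (hf : Integrable f ν) (hg : Integrable g ν)
    (hf1 : ∀ ω, ‖f ω‖ ≤ 1) (hg1 : ∀ ω, ‖g ω‖ ≤ 1) {N : Set Ω} (h : ∀ᵐ ω ∂ν, ω ∉ N → f ω = g ω)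
    {ε : ℝ} (hε : 0 ≤ ε) (hN : ν N ≤ ENNReal.ofReal ε) :
    ‖∫ ω, f ω ∂ν - ∫ ω, g ω ∂ν‖ ≤ 2 * ε := by
  rw [← integral_sub hf hg]
  -- `N` need not be measurable; its measurable hull has the same measure.
  set N' := toMeasurable ν N
  have hN' : MeasurableSet N' := measurableSet_toMeasurable ν N
  have hle : ∀ᵐ ω ∂ν, ‖f ω - g ω‖ ≤ N'.indicator (fun _ => (2 : ℝ)) ω := by
    filter_upwards [h] with ω hω
    by_cases hm : ω ∈ N'
    · rw [Set.indicator_of_mem hm]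
      exact (norm_sub_le _ _).trans (by linarith [hf1 ω, hg1 ω])
    · rw [Set.indicator_of_notMem hm, hω fun hn => hm (subset_toMeasurable ν N hn)]
      simp
  refine (norm_integral_le_of_norm_le ((integrable_const _).indicator hN') hle).trans ?_
  rw [integral_indicator hN', setIntegral_const, smul_eq_mul, mul_comm]
  refine mul_le_mul_of_nonneg_left ?_ (by norm_num)
  rw [measureReal_def, measure_toMeasurable]
  exact ENNReal.toReal_le_of_le_ofReal hε hN

theorem norm_integral_mouse_sub_le (hX : IsMarkovChain ν (catMouse (freeWalk p)) (0, 0) X)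
    {γ : ℝ} (hγ : 0 < γ) (hγ1 : γ < 1)
    (hmeet : ∀ K, ν.real {ω | (X K ω).1 = (X K ω).2} ≤ γ ^ K) {M : Ω → ℤ}
    (hM : ∀ᵐ ω ∂ν, Tendsto (fun k => (X k ω).2) atTop (𝓝 (M ω)))
    (F : ℤ → ℂ) (hF : ∀ m, ‖F m‖ ≤ 1) (K : ℕ) :
    ‖∫ ω, F (X K ω).2 ∂ν - ∫ ω, F (M ω) ∂ν‖ ≤ 2 * (γ ^ K / (1 - γ)) := by
  have hMm := aemeasurable_asymptoticLocation hX hM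
  have hγ' : 0 < 1 - γ := by linarith
  refine norm_integral_sub_le_of_ae_eq_off ?_ ?_ (fun _ => hF _) (fun _ => hF _) ?_ (by positivity)
    (free_mouse_tail hX hγ hγ1 hmeet K)
  · exact integrable_of_discrete (hX.measurable K) (fun x : ℤ × ℤ => F x.2) fun x => hF _
  · refine Integrable.of_bound ?_ 1 (ae_of_all _ fun ω => hF _)
    exact (StronglyMeasurable.of_discrete (f := F)).aestronglyMeasurable.comp_aemeasurable hMm
  · filter_upwards [hM] with ω hω h
    rw [not_not] at h
    rw [tendsto_nhds_unique hω (asymptoticLocation_eq (w := fun k => X k ω) h)]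

theorem integral_free_eq_iterate (hX : IsMarkovChain ν (catMouse (freeWalk p)) (0, 0) X)
    (f : ℤ × ℤ → ℂ) (K : ℕ) :
    ∫ ω, f (X K ω) ∂ν = ((stepMean p upZ dnZ)^[K] f) (0, 0) := by
  have h := hX.integral_iterate (sum_free p) (T := stepMean p upZ dnZ) (stepMean_free p) (a := 0)
    (G := fun _ => (1 : ℂ)) (fun _ _ _ => rfl) K f
  simp only [one_mul, zero_add] at h
  rw [h, integral_congr_ae (g := fun _ => ((stepMean p upZ dnZ)^[K] f) (0, 0))
    (hX.ae_init.mono fun ω hω => by simp [hω])]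
  simp

end FreeChain

/-! ### From the first return time to the first meeting time -/

section Comparison

variable {Ω : Type*} [MeasurableSpace Ω] {μ : Measure Ω} [IsProbabilityMeasure μ] {p : ℝ}
  {n : ℕ} {X : ℕ → Ω → ℕ × ℕ}

theorem norm_pow_sub_one_le {z : ℂ} (hz : ‖z‖ = 1) (k : ℕ) : ‖z ^ k - 1‖ ≤ k * ‖z - 1‖ := by
  induction k with
  | zero => simp
  | succ k ih =>
    have : z ^ (k + 1) - 1 = z * (z ^ k - 1) + (z - 1) := by ring
    rw [this]
    refine (norm_add_le _ _).trans ?_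
    rw [norm_mul, hz, one_mul]
    push_cast
    linarith

-- `|z^t - z^s| ≤ (t - s)|z - 1|` on the unit circle, and `t₁ - s₁` is the time the cat takes to
-- return to 0 from `n`.
open Classical in
theorem integral_norm_pow_sub_pow_le (hp : 0 < p) (hp' : p < 1 / 2)
    (hX : IsMarkovChain μ (catMouse (reflectedWalk p)) (0, n) X) {z : ℂ} (hz : ‖z‖ = 1) :
    ∫ ω, ‖z ^ (t₁ (fun k => X k ω)).toNat - z ^ (s₁ (fun k => X k ω)).toNat‖ ∂μ ≤
      ‖z - 1‖ * (n / (1 - 2 * p)) := by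
  have hms := measurable_s₁ hX.measurable
  have hmt := measurable_t₁ hX.measurable
  have hi : Integrable (fun ω =>
      ‖z ^ (t₁ (fun k => X k ω)).toNat - z ^ (s₁ (fun k => X k ω)).toNat‖) μ :=
    integrable_of_discrete (hms.prodMk hmt) (fun i : ℕ × ℕ => ‖z ^ i.2 - z ^ i.1‖) (C := 2)
      fun i => by
        rw [norm_norm]
        refine (norm_sub_le _ _).trans ?_
        simp [hz]; norm_num
  calc _ ≤ ∫ _, ‖z - 1‖ * (n / (1 - 2 * p)) ∂μ := by
        refine integral_le_of_fiber hms hi (integrable_const _) fun b => ?_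
        have hset : MeasurableSet ((fun ω => (s₁ (fun k => X k ω)).toNat) ⁻¹' {b}) :=
          hms (measurableSet_singleton b)
        let G : (ℕ → ℕ × ℕ) → ℝ := fun w => if s₁ w = b ∧ (w b).1 = n then 1 else 0
        have hG : DependsOn G (Set.Iic b) := fun w w' hw => by
          simp only [G, isTrajectoryStoppingTime_s₁ b hw, hw b (Set.mem_Iic.2 le_rfl)]
        obtain ⟨-, h2, h3⟩ := integral_returnTime_le hp' hX (c := n) hG
          (fun w => by simp only [G]; positivity) (fun w hw => by
            by_contra hc
            simp [G, hc] at hw)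
        have hGf : ∀ᵐ ω ∂μ, ω ∈ (fun ω => (s₁ (fun k => X k ω)).toNat) ⁻¹' {b} →
            s₁ (fun k => X k ω) = b ∧ (X b ω).1 = n := by
          filter_upwards [ae_s₁_lt_top hp hp' hX, ae_legal hX, hX.ae_init] with ω hω hl h0 hb
          obtain ⟨s, hs⟩ := ENat.ne_top_iff_exists.1 hω.ne
          have hb' : (s₁ (fun k => X k ω)).toNat = b := hb
          rw [← hs, ENat.toNat_natCast] at hb'
          subst hb'
          exact ⟨hs.symm, by rw [hl.eq_of_s₁ h0 hs.symm]⟩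
        have h4 : ∫ ω, G (fun k => X k ω) ∂μ =
            μ.real ((fun ω => (s₁ (fun k => X k ω)).toNat) ⁻¹' {b}) := by
          rw [← integral_indicator_one hset]
          refine integral_congr_ae (hGf.mono fun ω hω => ?_)
          by_cases hb : ω ∈ (fun ω => (s₁ (fun k => X k ω)).toNat) ⁻¹' {b}
          · simp only [Set.indicator_of_mem hb]
            simp [G, hω hb]
          · simp only [Set.indicator_of_notMem hb]
            refine if_neg fun h => hb ?_
            simp [h.1]
        rw [setIntegral_const, smul_eq_mul, ← integral_indicator hset]
        refine le_trans (integral_mono_ae (g := fun ω => ‖z - 1‖ * (G (fun k => X k ω) *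
          (((firstFrom (fun ℓ => (X ℓ ω).1 = 0) b).toNat : ℝ) - b)))
          (hi.indicator hset) (h2.const_mul _) ?_) ?_
        · filter_upwards [hGf, ae_t₁_lt_top hp hp' hX] with ω hω ht
          by_cases hb : ω ∈ (fun ω => (s₁ (fun k => X k ω)).toNat) ⁻¹' {b}
          · obtain ⟨hs, hc⟩ := hω hb
            simp only [Set.indicator_of_mem hb]
            have hst : t₁ (fun k => X k ω) = firstFrom (fun ℓ => (X ℓ ω).1 = 0) b := by
              rw [t₁, hs]
            rw [hst] at ht
            have hle := ENat.toNat_le_toNat (le_firstFrom (fun ℓ => (X ℓ ω).1 = 0) b) ht.ne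
            rw [ENat.toNat_natCast] at hle
            simp only [G, hs, hc, and_self, if_true, one_mul, hst, ENat.toNat_natCast]
            set t := (firstFrom (fun ℓ => (X ℓ ω).1 = 0) b).toNat
            have e : z ^ t - z ^ b = z ^ b * (z ^ (t - b) - 1) := by
              rw [mul_sub, ← pow_add, Nat.add_sub_cancel' hle, mul_one]
            rw [e, norm_mul, norm_pow, hz, one_pow, one_mul]
            refine (norm_pow_sub_one_le hz _).trans (le_of_eq ?_)
            rw [Nat.cast_sub hle, mul_comm]
          · simp only [Set.indicator_of_notMem hb]
            have : G (fun k => X k ω) = 0 := by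
              refine if_neg fun h => hb ?_
              simp [h.1]
            rw [this]
            simp
        · rw [integral_const_mul, ← h4, mul_left_comm]
          refine mul_le_mul_of_nonneg_left (h3.trans (le_of_eq ?_)) (norm_nonneg _)
          ring
    _ = _ := by simp

-- The state at `s₁` is the constant `(n, n)`, so the strong Markov property at `s₁` yields a
-- product.
open Classical in
theorem integral_after_s₁ (hp : 0 < p) (hp' : p < 1 / 2)
    (hX : IsMarkovChain μ (catMouse (reflectedWalk p)) (0, n) X) {z : ℂ} (hz : ‖z‖ = 1)
    (f : ℕ × ℕ → ℂ) (hf : ∀ x, ‖f x‖ ≤ 1) (K : ℕ) :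
    ∫ ω, z ^ (s₁ (fun k => X k ω)).toNat * f (X ((s₁ (fun k => X k ω)).toNat + K) ω) ∂μ =
      (∫ ω, z ^ (s₁ (fun k => X k ω)).toNat ∂μ) * ((stepMean p upN dnN)^[K] f) (n, n) := by
  have hms := measurable_s₁ hX.measurable
  have hme := measurable_eval hX.measurable (hms.add_const K)
  rw [← integral_mul_const]
  refine integral_eq_of_fiber hms ?_ ?_ fun b => ?_
  · exact integrable_of_discrete (hms.prodMk hme) (fun i : ℕ × (ℕ × ℕ) => z ^ i.1 * f i.2)
      (C := 1) fun i => by simpa [hz] using hf _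
  · exact (integrable_of_discrete hms (fun i => z ^ i) (C := 1) fun i => by simp [hz]).mul_const _
  have hset : MeasurableSet ((fun ω => (s₁ (fun k => X k ω)).toNat) ⁻¹' {b}) :=
    hms (measurableSet_singleton b)
  let G : (ℕ → ℕ × ℕ) → ℂ := fun w => if s₁ w = b ∧ w b = (n, n) then z ^ b else 0
  have hG : DependsOn G (Set.Iic b) := fun w w' hw => by
    simp only [G, isTrajectoryStoppingTime_s₁ b hw, hw b (Set.mem_Iic.2 le_rfl)]
  have hGf : ∀ᵐ ω ∂μ, (ω ∈ (fun ω => (s₁ (fun k => X k ω)).toNat) ⁻¹' {b} ↔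
      s₁ (fun k => X k ω) = b ∧ X b ω = (n, n)) := by
    filter_upwards [ae_s₁_lt_top hp hp' hX, ae_legal hX, hX.ae_init] with ω hω hl h0
    constructor
    · intro hb
      obtain ⟨s, hs⟩ := ENat.ne_top_iff_exists.1 hω.ne
      have hb' : (s₁ (fun k => X k ω)).toNat = b := hb
      rw [← hs, ENat.toNat_natCast] at hb'
      subst hb'
      exact ⟨hs.symm, by rw [hl.eq_of_s₁ h0 hs.symm]⟩
    · rintro ⟨h, -⟩
      simp [h]
  have key := hX.integral_iterate (sum_reflected p) (T := stepMean p upN dnN)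
    (stepMean_reflected p) hG K f
  rw [← integral_indicator hset, ← integral_indicator hset]
  refine (integral_congr_ae ?_).trans (key.trans (integral_congr_ae ?_))
  · filter_upwards [hGf] with ω hω
    by_cases h : s₁ (fun k => X k ω) = b ∧ X b ω = (n, n)
    · rw [Set.indicator_of_mem (hω.2 h)]
      simp [G, h]
    · rw [Set.indicator_of_notMem fun h' => h (hω.1 h')]
      simp [G, h]
  · filter_upwards [hGf] with ω hω
    by_cases h : s₁ (fun k => X k ω) = b ∧ X b ω = (n, n)
    · rw [Set.indicator_of_mem (hω.2 h)]
      simp [G, h]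
    · rw [Set.indicator_of_notMem fun h' => h (hω.1 h')]
      simp [G, h]

/-- Three replacements: `t₁` by `s₁` in the exponent, `M_{t₁}` by `M_{s₁ + n}`, and `M'_n` by
`M'_∞`. The bound is uniform over `F` of norm at most one, so `F` may vary with `n`. -/
theorem norm_integral_t₁_sub_le (hp : 0 < p) (hp' : p < 1 / 2)
    (hX : IsMarkovChain μ (catMouse (reflectedWalk p)) (0, n) X)
    {γ : ℝ} (hγ : 0 < γ) (hγ1 : γ < 1)
    (hmeet : ∀ k, μ.real {ω | MeetsAfter (fun k => X k ω) k} ≤ γ ^ k)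
    {Ω' : Type*} [MeasurableSpace Ω'] {ν : Measure Ω'} [IsProbabilityMeasure ν]
    {X' : ℕ → Ω' → ℤ × ℤ} (hX' : IsMarkovChain ν (catMouse (freeWalk p)) (0, 0) X')
    (hmeet' : ∀ K, ν.real {ω | (X' K ω).1 = (X' K ω).2} ≤ γ ^ K) {M : Ω' → ℤ}
    (hM : ∀ᵐ ω ∂ν, Tendsto (fun k => (X' k ω).2) atTop (𝓝 (M ω)))
    {z : ℂ} (hz : ‖z‖ = 1) (F : ℤ → ℂ) (hF : ∀ m, ‖F m‖ ≤ 1) :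
    ‖∫ ω, F (((X (t₁ (fun k => X k ω)).toNat ω).2 : ℤ) - n) *
        z ^ (t₁ (fun k => X k ω)).toNat ∂μ -
      (∫ ω, z ^ (s₁ (fun k => X k ω)).toNat ∂μ) * ∫ ω, F (M ω) ∂ν‖ ≤
      ‖z - 1‖ * (n / (1 - 2 * p)) + 4 * (γ ^ n / (1 - γ)) := by
  have hγ' : 0 < 1 - γ := by linarith
  have hms := measurable_s₁ hX.measurable
  have hmt := measurable_t₁ hX.measurable
  have hmet := measurable_eval hX.measurable hmt
  have hmes := measurable_eval hX.measurable (hms.add_const n)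
  let Y : Ω → ℤ := fun ω => ((X (t₁ (fun k => X k ω)).toNat ω).2 : ℤ) - n
  let Y' : Ω → ℤ := fun ω => ((X ((s₁ (fun k => X k ω)).toNat + n) ω).2 : ℤ) - n
  have iA : Integrable (fun ω => F (Y ω) * z ^ (t₁ (fun k => X k ω)).toNat) μ :=
    integrable_of_discrete (hmt.prodMk hmet)
      (fun i : ℕ × (ℕ × ℕ) => F ((i.2.2 : ℤ) - n) * z ^ i.1) (C := 1)
      fun i => by simpa [hz] using hF _
  have iB : Integrable (fun ω => F (Y ω) * z ^ (s₁ (fun k => X k ω)).toNat) μ :=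
    integrable_of_discrete (hms.prodMk hmet)
      (fun i : ℕ × (ℕ × ℕ) => F ((i.2.2 : ℤ) - n) * z ^ i.1) (C := 1)
      fun i => by simpa [hz] using hF _
  have iC : Integrable (fun ω => F (Y' ω) * z ^ (s₁ (fun k => X k ω)).toNat) μ :=
    integrable_of_discrete (hms.prodMk hmes)
      (fun i : ℕ × (ℕ × ℕ) => F ((i.2.2 : ℤ) - n) * z ^ i.1) (C := 1)
      fun i => by simpa [hz] using hF _
  have h1 : ‖∫ ω, F (Y ω) * z ^ (t₁ (fun k => X k ω)).toNat ∂μ -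
      ∫ ω, F (Y ω) * z ^ (s₁ (fun k => X k ω)).toNat ∂μ‖ ≤ ‖z - 1‖ * (n / (1 - 2 * p)) := by
    rw [← integral_sub iA iB]
    refine (norm_integral_le_integral_norm _).trans
      (le_trans (integral_mono (iA.sub iB).norm ?_ fun ω => ?_)
        (integral_norm_pow_sub_pow_le hp hp' hX hz))
    · exact integrable_of_discrete (hms.prodMk hmt) (fun i : ℕ × ℕ => ‖z ^ i.2 - z ^ i.1‖)
        (C := 2) fun i => by
          rw [norm_norm]
          refine (norm_sub_le _ _).trans ?_
          simp [hz]; norm_num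
    · simp only [← mul_sub, norm_mul]
      exact mul_le_of_le_one_left (norm_nonneg _) (hF _)
  have h2 : ‖∫ ω, F (Y ω) * z ^ (s₁ (fun k => X k ω)).toNat ∂μ -
      ∫ ω, F (Y' ω) * z ^ (s₁ (fun k => X k ω)).toNat ∂μ‖ ≤ 2 * (γ ^ n / (1 - γ)) := by
    refine norm_integral_sub_le_of_ae_eq_off iB iC (fun ω => by simpa [hz] using hF _)
      (fun ω => by simpa [hz] using hF _) ?_ (by positivity) (measure_exists_ge_le hγ hγ1 hmeet n)
    filter_upwards [ae_s₁_lt_top hp hp' hX, ae_t₁_lt_top hp hp' hX, ae_legal hX, hX.ae_init]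
      with ω hs ht hl h0 hN
    obtain ⟨s, hs⟩ := ENat.ne_top_iff_exists.1 hs.ne
    obtain ⟨t, ht⟩ := ENat.ne_top_iff_exists.1 ht.ne
    have := hl.mouse_t₁_eq h0 hs.symm ht.symm fun k hk hm => hN ⟨k, hk, hm⟩
    simp only [Y, Y', ← hs, ← ht, ENat.toNat_natCast]
    rw [this]
  have h3 : ∫ ω, F (Y' ω) * z ^ (s₁ (fun k => X k ω)).toNat ∂μ =
      (∫ ω, z ^ (s₁ (fun k => X k ω)).toNat ∂μ) * ∫ ω, F (X' n ω).2 ∂ν := by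
    have e1 := integral_after_s₁ hp hp' hX hz (fun x => F ((x.2 : ℤ) - n)) (fun x => hF _) n
    have e2 := iterate_stepMean_shift (p := p) n (fun x : ℤ × ℤ => F x.2) n n n le_rfl le_rfl
    have e3 := integral_free_eq_iterate hX' (fun x => F x.2) n
    rw [sub_self] at e2
    rw [e3, ← e2, ← e1]
    simp only [Y', mul_comm]
  have h4 : ‖(∫ ω, z ^ (s₁ (fun k => X k ω)).toNat ∂μ) * ∫ ω, F (X' n ω).2 ∂ν -
      (∫ ω, z ^ (s₁ (fun k => X k ω)).toNat ∂μ) * ∫ ω, F (M ω) ∂ν‖ ≤ 2 * (γ ^ n / (1 - γ)) := by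
    rw [← mul_sub, norm_mul]
    exact (mul_le_of_le_one_left (norm_nonneg _) (norm_integral_pow_s₁_le z hz)).trans
      (norm_integral_mouse_sub_le hX' hγ hγ1 hmeet' hM F hF n)
  rw [← h3] at h4
  calc _ ≤ _ := (norm_sub_le_norm_sub_add_norm_sub _
        (∫ ω, F (Y ω) * z ^ (s₁ (fun k => X k ω)).toNat ∂μ) _).trans
          (add_le_add h1 ((norm_sub_le_norm_sub_add_norm_sub _
            (∫ ω, F (Y' ω) * z ^ (s₁ (fun k => X k ω)).toNat ∂μ) _).trans (add_le_add h2 h4)))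
    _ = _ := by ring

end Comparison

/-! ### The exponential law -/

section Exponential

theorem integral_exp_expMeasure {r : ℝ} (hr : 0 < r) (a : ℝ) :
    ∫ x, Complex.exp (Complex.I * a * x) ∂(expMeasure r) = (1 - Complex.I * a * (r⁻¹ : ℝ))⁻¹ := by
  have h0 : (expMeasure r) = volume.withDensity (fun x => exponentialPDF r x) := rfl
  have hlt : ∀ᵐ x ∂(volume : Measure ℝ), exponentialPDF r x < ⊤ :=
    ae_of_all _ fun x => ENNReal.ofReal_lt_top
  have hm : Measurable (fun x => exponentialPDF r x) :=
    (measurable_exponentialPDFReal r).ennreal_ofReal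
  rw [h0, integral_withDensity_eq_integral_toReal_smul hm hlt]
  have h1 : (fun x : ℝ => (exponentialPDF r x).toReal • Complex.exp (Complex.I * a * x)) =
      (Set.Ici 0).indicator (fun x : ℝ => r * Complex.exp ((Complex.I * a - r) * x)) := by
    funext x
    rw [exponentialPDF_eq]
    by_cases hx : 0 ≤ x
    · rw [Set.indicator_of_mem (Set.mem_Ici.2 hx), if_pos hx,
        ENNReal.toReal_ofReal (by positivity), Complex.real_smul]
      push_cast
      rw [mul_assoc, ← Complex.exp_add]
      congr 2
      ring
    · rw [Set.indicator_of_notMem (by simpa using hx), if_neg hx]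
      simp
  rw [h1, integral_indicator measurableSet_Ici, integral_Ici_eq_integral_Ioi, integral_const_mul,
    integral_exp_mul_complex_Ioi (by simpa using hr)]
  have hrc : (r : ℂ) ≠ 0 := by exact_mod_cast hr.ne'
  have h2 : Complex.I * a - r ≠ 0 := fun h => by
    have := congrArg Complex.re h
    simp at this
    exact hr.ne' this
  have h3 : (1 - Complex.I * a * (r⁻¹ : ℝ) : ℂ) = -(Complex.I * a - r) / r := by
    push_cast
    field_simp
    ring
  rw [h3]
  simp only [Complex.ofReal_zero, mul_zero, Complex.exp_zero]
  field_simp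

theorem expMeasure_singleton (r x : ℝ) : expMeasure r {x} = 0 :=
  withDensity_absolutelyContinuous _ _ (by simp : (volume : Measure ℝ) {x} = 0)

theorem expMeasure_Iio (r : ℝ) : expMeasure r (Set.Iio 0) = 0 := by
  have h0 : (expMeasure r) = volume.withDensity (fun x => exponentialPDF r x) := rfl
  rw [h0, withDensity_apply _ measurableSet_Iio]
  exact lintegral_exponentialPDF_of_nonpos le_rfl

end Exponential

/-! ### The limiting variables -/

section JointLaw

variable {Ω : Type*} [MeasurableSpace Ω] {ν : Measure Ω} [IsProbabilityMeasure ν]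
  {M : Ω → ℤ} {E₁ E₂ : Ω → ℝ} {r : ℝ}

theorem map_location_exponentials (hM : AEMeasurable M ν) (hE₁ : HasLaw E₁ (expMeasure r) ν)
    (hE₂ : HasLaw E₂ (expMeasure r) ν) (hE : IndepFun E₁ E₂ ν)
    (hME : IndepFun M (fun ω => (E₁ ω, E₂ ω)) ν) :
    ν.map (fun ω => (M ω, (E₁ ω, E₂ ω))) =
      (ν.map M).prod ((expMeasure r).prod (expMeasure r)) := by
  rw [hME.map_prod_eq_prod_map_map hM (hE₁.aemeasurable.prodMk hE₂.aemeasurable),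
    hE.map_prod_eq_prod_map_map hE₁.aemeasurable hE₂.aemeasurable, hE₁.map_eq, hE₂.map_eq]

theorem integral_location_exponentials (hr : 0 < r) (hM : AEMeasurable M ν)
    (hE₁ : HasLaw E₁ (expMeasure r) ν)
    (hE₂ : HasLaw E₂ (expMeasure r) ν) (hE : IndepFun E₁ E₂ ν)
    (hME : IndepFun M (fun ω => (E₁ ω, E₂ ω)) ν) (ψ : ℤ → ℂ) (hψ : ∀ m, ‖ψ m‖ ≤ 1) (a : ℝ)
    (b : ℤ → ℝ) :
    ∫ ω, ψ (M ω) * Complex.exp (Complex.I * a * E₁ ω) *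
        Complex.exp (Complex.I * b (M ω) * E₂ ω) ∂ν =
      (1 - Complex.I * a * (r⁻¹ : ℝ))⁻¹ *
        ∫ ω, ψ (M ω) * (1 - Complex.I * b (M ω) * (r⁻¹ : ℝ))⁻¹ ∂ν := by
  have := isProbabilityMeasure_expMeasure hr
  have hPM : IsProbabilityMeasure (ν.map M) := Measure.isProbabilityMeasure_map hM
  let f : ℤ × (ℝ × ℝ) → ℂ := fun q => ψ q.1 * (Complex.exp (Complex.I * a * q.2.1) *
    Complex.exp (Complex.I * b q.1 * q.2.2))
  have hψm : Measurable ψ := Measurable.of_discrete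
  have hbm : Measurable b := Measurable.of_discrete
  have hf : Measurable f := by fun_prop
  have hnorm : ∀ x y : ℝ, ‖Complex.exp (Complex.I * x * y)‖ = 1 := fun x y => by
    have : Complex.I * x * y = ((x * y : ℝ) : ℂ) * Complex.I := by push_cast; ring
    rw [this, Complex.norm_exp_ofReal_mul_I]
  have hfb : ∀ q, ‖f q‖ ≤ 1 := fun q => by
    simp only [f, norm_mul, hnorm, mul_one]
    exact hψ _
  have e1 : ∫ ω, ψ (M ω) * Complex.exp (Complex.I * a * E₁ ω) *
        Complex.exp (Complex.I * b (M ω) * E₂ ω) ∂ν =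
      ∫ q, f q ∂(ν.map (fun ω => (M ω, (E₁ ω, E₂ ω)))) := by
    rw [integral_map (hM.prodMk (hE₁.aemeasurable.prodMk hE₂.aemeasurable))
      hf.aestronglyMeasurable]
    simp only [f, mul_assoc]
  rw [e1, map_location_exponentials hM hE₁ hE₂ hE hME,
    integral_prod _ (Integrable.of_bound hf.aestronglyMeasurable 1 (ae_of_all _ hfb))]
  have e2 : ∀ m : ℤ, ∫ q : ℝ × ℝ, f (m, q) ∂((expMeasure r).prod (expMeasure r)) =
      (1 - Complex.I * a * (r⁻¹ : ℝ))⁻¹ * (ψ m * (1 - Complex.I * b m * (r⁻¹ : ℝ))⁻¹) := by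
    intro m
    simp only [f]
    rw [integral_const_mul, integral_prod_mul (fun x : ℝ => Complex.exp (Complex.I * a * x))
      (fun y : ℝ => Complex.exp (Complex.I * b m * y)), integral_exp_expMeasure hr,
      integral_exp_expMeasure hr]
    ring
  simp_rw [e2]
  rw [integral_const_mul, integral_map hM Measurable.of_discrete.aestronglyMeasurable]

/-- Given `M` and `E₁`, equality would prescribe a single value for `E₂`, whose law has no atoms. -/
theorem ae_limit_ne (hr : 0 < r) (hM : AEMeasurable M ν)
    (hE₁ : HasLaw E₁ (expMeasure r) ν)
    (hE₂ : HasLaw E₂ (expMeasure r) ν) (hE : IndepFun E₁ E₂ ν)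
    (hME : IndepFun M (fun ω => (E₁ ω, E₂ ω)) ν) (g : ℤ → ℝ) (hg : ∀ m, g m ≠ 0) (T : ℝ) :
    ∀ᵐ ω ∂ν, E₁ ω + g (M ω) * E₂ ω ≠ T := by
  have := isProbabilityMeasure_expMeasure hr
  have hPM : IsProbabilityMeasure (ν.map M) := Measure.isProbabilityMeasure_map hM
  have hgm : Measurable g := Measurable.of_discrete
  have hF : Measurable (fun q : ℤ × (ℝ × ℝ) => q.2.1 + g q.1 * q.2.2) := by fun_prop
  have hA : MeasurableSet {q : ℤ × (ℝ × ℝ) | q.2.1 + g q.1 * q.2.2 = T} :=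
    hF (measurableSet_singleton T)
  have hmap := map_location_exponentials hM hE₁ hE₂ hE hME
  have h0 : (ν.map (fun ω => (M ω, (E₁ ω, E₂ ω))))
      {q : ℤ × (ℝ × ℝ) | q.2.1 + g q.1 * q.2.2 = T} = 0 := by
    rw [hmap, Measure.measure_prod_null hA]
    refine ae_of_all _ fun m => ?_
    have hAm : MeasurableSet (Prod.mk m ⁻¹' {q : ℤ × (ℝ × ℝ) | q.2.1 + g q.1 * q.2.2 = T}) :=
      measurable_prodMk_left hA
    simp only [Pi.zero_apply]
    rw [Measure.measure_prod_null hAm]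
    refine ae_of_all _ fun x => measure_mono_null ?_ (expMeasure_singleton r ((T - x) / g m))
    intro y hy
    have hy' : x + g m * y = T := hy
    rw [Set.mem_singleton_iff, eq_div_iff (hg m), ← hy']
    ring
  rw [Measure.map_apply_of_aemeasurable
    (hM.prodMk (hE₁.aemeasurable.prodMk hE₂.aemeasurable)) hA] at h0
  exact measure_eq_zero_iff_ae_notMem.1 h0

theorem ae_nonneg_of_hasLaw_expMeasure {E : Ω → ℝ} (hE : HasLaw E (expMeasure r) ν) :
    ∀ᵐ ω ∂ν, 0 ≤ E ω := by
  have h := expMeasure_Iio r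
  rw [← hE.map_eq, Measure.map_apply_of_aemeasurable hE.aemeasurable measurableSet_Iio] at h
  filter_upwards [measure_eq_zero_iff_ae_notMem.1 h] with ω hω
  simpa using hω

end JointLaw

/-! ### Convergence of the joint transform -/

section Limit

variable {p : ℝ}

theorem norm_exp_I_mul (x y : ℝ) : ‖Complex.exp (Complex.I * x * y)‖ = 1 := by
  have : Complex.I * x * y = ((x * y : ℝ) : ℂ) * Complex.I := by push_cast; ring
  rw [this, Complex.norm_exp_ofReal_mul_I]

theorem tendsto_rho_pow (hp : 0 < p) (hp' : p < 1 / 2) :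
    Tendsto (fun n : ℕ => rho p ^ n) atTop (𝓝 0) :=
  tendsto_pow_atTop_nhds_zero_of_lt_one (rho_pos hp hp').le (rho_lt_one hp')

theorem tendsto_hitPoly_exp (hp : 0 < p) (hp' : p < 1 / 2) (θ : ℝ) :
    Tendsto (fun n : ℕ => hitPoly p (Complex.exp (Complex.I * θ * (rho p ^ n : ℝ)))⁻¹ n) atTop
      (𝓝 (1 - Complex.I * θ * ((1 + rho p) / (1 - rho p) ^ 2 : ℝ))) := by
  have h := tendsto_hitPoly hp hp'
    (ζ := fun n : ℕ => (Complex.exp (Complex.I * θ * (rho p ^ n : ℝ)))⁻¹)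
    (α := -(Complex.I * θ)) (by
      refine (tendsto_exp_sub_one_div (tendsto_rho_pow hp hp')
        (fun n => (pow_pos (rho_pos hp hp') n).ne') (-(Complex.I * θ))).congr fun n => ?_
      rw [← Complex.exp_neg, neg_mul]
      push_cast
      rfl)
  rw [neg_mul, ← sub_eq_add_neg] at h
  exact h

/-- At height `n + j` the natural scale is `ρ^{n+j}`; writing `ρ^n = ρ^{-j} ρ^{n+j}` replaces `θ` by
`θ ρ^{-j}`. This produces the factor `ρ^{-M'_∞}` in front of `E₂`. -/
theorem tendsto_hitPoly_exp_shift (hp : 0 < p) (hp' : p < 1 / 2) (θ : ℝ) (j : ℤ) :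
    Tendsto (fun n : ℕ => hitPoly p (Complex.exp (Complex.I * θ * (rho p ^ n : ℝ)))⁻¹
        ((n : ℤ) + j).toNat) atTop
      (𝓝 (1 - Complex.I * (θ * rho p ^ (-j) : ℝ) * ((1 + rho p) / (1 - rho p) ^ 2 : ℝ))) := by
  have hρ := (rho_pos hp hp').ne'
  have h1 : Tendsto (fun n : ℕ => ((n : ℤ) + j).toNat) atTop atTop := by
    refine tendsto_atTop.2 fun b => ?_
    filter_upwards [eventually_ge_atTop (b + j.natAbs)] with n hn
    omega
  refine ((tendsto_hitPoly_exp hp hp' (θ * rho p ^ (-j))).comp h1).congr' ?_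
  filter_upwards [eventually_ge_atTop j.natAbs] with n hn
  have h2 : rho p ^ (-j) * rho p ^ (((n : ℤ) + j).toNat) = rho p ^ n := by
    rw [← zpow_natCast (rho p) (((n : ℤ) + j).toNat), ← zpow_add₀ hρ, ← zpow_natCast]
    congr 1
    omega
  simp only [Function.comp_apply]
  congr 3
  rw [← h2]
  push_cast
  ring

theorem one_sub_I_mul_ne_zero (x y : ℝ) : (1 - Complex.I * x * y : ℂ) ≠ 0 := fun h => by
  have := congrArg Complex.re h
  simp at this

/-- Integrating out the second cycle leaves a bounded functional of the displacement of the mouse,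
depending on `n`. The first cycle then factorizes up to a vanishing error, and dominated convergence
handles the functional. -/
theorem tendsto_joint_transform (hp : 0 < p) (hp' : p < 1 / 2)
    {Ω : ℕ → Type*} [∀ n, MeasurableSpace (Ω n)]
    {μ : ∀ n, Measure (Ω n)} [∀ n, IsProbabilityMeasure (μ n)]
    {X : ∀ n, ℕ → Ω n → ℕ × ℕ}
    (hX : ∀ n, IsMarkovChain (μ n) (catMouse (reflectedWalk p)) (0, n) (X n))
    {Ω' : Type*} [MeasurableSpace Ω'] {ν : Measure Ω'} [IsProbabilityMeasure ν]
    {X' : ℕ → Ω' → ℤ × ℤ} (hX' : IsMarkovChain ν (catMouse (freeWalk p)) (0, 0) X')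
    {γ : ℝ} (hγ : 0 < γ) (hγ1 : γ < 1)
    (hmeet : ∀ n k, (μ n).real {ω | MeetsAfter (fun k => X n k ω) k} ≤ γ ^ k)
    (hmeet' : ∀ K, ν.real {ω | (X' K ω).1 = (X' K ω).2} ≤ γ ^ K) {M : Ω' → ℤ}
    (hM : ∀ᵐ ω ∂ν, Tendsto (fun k => (X' k ω).2) atTop (𝓝 (M ω)))
    (ψ : ℤ → ℂ) (hψ : ∀ m, ‖ψ m‖ ≤ 1) (θ θ' : ℝ) :
    Tendsto (fun n => ∫ ω, ψ (((X n (t₁ (fun k => X n k ω)).toNat ω).2 : ℤ) - n) *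
        Complex.exp (Complex.I * θ * (rho p ^ n : ℝ)) ^ (t₁ (fun k => X n k ω)).toNat *
        Complex.exp (Complex.I * θ' * (rho p ^ n : ℝ)) ^
          ((s₂ (fun k => X n k ω)).toNat - (t₁ (fun k => X n k ω)).toNat) ∂(μ n)) atTop
      (𝓝 ((1 - Complex.I * θ * ((1 + rho p) / (1 - rho p) ^ 2 : ℝ))⁻¹ *
        ∫ ω, ψ (M ω) * (1 - Complex.I * (θ' * rho p ^ (-M ω) : ℝ) *
          ((1 + rho p) / (1 - rho p) ^ 2 : ℝ))⁻¹ ∂ν)) := by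
  set z : ℕ → ℂ := fun n => Complex.exp (Complex.I * θ * (rho p ^ n : ℝ))
  set z' : ℕ → ℂ := fun n => Complex.exp (Complex.I * θ' * (rho p ^ n : ℝ))
  have hz : ∀ n, ‖z n‖ = 1 := fun n => norm_exp_I_mul _ _
  have hz' : ∀ n, ‖z' n‖ = 1 := fun n => norm_exp_I_mul _ _
  -- The parameter comes from index `n` but the chain from height `m`: the mouse may restart from
  -- any height, so bounds are needed at all `m`.
  have hu1 : ∀ n m, ‖(hitPoly p (z' n)⁻¹ m)⁻¹‖ ≤ 1 := fun n m =>
    norm_inv_hitPoly_le hp hp' (hX m) (hz' n)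
  let F : ℕ → ℤ → ℂ := fun n j => ψ j * (hitPoly p (z' n)⁻¹ ((n : ℤ) + j).toNat)⁻¹
  have hF : ∀ n j, ‖F n j‖ ≤ 1 := fun n j => by
    rw [norm_mul]
    exact mul_le_one₀ (hψ _) (norm_nonneg _) (hu1 _ _)
  have hMm := aemeasurable_asymptoticLocation hX' hM
  have e1 : ∀ n, ∫ ω, ψ (((X n (t₁ (fun k => X n k ω)).toNat ω).2 : ℤ) - n) *
        z n ^ (t₁ (fun k => X n k ω)).toNat *
        z' n ^ ((s₂ (fun k => X n k ω)).toNat - (t₁ (fun k => X n k ω)).toNat) ∂(μ n) =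
      ∫ ω, F n (((X n (t₁ (fun k => X n k ω)).toNat ω).2 : ℤ) - n) *
        z n ^ (t₁ (fun k => X n k ω)).toNat ∂(μ n) := by
    intro n
    have := integral_second_meeting hp hp' (hX n) (hz n) (hz' n)
      (fun m => hitPoly_ne_zero hp hp' (hX m) (hz' n)) (hu1 n) (fun m => ψ ((m : ℤ) - n))
      (fun m => hψ _)
    rw [this]
    simp [F]
  have h1 : Tendsto (fun n => (hitPoly p (z n)⁻¹ n)⁻¹) atTop
      (𝓝 (1 - Complex.I * θ * ((1 + rho p) / (1 - rho p) ^ 2 : ℝ))⁻¹) :=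
    (tendsto_hitPoly_exp hp hp' θ).inv₀ (one_sub_I_mul_ne_zero _ _)
  have h2 : Tendsto (fun n => ∫ ω, F n (M ω) ∂ν) atTop
      (𝓝 (∫ ω, ψ (M ω) * (1 - Complex.I * (θ' * rho p ^ (-M ω) : ℝ) *
          ((1 + rho p) / (1 - rho p) ^ 2 : ℝ))⁻¹ ∂ν)) := by
    refine tendsto_integral_of_dominated_convergence (fun _ => 1) (fun n => ?_)
      (integrable_const _) (fun n => ae_of_all _ fun ω => hF _ _) (ae_of_all _ fun ω => ?_)
    · exact (StronglyMeasurable.of_discrete (f := F n)).aestronglyMeasurable.comp_aemeasurable hMm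
    · exact ((tendsto_hitPoly_exp_shift hp hp' θ' (M ω)).inv₀
        (one_sub_I_mul_ne_zero _ _)).const_mul _
  have herr : Tendsto (fun n : ℕ => ‖z n - 1‖ * (n / (1 - 2 * p)) + 4 * (γ ^ n / (1 - γ))) atTop
      (𝓝 0) := by
    have g1 := (tendsto_exp_sub_one_div (tendsto_rho_pow hp hp')
        (fun n => (pow_pos (rho_pos hp hp') n).ne') (Complex.I * θ)).norm
    have g2 := (tendsto_self_mul_const_pow_of_lt_one (rho_pos hp hp').le
      (rho_lt_one hp')).div_const (1 - 2 * p)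
    have g3 := ((tendsto_pow_atTop_nhds_zero_of_lt_one hγ.le hγ1).div_const (1 - γ)).const_mul 4
    have g4 := (g1.mul g2).add g3
    simp only [zero_div, mul_zero, add_zero] at g4
    refine g4.congr fun n => ?_
    have hn : (0 : ℝ) < rho p ^ n := pow_pos (rho_pos hp hp') n
    rw [norm_div, Complex.norm_of_nonneg hn.le]
    simp only [z]
    field_simp
  have h3 := h1.mul h2
  rw [tendsto_iff_dist_tendsto_zero] at h3 ⊢
  have h5 := herr.add h3
  rw [add_zero] at h5
  refine squeeze_zero (fun _ => dist_nonneg) (fun n => ?_) h5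
  have h4 := norm_integral_t₁_sub_le hp hp' (hX n) hγ hγ1 (hmeet n) hX' hmeet' hM (hz n) (F n)
    (hF n)
  rw [eq_inv_of_mul_eq_one_left (integral_pow_s₁ hp hp' (hX n) (hz n)), ← dist_eq_norm] at h4
  exact (congrArg₂ dist (e1 n) rfl).trans_le
    ((dist_triangle _ _ _).trans (add_le_add_left h4 _))

end Limit

/-! ### Criteria for convergence in distribution -/

section Convergence

variable {Ω : ℕ → Type*} [∀ n, MeasurableSpace (Ω n)] {μ : ∀ n, Measure (Ω n)}
  [∀ n, IsProbabilityMeasure (μ n)] {Ω' : Type*} [MeasurableSpace Ω'] {ν : Measure Ω'}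
  [IsProbabilityMeasure ν]

theorem tendstoInDistribution_of_isOpen {E : Type*} [TopologicalSpace E] [MeasurableSpace E]
    [OpensMeasurableSpace E] {Y : ∀ n, Ω n → E} {Z : Ω' → E}
    (hY : ∀ n, AEMeasurable (Y n) (μ n)) (hZ : AEMeasurable Z ν)
    (h : ∀ G, IsOpen G → ν (Z ⁻¹' G) ≤ atTop.liminf fun n => μ n (Y n ⁻¹' G)) :
    TendstoInDistribution Y atTop Z μ ν := by
  refine ⟨hY, hZ, tendsto_of_forall_isOpen_le_liminf' fun G hG => ?_⟩
  simp only [ProbabilityMeasure.coe_mk]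
  rw [Measure.map_apply_of_aemeasurable hZ hG.measurableSet]
  refine (h G hG).trans (le_of_eq ?_)
  congr 1
  funext n
  rw [Measure.map_apply_of_aemeasurable (hY n) hG.measurableSet]

theorem le_liminf_of_tendstoInDistribution {E : Type*} [TopologicalSpace E] [MeasurableSpace E]
    [OpensMeasurableSpace E] [HasOuterApproxClosed E] {Y : ∀ n, Ω n → E} {Z : Ω' → E}
    (h : TendstoInDistribution Y atTop Z μ ν) {G : Set E} (hG : IsOpen G) :
    ν (Z ⁻¹' G) ≤ atTop.liminf fun n => μ n (Y n ⁻¹' G) := by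
  have h1 := ProbabilityMeasure.le_liminf_measure_open_of_tendsto h.tendsto hG
  simp only [ProbabilityMeasure.coe_mk] at h1
  rw [Measure.map_apply_of_aemeasurable h.aemeasurable_limit hG.measurableSet] at h1
  refine h1.trans (le_of_eq ?_)
  congr 1
  funext n
  rw [Measure.map_apply_of_aemeasurable (h.forall_aemeasurable n) hG.measurableSet]

/-- Open sets are preimages of open sets, so the portmanteau inequality pulls back. It serves to
embed `ℤ × ℝ` in the plane, where characteristic functions decide. -/
theorem tendstoInDistribution_of_isInducing {E F : Type*} [TopologicalSpace E] [MeasurableSpace E]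
    [OpensMeasurableSpace E] [TopologicalSpace F] [MeasurableSpace F] [OpensMeasurableSpace F]
    [HasOuterApproxClosed F] {g : E → F} (hg : IsInducing g) {Y : ∀ n, Ω n → E} {Z : Ω' → E}
    (hY : ∀ n, AEMeasurable (Y n) (μ n)) (hZ : AEMeasurable Z ν)
    (h : TendstoInDistribution (fun n ω => g (Y n ω)) atTop (fun ω => g (Z ω)) μ ν) :
    TendstoInDistribution Y atTop Z μ ν := by
  refine tendstoInDistribution_of_isOpen hY hZ fun G hG => ?_
  obtain ⟨V, hV, rfl⟩ := hg.isOpen_iff.1 hG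
  exact le_liminf_of_tendstoInDistribution h hV

theorem tendstoInDistribution_of_tendsto_integral_exp {E : Type*} [NormedAddCommGroup E]
    [InnerProductSpace ℝ E] [FiniteDimensional ℝ E] [MeasurableSpace E] [BorelSpace E]
    {Y : ∀ n, Ω n → E} {Z : Ω' → E} (hY : ∀ n, AEMeasurable (Y n) (μ n)) (hZ : AEMeasurable Z ν)
    (h : ∀ t : E, Tendsto
      (fun n => ∫ ω, Complex.exp ((inner ℝ (Y n ω) t : ℝ) * Complex.I) ∂(μ n)) atTop
      (𝓝 (∫ ω, Complex.exp ((inner ℝ (Z ω) t : ℝ) * Complex.I) ∂ν))) :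
    TendstoInDistribution Y atTop Z μ ν := by
  refine ⟨hY, hZ, ProbabilityMeasure.tendsto_iff_tendsto_charFun.2 fun t => ?_⟩
  have hm : Measurable fun x : E => Complex.exp ((inner ℝ x t : ℝ) * Complex.I) := by fun_prop
  simp only [ProbabilityMeasure.coe_mk, charFun_apply]
  rw [integral_map hZ hm.aestronglyMeasurable]
  refine (h t).congr fun n => ?_
  rw [integral_map (hY n) hm.aestronglyMeasurable]

end Convergence

/-! ### Limits of the return time and of the second meeting time -/

section TimesLimit

variable {p : ℝ} {Ω : ℕ → Type*} [∀ n, MeasurableSpace (Ω n)]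
  {μ : ∀ n, Measure (Ω n)} [∀ n, IsProbabilityMeasure (μ n)]
  {X : ∀ n, ℕ → Ω n → ℕ × ℕ}
  {Ω' : Type*} [MeasurableSpace Ω'] {ν : Measure Ω'} [IsProbabilityMeasure ν]
  {X' : ℕ → Ω' → ℤ × ℤ} {γ : ℝ} {M : Ω' → ℤ} {E₁ E₂ : Ω' → ℝ}

/-- The pair formed by the location of the mouse and the rescaled time at the first return of the
cat to the origin after the first meeting. -/
theorem tendstoInDistribution_t₁ (hp : 0 < p) (hp' : p < 1 / 2)
    (hX : ∀ n, IsMarkovChain (μ n) (catMouse (reflectedWalk p)) (0, n) (X n))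
    (hX' : IsMarkovChain ν (catMouse (freeWalk p)) (0, 0) X') (hγ : 0 < γ) (hγ1 : γ < 1)
    (hmeet : ∀ n k, (μ n).real {ω | MeetsAfter (fun k => X n k ω) k} ≤ γ ^ k)
    (hmeet' : ∀ K, ν.real {ω | (X' K ω).1 = (X' K ω).2} ≤ γ ^ K)
    (hM : ∀ᵐ ω ∂ν, Tendsto (fun k => (X' k ω).2) atTop (𝓝 (M ω)))
    (hE₁ : HasLaw E₁ (expMeasure (((1 + rho p) / (1 - rho p) ^ 2)⁻¹)) ν)
    (hE₂ : HasLaw E₂ (expMeasure (((1 + rho p) / (1 - rho p) ^ 2)⁻¹)) ν)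
    (hE : IndepFun E₁ E₂ ν) (hME : IndepFun M (fun ω => (E₁ ω, E₂ ω)) ν) :
    TendstoInDistribution
      (fun n ω =>
        ((((X n (t₁ (fun k => X n k ω)).toNat ω).2 : ℤ) - (n : ℤ),
          rho p ^ n * ((t₁ (fun k => X n k ω)).toNat : ℝ)) : ℤ × ℝ))
      atTop (fun ω => (M ω, E₁ ω)) μ ν := by
  have hc : 0 < ((1 + rho p) / (1 - rho p) ^ 2)⁻¹ := by
    have h0 := rho_pos hp hp'
    have h1 := rho_lt_one hp'
    have : 0 < 1 - rho p := by linarith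
    positivity
  have hMm : AEMeasurable M ν := aemeasurable_asymptoticLocation hX' hM
  let g : ℤ × ℝ → WithLp 2 (ℝ × ℝ) := fun q => WithLp.toLp 2 ((q.1 : ℝ), q.2)
  have hg : IsInducing g :=
    (WithLp.homeomorphProd 2 ℝ ℝ).symm.isInducing.comp
      (Int.isClosedEmbedding_coe_real.isInducing.prodMap IsInducing.id)
  have hgm : Measurable g := hg.continuous.measurable
  have hYm : ∀ n, Measurable (fun ω : Ω n =>
        ((((X n (t₁ (fun k => X n k ω)).toNat ω).2 : ℤ) - (n : ℤ),
          rho p ^ n * ((t₁ (fun k => X n k ω)).toNat : ℝ)) : ℤ × ℝ)) := fun n => by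
    have ht := measurable_t₁ (hX n).measurable
    have h1 : Measurable (fun ω => (X n (t₁ (fun k => X n k ω)).toNat ω)) :=
      measurable_eval (hX n).measurable ht
    have h2 : Measurable (fun q : ℕ × ℕ => (q.2 : ℤ) - (n : ℤ)) := Measurable.of_discrete
    have h3 : Measurable (fun q : ℕ => rho p ^ n * (q : ℝ)) := Measurable.of_discrete
    exact (h2.comp h1).prodMk (h3.comp ht)
  refine tendstoInDistribution_of_isInducing hg (fun n => (hYm n).aemeasurable)
    (hMm.prodMk hE₁.aemeasurable)
    (tendstoInDistribution_of_tendsto_integral_exp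
      (fun n => (hgm.comp (hYm n)).aemeasurable)
      (hgm.comp_aemeasurable (hMm.prodMk hE₁.aemeasurable)) fun t => ?_)
  set η : ℝ := t.fst with hη
  set θ : ℝ := t.snd with hθ
  have hexp : ∀ q : ℤ × ℝ, Complex.exp ((inner ℝ (g q) t : ℝ) * Complex.I) =
      Complex.exp (Complex.I * (q.1 : ℝ) * η) * Complex.exp (Complex.I * θ * q.2) := fun q => by
    rw [← Complex.exp_add]
    congr 1
    rw [WithLp.prod_inner_apply]
    simp only [g, inner]
    push_cast
    simp [hη, hθ]
    ring
  -- The second frequency 0 discards `s₂`, while `ψ` carries the character of the integer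
  -- coordinate.
  have h := tendsto_joint_transform hp hp' hX hX' hγ hγ1 hmeet hmeet' hM
    (fun m => Complex.exp (Complex.I * (m : ℝ) * η)) (fun m => (norm_exp_I_mul _ _).le) θ 0
  have hlim := integral_location_exponentials hc hMm hE₁ hE₂ hE hME
    (fun m => Complex.exp (Complex.I * (m : ℝ) * η)) (fun m => (norm_exp_I_mul _ _).le) θ
    (fun _ => 0)
  simp only [Complex.ofReal_zero, mul_zero, zero_mul, Complex.exp_zero, one_pow, mul_one,
    sub_zero, inv_one, inv_inv] at h hlim
  simp only [hexp, hlim]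
  refine h.congr fun n => integral_congr_ae (ae_of_all _ fun ω => ?_)
  simp only
  congr 1
  · rw [← Complex.exp_nat_mul]
    congr 1
    push_cast
    ring

/-- The rescaled second meeting time. -/
theorem tendstoInDistribution_s₂ (hp : 0 < p) (hp' : p < 1 / 2)
    (hX : ∀ n, IsMarkovChain (μ n) (catMouse (reflectedWalk p)) (0, n) (X n))
    (hX' : IsMarkovChain ν (catMouse (freeWalk p)) (0, 0) X') (hγ : 0 < γ) (hγ1 : γ < 1)
    (hmeet : ∀ n k, (μ n).real {ω | MeetsAfter (fun k => X n k ω) k} ≤ γ ^ k)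
    (hmeet' : ∀ K, ν.real {ω | (X' K ω).1 = (X' K ω).2} ≤ γ ^ K)
    (hM : ∀ᵐ ω ∂ν, Tendsto (fun k => (X' k ω).2) atTop (𝓝 (M ω)))
    (hE₁ : HasLaw E₁ (expMeasure (((1 + rho p) / (1 - rho p) ^ 2)⁻¹)) ν)
    (hE₂ : HasLaw E₂ (expMeasure (((1 + rho p) / (1 - rho p) ^ 2)⁻¹)) ν)
    (hE : IndepFun E₁ E₂ ν) (hME : IndepFun M (fun ω => (E₁ ω, E₂ ω)) ν) :
    TendstoInDistribution
      (fun n ω => rho p ^ n * ((s₂ (fun k => X n k ω)).toNat : ℝ))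
      atTop (fun ω => E₁ ω + rho p ^ (-(M ω)) * E₂ ω) μ ν := by
  have hc : 0 < ((1 + rho p) / (1 - rho p) ^ 2)⁻¹ := by
    have h0 := rho_pos hp hp'
    have h1 := rho_lt_one hp'
    have : 0 < 1 - rho p := by linarith
    positivity
  have hMm : AEMeasurable M ν := aemeasurable_asymptoticLocation hX' hM
  have hgm : Measurable (fun m : ℤ => rho p ^ (-m)) := Measurable.of_discrete
  have hYm : ∀ n, Measurable (fun ω : Ω n =>
      rho p ^ n * ((s₂ (fun k => X n k ω)).toNat : ℝ)) := fun n => by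
    have h3 : Measurable (fun q : ℕ => rho p ^ n * (q : ℝ)) := Measurable.of_discrete
    exact h3.comp (measurable_s₂ (hX n).measurable)
  refine tendstoInDistribution_of_tendsto_integral_exp (fun n => (hYm n).aemeasurable)
    (hE₁.aemeasurable.add ((hgm.comp_aemeasurable hMm).mul hE₂.aemeasurable)) fun θ => ?_
  -- Equal frequencies recombine `t₁` and `s₂ - t₁` into `s₂`.
  have h := tendsto_joint_transform hp hp' hX hX' hγ hγ1 hmeet hmeet' hM
    (fun _ => 1) (fun _ => by simp) θ θ
  have hlim := integral_location_exponentials hc hMm hE₁ hE₂ hE hME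
    (fun _ => 1) (fun _ => by simp) θ (fun m => θ * rho p ^ (-m))
  rw [inv_inv] at hlim
  simp only [one_mul] at h hlim
  rw [← hlim] at h
  have hin : ∀ x y : ℝ, inner ℝ x y = x * y := fun x y => by simp [mul_comm]
  have hR : ∫ ω, Complex.exp ((inner ℝ (E₁ ω + rho p ^ (-(M ω)) * E₂ ω) θ : ℝ) * Complex.I) ∂ν =
      ∫ ω, Complex.exp (Complex.I * θ * E₁ ω) *
        Complex.exp (Complex.I * ((θ * rho p ^ (-(M ω)) : ℝ) : ℂ) * E₂ ω) ∂ν := by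
    refine integral_congr_ae (ae_of_all _ fun ω => ?_)
    simp only
    rw [← Complex.exp_add]
    congr 1
    rw [hin]
    push_cast
    ring
  rw [hR]
  refine h.congr fun n => integral_congr_ae ?_
  filter_upwards [ae_s₂_lt_top hp hp' (hX n)] with ω hs
  have hle : (t₁ (fun k => X n k ω)).toNat ≤ (s₂ (fun k => X n k ω)).toNat :=
    ENat.toNat_le_toNat (le_firstFrom _ _) hs.ne
  rw [← pow_add, Nat.add_sub_cancel' hle, ← Complex.exp_nat_mul]
  congr 1
  rw [hin]
  push_cast
  ring

end TimesLimit

/-! ### Time changes between indicator paths -/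

section TimeChange

/-- For `z'` close to `z`, a time change of `I` with slopes close to `1` exchanges the processes
`t ↦ 1{t < z}` and `t ↦ 1{t < z'}`. -/
def HasTimeChanges (I : Set ℝ) (z : ℝ) : Prop :=
  ∀ ε : ℝ, 0 < ε → ∀ᶠ z' in 𝓝 z, ∃ φ : I ≃o I,
    (∀ s t : I, s < t → |Real.log (((φ t : ℝ) - φ s) / ((t : ℝ) - s))| ≤ ε) ∧
    ∀ t : I, (φ t : ℝ) < z ↔ (t : ℝ) < z'

theorem abs_log_le_of_abs_sub_one_le {x ε : ℝ} (h : |x - 1| ≤ 1 - Real.exp (-ε)) :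
    |Real.log x| ≤ ε := by
  have h1 := abs_le.1 h
  have h2 : Real.exp (-ε) ≤ x := by linarith [h1.1]
  have h3 : 0 < x := (Real.exp_pos _).trans_le h2
  -- The hypothesis gives `x ≤ 2 - exp (-ε)`, and `exp ε + exp (-ε) ≥ 2`.
  have h4 : x ≤ Real.exp ε := by
    linarith [h1.2, Real.add_one_le_exp ε, Real.add_one_le_exp (-ε)]
  exact abs_le.2 ⟨(Real.le_log_iff_exp_le h3).2 h2, (Real.log_le_iff_le_exp h3).2 h4⟩

/-- The dilation by `z/z'` has a constant slope that tends to 1. -/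
theorem hasTimeChanges_Ici {z : ℝ} (hz : 0 < z) : HasTimeChanges (Set.Ici 0) z := by
  intro ε hε
  have hδ : 0 < 1 - Real.exp (-ε) := by
    rw [sub_pos, Real.exp_lt_one_iff]
    linarith
  have hc : Tendsto (fun z' : ℝ => |z / z' - 1|) (𝓝 z) (𝓝 0) := by
    have : ContinuousAt (fun z' : ℝ => |z / z' - 1|) z :=
      ((continuousAt_const.div continuousAt_id hz.ne').sub continuousAt_const).abs
    have h := this.tendsto
    simpa [hz.ne'] using h
  filter_upwards [hc.eventually (gt_mem_nhds hδ), lt_mem_nhds hz] with z' h1 h2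
  have hpos : 0 < z / z' := div_pos hz h2
  let f : Set.Ici (0 : ℝ) → Set.Ici (0 : ℝ) := fun t => ⟨z / z' * t, mul_nonneg hpos.le t.2⟩
  have hf : StrictMono f := fun s t hst =>
    Subtype.mk_lt_mk.2 (mul_lt_mul_of_pos_left (Subtype.coe_lt_coe.2 hst) hpos)
  have hs : Function.Surjective f := fun t =>
    ⟨⟨t / (z / z'), div_nonneg t.2 hpos.le⟩, Subtype.ext (mul_div_cancel₀ _ hpos.ne')⟩
  refine ⟨hf.orderIsoOfSurjective f hs, fun s t hst => ?_, fun t => ?_⟩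
  · have hst' : (0 : ℝ) < (t : ℝ) - s := sub_pos.2 hst
    have : (((f t : ℝ) - f s) / ((t : ℝ) - s)) = z / z' := by
      rw [div_eq_iff hst'.ne']
      simp only [f]
      ring
    rw [StrictMono.coe_orderIsoOfSurjective, this]
    exact abs_log_le_of_abs_sub_one_le h1.le
  · rw [StrictMono.coe_orderIsoOfSurjective]
    change z / z' * (t : ℝ) < z ↔ _
    rw [div_mul_eq_mul_div, div_lt_iff₀ h2, mul_lt_mul_iff_right₀ hz]

/-- A time change must fix 0 and `T`. For `z < T` take the parabola `t + κ t (T - t)`, with `κ`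
chosen so that `z'` goes to `z`; its chords have slope `1 + κ (T - s - t)`, within `|κ| T` of 1. For
`z > T` both indicators are identically 1 and the identity serves. The case `z = T` fails: the value
at the fixed point `T` jumps when `z'` crosses `T`. -/
theorem hasTimeChanges_Icc {T z : ℝ} (hz : 0 < z) (hzT : z ≠ T) :
    HasTimeChanges (Set.Icc 0 T) z := by
  intro ε hε
  rcases hzT.lt_or_gt with hzT | hzT
  swap
  · filter_upwards [lt_mem_nhds hzT] with z' h1
    refine ⟨OrderIso.refl _, fun s t hst => ?_, fun t => ?_⟩
    · have hst' : (0 : ℝ) < (t : ℝ) - s := sub_pos.2 hst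
      simp [div_self hst'.ne', hε.le]
    · exact iff_of_true (t.2.2.trans_lt hzT) (t.2.2.trans_lt h1)
  have hδ : 0 < 1 - Real.exp (-ε) := by
    rw [sub_pos, Real.exp_lt_one_iff]
    linarith
  have hT : 0 < T := hz.trans hzT
  have hc : Tendsto (fun z' : ℝ => |(z - z') / (z' * (T - z'))| * T) (𝓝 z) (𝓝 0) := by
    have : ContinuousAt (fun z' : ℝ => |(z - z') / (z' * (T - z'))| * T) z :=
      ((((continuousAt_const.sub continuousAt_id).div
        (continuousAt_id.mul (continuousAt_const.sub continuousAt_id))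
        (mul_pos hz (sub_pos.2 hzT)).ne').abs).mul continuousAt_const)
    have h := this.tendsto
    simpa using h
  filter_upwards [hc.eventually (gt_mem_nhds hδ), lt_mem_nhds hz, gt_mem_nhds hzT] with z' h1 h2 h3
  set κ := (z - z') / (z' * (T - z')) with hκ
  have hslope : ∀ s ∈ Set.Icc 0 T, ∀ t ∈ Set.Icc 0 T,
      |κ * (T - s - t)| ≤ 1 - Real.exp (-ε) := fun s hs t ht => by
    rw [abs_mul]
    refine le_trans (mul_le_mul_of_nonneg_left ?_ (abs_nonneg κ)) h1.le
    exact abs_le.2 ⟨by linarith [hs.2, ht.2], by linarith [hs.1, ht.1]⟩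
  have hdiff : ∀ s t : ℝ, (t + κ * t * (T - t)) - (s + κ * s * (T - s)) =
      (1 + κ * (T - s - t)) * (t - s) := fun s t => by ring
  have hpos : ∀ s ∈ Set.Icc 0 T, ∀ t ∈ Set.Icc 0 T, 0 < 1 + κ * (T - s - t) := fun s hs t ht => by
    have := (abs_le.1 (hslope s hs t ht)).1
    linarith [Real.exp_pos (-ε)]
  have hmono : ∀ s ∈ Set.Icc 0 T, ∀ t ∈ Set.Icc 0 T, s < t →
      s + κ * s * (T - s) < t + κ * t * (T - t) := fun s hs t ht hst => by
    have := mul_pos (hpos s hs t ht) (sub_pos.2 hst)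
    rw [← hdiff] at this
    linarith
  have hmono' : ∀ s ∈ Set.Icc 0 T, ∀ t ∈ Set.Icc 0 T, s ≤ t →
      s + κ * s * (T - s) ≤ t + κ * t * (T - t) := fun s hs t ht hst => by
    rcases hst.eq_or_lt with rfl | h
    · exact le_rfl
    · exact (hmono s hs t ht h).le
  have h0T : (0 : ℝ) ∈ Set.Icc 0 T := ⟨le_rfl, hT.le⟩
  have hTT : T ∈ Set.Icc 0 T := ⟨hT.le, le_rfl⟩
  let f : Set.Icc 0 T → Set.Icc 0 T := fun t => ⟨t + κ * t * (T - t),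
    by have := hmono' 0 h0T t t.2 t.2.1; simpa using this,
    by have := hmono' t t.2 T hTT t.2.2; simpa using this⟩
  have hf : StrictMono f := fun s t hst => Subtype.mk_lt_mk.2 (hmono s s.2 t t.2 hst)
  have hs : Function.Surjective f := fun t => by
    have hcont : ContinuousOn (fun s : ℝ => s + κ * s * (T - s)) (Set.Icc 0 T) := by fun_prop
    have := intermediate_value_Icc hT.le hcont
    obtain ⟨s, hs, hst⟩ := this (show (t : ℝ) ∈ _ by simp)
    exact ⟨⟨s, hs⟩, Subtype.ext hst⟩
  refine ⟨hf.orderIsoOfSurjective f hs, fun s t hst => ?_, fun t => ?_⟩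
  · have hst' : (0 : ℝ) < (t : ℝ) - s := sub_pos.2 hst
    have : (((f t : ℝ) - f s) / ((t : ℝ) - s)) = 1 + κ * (T - s - t) := by
      rw [div_eq_iff hst'.ne']
      exact hdiff s t
    rw [StrictMono.coe_orderIsoOfSurjective, this]
    refine abs_log_le_of_abs_sub_one_le ?_
    rw [add_sub_cancel_left]
    exact hslope s s.2 t t.2
  · have hz' : z' ∈ Set.Icc 0 T := ⟨h2.le, h3.le⟩
    have hfz : ((f ⟨z', hz'⟩ : Set.Icc 0 T) : ℝ) = z := by
      change z' + κ * z' * (T - z') = z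
      have : κ * (z' * (T - z')) = z - z' :=
        div_mul_cancel₀ _ (mul_pos h2 (sub_pos.2 h3)).ne'
      linarith
    rw [StrictMono.coe_orderIsoOfSurjective]
    calc (f t : ℝ) < z ↔ f t < f ⟨z', hz'⟩ := by rw [← Subtype.coe_lt_coe, hfz]
      _ ↔ t < ⟨z', hz'⟩ := hf.lt_iff_lt
      _ ↔ _ := Iff.rfl

theorem indicatorLT_coe (z t : ℝ) : indicatorLT (z : EReal) t = if t < z then 1 else 0 := by
  simp [indicatorLT]

theorem close_indicatorPath {I : Set ℝ} {z z' ε : ℝ} (m : ℝ) {y : SkorohodSpace I} {φ : I ≃o I}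
    (hφ : ∀ s t : I, s < t → |Real.log (((φ t : ℝ) - φ s) / ((t : ℝ) - s))| ≤ ε)
    (hz : ∀ t : I, (φ t : ℝ) < z ↔ (t : ℝ) < z')
    (hy : ∀ t : I, |y.toFun t - (indicatorPath I z').toFun t| ≤ ε) :
    SkorohodSpace.Close m ε (indicatorPath I z) y := by
  refine ⟨φ, hφ, fun t _ => ?_⟩
  have h := hy t
  simp only [indicatorPath, indicatorLT_coe] at h ⊢
  rwa [if_congr (hz t) rfl rfl]

/-- The time change and the uniform error enter a single `Close` relation, so no triangle inequality
is needed. -/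
theorem HasTimeChanges.exists_eventually {I : Set ℝ} {z : ℝ} (hz : HasTimeChanges I z)
    {U : Set (SkorohodSpace I)} (hU : IsOpen U) (hzU : indicatorPath I z ∈ U) :
    ∃ ε : ℝ, 0 < ε ∧ ∀ᶠ z' in 𝓝 z, ∀ y : SkorohodSpace I,
      (∀ t : I, |y.toFun t - (indicatorPath I z').toFun t| ≤ ε) → y ∈ U := by
  obtain ⟨m, ε, hε, h⟩ := hU _ hzU
  refine ⟨ε, hε, ?_⟩
  filter_upwards [hz ε hε] with z' ⟨φ, h1, h2⟩ y hy
  exact h y (close_indicatorPath m h1 h2 hy)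

theorem HasTimeChanges.continuousAt {I : Set ℝ} {z : ℝ} (hz : HasTimeChanges I z) :
    ContinuousAt (indicatorPath I) z := by
  refine tendsto_nhds.2 fun U hU hzU => ?_
  obtain ⟨ε, hε, h⟩ := hz.exists_eventually hU hzU
  filter_upwards [h] with z' hz'
  exact hz' _ fun t => by simpa using hε.le

end TimeChange

/-! ### From real variables to indicator paths -/

section SkorohodLimit

variable {Ω : ℕ → Type*} [∀ n, MeasurableSpace (Ω n)] {μ : ∀ n, Measure (Ω n)}
  [∀ n, IsProbabilityMeasure (μ n)] {Ω' : Type*} [MeasurableSpace Ω'] {ν : Measure Ω'}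
  [IsProbabilityMeasure ν]

theorem aemeasurable_indicatorPath {I O : Set ℝ} (hO : MeasurableSet O)
    (hgood : ∀ z ∈ O, HasTimeChanges I z) {Z : Ω' → ℝ} (hZ : AEMeasurable Z ν)
    (hZO : ∀ᵐ ω ∂ν, Z ω ∈ O) : AEMeasurable (fun ω => indicatorPath I (Z ω)) ν := by
  classical
  have hm : Measurable (O.piecewise (indicatorPath I) fun _ => indicatorPath I 0) :=
    ContinuousOn.measurable_piecewise
      (fun z hz => (hgood z hz).continuousAt.continuousWithinAt) continuousOn_const hO
  refine (hm.comp_aemeasurable hZ).congr ?_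
  filter_upwards [hZO] with ω hω
  simp [hω]

/-- Processes uniformly close to `t ↦ 1{t < Zₙ}` converge in distribution to `t ↦ 1{t < Z}` when
`Zₙ` converges in distribution to `Z`. -/
theorem tendstoInDistribution_indicatorPath {I O : Set ℝ} (hO : MeasurableSet O)
    (hgood : ∀ z ∈ O, HasTimeChanges I z) {Z : ∀ n, Ω n → ℝ} {Z' : Ω' → ℝ}
    (hZ : TendstoInDistribution Z atTop Z' μ ν) (hZO : ∀ᵐ ω ∂ν, Z' ω ∈ O)
    {Y : ∀ n, Ω n → SkorohodSpace I} (hY : ∀ n, AEMeasurable (Y n) (μ n))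
    (hnear : ∀ η : ℝ, 0 < η → Tendsto (fun n => μ n
      {ω | ¬ ∀ t : I, |(Y n ω).toFun t - (indicatorPath I (Z n ω)).toFun t| ≤ η}) atTop (𝓝 0)) :
    TendstoInDistribution Y atTop (fun ω => indicatorPath I (Z' ω)) μ ν := by
  refine tendstoInDistribution_of_isOpen hY
    (aemeasurable_indicatorPath hO hgood hZ.aemeasurable_limit hZO) fun U hU => ?_
  -- An open set of levels whose indicator path lies in `U` with a uniform margin. These sets
  -- increase with `j` and, by the existence of time changes, cover every level of `O` whose path is
  -- in `U`.
  let V : ℕ → Set ℝ := fun j => interior {z | ∀ y : SkorohodSpace I,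
    (∀ t : I, |y.toFun t - (indicatorPath I z).toFun t| ≤ 1 / ((j : ℝ) + 1)) → y ∈ U}
  have hV : Monotone V := fun i j hij => interior_mono fun z hz y hy =>
    hz y fun t => (hy t).trans (Nat.one_div_le_one_div hij)
  have hcover : ∀ᵐ ω ∂ν, ω ∈ (fun ω => indicatorPath I (Z' ω)) ⁻¹' U →
      ω ∈ ⋃ j, Z' ⁻¹' V j := by
    filter_upwards [hZO] with ω hω hωU
    obtain ⟨ε, hε, h⟩ := (hgood _ hω).exists_eventually hU hωU
    obtain ⟨j, hj⟩ := exists_nat_one_div_lt hε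
    refine Set.mem_iUnion.2 ⟨j, mem_interior_iff_mem_nhds.2 ?_⟩
    filter_upwards [h] with z' hz' y hy
    exact hz' y fun t => (hy t).trans hj.le
  refine (measure_mono_ae (t := ⋃ j, Z' ⁻¹' V j) hcover).trans ?_
  rw [Directed.measure_iUnion
    (Monotone.directed_le fun i j hij => Set.preimage_mono (hV hij))]
  refine iSup_le fun j => (le_liminf_of_tendstoInDistribution hZ isOpen_interior).trans ?_
  have hb := hnear (1 / ((j : ℝ) + 1)) Nat.one_div_pos_of_nat
  -- The probability of exceeding the margin tends to 0, so it can be added without changing the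
  -- lower limit.
  rw [← ENNReal.liminf_add_of_right_tendsto_zero hb fun n => μ n (Y n ⁻¹' U)]
  refine liminf_le_liminf (Eventually.of_forall fun n => ?_)
  refine (measure_mono fun ω hω => ?_).trans (measure_union_le _ _)
  by_cases h : ∀ t : I, |(Y n ω).toFun t - (indicatorPath I (Z n ω)).toFun t| ≤ 1 / ((j : ℝ) + 1)
  · exact Or.inl (interior_subset hω (Y n ω) h)
  · exact Or.inr h

end SkorohodLimit

/-! ### The rescaled path of the mouse -/

section ScaledPath

variable {I : Set ℝ} {r : ℝ} {n : ℕ} {w : ℕ → ℕ × ℕ}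

theorem scaledMousePath_apply (hr : 0 ≤ r) {N : ℕ} (hN : s₂ w = N) (t : I) :
    (scaledMousePath I r hr n w).toFun t =
      ((w ⌊(t : ℝ) / r ^ n⌋₊).2 : ℝ) / n * if (t : ℝ) < r ^ n * N then 1 else 0 := by
  have : ((r ^ n : ℝ) : EReal) * ((s₂ w : ℝ≥0∞) : EReal) = ((r ^ n * N : ℝ) : EReal) := by
    rw [hN]
    simp
    rfl
  simp only [scaledMousePath, this, indicatorLT_coe]

theorem scaledMousePath_stopped (hr : 0 < r) {N : ℕ} (hN : s₂ w = N) :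
    scaledMousePath I r hr.le n w = scaledMousePath I r hr.le n (fun k => w (min k N)) := by
  have hN' : s₂ (fun k => w (min k N)) = N := by
    have := isTrajectoryStoppingTime_s₂ N (x := w) (y := fun k => w (min k N)) fun k hk => by
      simp [min_eq_left (Set.mem_Iic.1 hk)]
    exact (iff_of_eq this).1 hN
  have : (scaledMousePath I r hr.le n w).toFun =
      (scaledMousePath I r hr.le n (fun k => w (min k N))).toFun := by
    funext t
    rw [scaledMousePath_apply hr.le hN, scaledMousePath_apply hr.le hN']
    split_ifs with h
    · have h1 : (t : ℝ) / r ^ n < N := by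
        rw [div_lt_iff₀ (pow_pos hr n), mul_comm]
        exact h
      rw [min_eq_left (Nat.floor_le_of_le h1.le)]
    · simp
  cases h : scaledMousePath I r hr.le n w
  cases h' : scaledMousePath I r hr.le n (fun k => w (min k N))
  rw [h, h'] at this
  simpa using this

/-- The path sees the trajectory only up to `s₂`. Stopped at a fixed `N`, it is a functional of
finitely many discrete coordinates, hence measurable; `N = s₂` is then substituted. -/
theorem aemeasurable_scaledMousePath {Ω : Type*} [MeasurableSpace Ω] {μ : Measure Ω}
    {X : ℕ → Ω → ℕ × ℕ} (hX : ∀ k, Measurable (X k)) (hr : 0 < r)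
    (hs : ∀ᵐ ω ∂μ, s₂ (fun k => X k ω) < ⊤) :
    AEMeasurable (fun ω => scaledMousePath I r hr.le n (fun k => X k ω)) μ := by
  have hm : ∀ N, Measurable fun ω =>
      scaledMousePath I r hr.le n (fun k => X (min k N) ω) := fun N => by
    refine measurable_of_dependsOn (a := N) hX
      (G := fun w => scaledMousePath I r hr.le n (fun k => w (min k N))) fun w w' h => ?_
    have : (fun k => w (min k N)) = fun k => w' (min k N) :=
      funext fun k => h _ (Set.mem_Iic.2 (min_le_right k N))
    simp only [this]
  refine ⟨_, measurable_eval hm (measurable_s₂ hX), ?_⟩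
  filter_upwards [hs] with ω hω
  exact scaledMousePath_stopped hr (ENat.natCast_toNat hω.ne).symm

theorem abs_scaledMousePath_sub_le (hr : 0 < r) (hn : n ≠ 0) (hI : ∀ t ∈ I, (0 : ℝ) ≤ t)
    (hl : Legal w) (h0 : w 0 = (0, n)) (hs₁ : s₁ w < ⊤) (ht₁ : t₁ w < ⊤) (hs₂ : s₂ w < ⊤)
    {K : ℕ} (hm : ∀ k, K ≤ k → ¬ MeetsAfter w k) (t : I) :
    |(scaledMousePath I r hr.le n w).toFun t -
      (indicatorPath I (r ^ n * ((s₂ w).toNat : ℝ))).toFun t| ≤ (K : ℝ) / n := by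
  have hn' : (0 : ℝ) < n := by exact_mod_cast Nat.pos_of_ne_zero hn
  have hN : s₂ w = ((s₂ w).toNat : ℕ) := (ENat.natCast_toNat hs₂.ne).symm
  rw [scaledMousePath_apply hr.le hN]
  simp only [indicatorPath, indicatorLT_coe]
  split_ifs with h
  · have hr' := pow_pos hr n
    have h1 : (t : ℝ) / r ^ n < (s₂ w).toNat := by
      rw [div_lt_iff₀ hr', mul_comm]
      exact h
    have h2 : ⌊(t : ℝ) / r ^ n⌋₊ < (s₂ w).toNat :=
      (Nat.floor_lt (div_nonneg (hI t t.2) hr'.le)).2 h1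
    have h3 := hl.abs_mouse_sub_le h0 (ENat.natCast_toNat hs₁.ne).symm (ENat.natCast_toNat ht₁.ne).symm hm
      (k := ⌊(t : ℝ) / r ^ n⌋₊) (by rw [hN]; exact_mod_cast h2)
    rw [mul_one, div_sub_one hn'.ne', abs_div, abs_of_pos hn']
    exact div_le_div_of_nonneg_right h3 hn'.le
  · simp only [mul_zero, sub_zero, abs_zero]
    positivity

end ScaledPath

/-! ### Uniform closeness of the path to an indicator -/

section PathLimit

variable {p : ℝ} {Ω : ℕ → Type*} [∀ n, MeasurableSpace (Ω n)]
  {μ : ∀ n, Measure (Ω n)} [∀ n, IsProbabilityMeasure (μ n)]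
  {X : ∀ n, ℕ → Ω n → ℕ × ℕ} {γ : ℝ}

/-- Take `K = ⌊η n⌋`: if no meeting occurs `K` or more steps after `s₁` and before `t₁`, then `M/n`
stays within `η` of 1 until `s₂`, and the exceptional probability `γ^K/(1-γ)` vanishes. -/
theorem tendsto_measure_path_far (hp : 0 < p) (hp' : p < 1 / 2)
    (hX : ∀ n, IsMarkovChain (μ n) (catMouse (reflectedWalk p)) (0, n) (X n))
    (hγ : 0 < γ) (hγ1 : γ < 1)
    (hmeet : ∀ n k, (μ n).real {ω | MeetsAfter (fun k => X n k ω) k} ≤ γ ^ k)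
    {I : Set ℝ} (hI : ∀ t ∈ I, (0 : ℝ) ≤ t) {η : ℝ} (hη : 0 < η) :
    Tendsto (fun n => μ n {ω | ¬ ∀ t : I,
      |(scaledMousePath I (rho p) (rho_nonneg hp hp') n (fun k => X n k ω)).toFun t -
        (indicatorPath I (rho p ^ n * ((s₂ (fun k => X n k ω)).toNat : ℝ))).toFun t| ≤ η})
      atTop (𝓝 0) := by
  have hK : Tendsto (fun n : ℕ => ⌊η * (n : ℝ)⌋₊) atTop atTop :=
    tendsto_nat_floor_atTop.comp (tendsto_natCast_atTop_atTop.const_mul_atTop hη)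
  have hlim : Tendsto (fun n : ℕ => ENNReal.ofReal (γ ^ ⌊η * (n : ℝ)⌋₊ / (1 - γ))) atTop
      (𝓝 0) := by
    have := ENNReal.tendsto_ofReal
      (((tendsto_pow_atTop_nhds_zero_of_lt_one hγ.le hγ1).div_const (1 - γ)).comp hK)
    simpa using this
  refine tendsto_of_tendsto_of_tendsto_of_le_of_le' tendsto_const_nhds hlim
    (Eventually.of_forall fun _ => zero_le) ?_
  filter_upwards [eventually_ne_atTop 0] with n hn
  refine (measure_mono_ae ?_).trans
    (measure_exists_ge_le (A := fun k => {ω | MeetsAfter (fun k => X n k ω) k})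
      hγ hγ1 (hmeet n) ⌊η * (n : ℝ)⌋₊)
  filter_upwards [ae_legal (hX n), (hX n).ae_init, ae_s₁_lt_top hp hp' (hX n),
    ae_t₁_lt_top hp hp' (hX n), ae_s₂_lt_top hp hp' (hX n)] with ω hl h0 h1 h2 h3 hω
  by_contra hno
  refine hω fun t => (abs_scaledMousePath_sub_le (rho_pos hp hp') hn hI hl h0 h1 h2 h3
    (K := ⌊η * (n : ℝ)⌋₊) (fun k hk hm => hno ⟨k, hk, hm⟩) t).trans ?_
  have hn' : (0 : ℝ) < n := by exact_mod_cast Nat.pos_of_ne_zero hn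
  rw [div_le_iff₀ hn']
  exact Nat.floor_le (by positivity)

end PathLimit

end CatMouse

/-! ### The convergence theorem -/

theorem mainTheorem8
    (p : ℝ) (hp : 0 < p) (hp' : p < 1 / 2)
    -- for each `n`, the cat and mouse chain of the reflected walk, from `C_0 = 0`, `M_0 = n`
    {Ω : ℕ → Type*} [∀ n, MeasurableSpace (Ω n)]
    (μ : ∀ n, Measure (Ω n)) [∀ n, IsProbabilityMeasure (μ n)]
    (X : ∀ n, ℕ → Ω n → ℕ × ℕ)
    (hX : ∀ n, CatMouse.IsMarkovChain (μ n)
      (CatMouse.catMouse (CatMouse.reflectedWalk p)) (0, n) (X n))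
    -- the cat and mouse chain of the free walk, from `(0, 0)`, and the variables `E₁`, `E₂`
    {Ω' : Type*} [MeasurableSpace Ω'] (ν : Measure Ω') [IsProbabilityMeasure ν]
    (X' : ℕ → Ω' → ℤ × ℤ)
    (hX' : CatMouse.IsMarkovChain ν (CatMouse.catMouse (CatMouse.freeWalk p)) (0, 0) X')
    (M' : Ω' → ℤ) (hM' : M' = CatMouse.asymptoticLocation (fun k ω => (X' k ω).2))
    (E₁ E₂ : Ω' → ℝ)
    -- exponential variables of mean `(1 + ρ) / (1 - ρ) ^ 2`
    (hE₁ : HasLaw E₁ (expMeasure (((1 + CatMouse.rho p) / (1 - CatMouse.rho p) ^ 2)⁻¹)) ν)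
    (hE₂ : HasLaw E₂ (expMeasure (((1 + CatMouse.rho p) / (1 - CatMouse.rho p) ^ 2)⁻¹)) ν)
    (hE : IndepFun E₁ E₂ ν) (hME : IndepFun M' (fun ω => (E₁ ω, E₂ ω)) ν) :
    -- the objects are well defined
    (∀ᵐ ω ∂ν, Tendsto (fun k => (X' k ω).2) atTop (𝓝 (M' ω))) ∧
    (∀ n, ∀ᵐ ω ∂(μ n), CatMouse.s₁ (fun k => X n k ω) < ⊤ ∧
      CatMouse.t₁ (fun k => X n k ω) < ⊤ ∧ CatMouse.s₂ (fun k => X n k ω) < ⊤) ∧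
    -- convergence of `(M_{t₁} - n, ρⁿ t₁)`
    TendstoInDistribution
      (fun n ω =>
        ((((X n (CatMouse.t₁ (fun k => X n k ω)).toNat ω).2 : ℤ) - (n : ℤ),
          CatMouse.rho p ^ n * ((CatMouse.t₁ (fun k => X n k ω)).toNat : ℝ)) : ℤ × ℝ))
      atTop (fun ω => (M' ω, E₁ ω)) μ ν ∧
    -- convergence of the process in `D([0, ∞), ℝ)`, and in `D([0, T], ℝ)` for every `T > 0`
    ∀ I : Set ℝ, (I = Set.Ici 0 ∨ ∃ T : ℝ, 0 < T ∧ I = Set.Icc 0 T) →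
      TendstoInDistribution
        (fun n ω => CatMouse.scaledMousePath I (CatMouse.rho p) (CatMouse.rho_nonneg hp hp') n
          (fun k => X n k ω))
        atTop
        (fun ω => CatMouse.indicatorPath I
          (E₁ ω + CatMouse.rho p ^ (-(M' ω)) * E₂ ω)) μ ν := by
  have hρ := CatMouse.rho_pos hp hp'
  have hρ1 := CatMouse.rho_lt_one hp'
  have hc : 0 < ((1 + CatMouse.rho p) / (1 - CatMouse.rho p) ^ 2)⁻¹ := by
    have : 0 < 1 - CatMouse.rho p := by linarith
    positivity
  obtain ⟨γ, h, hγ, hγ1, h_nonneg, h_zero, h_ne, h_eq⟩ :=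
    CatMouse.exists_contracted_potential hp hp'
  have hmeet := fun n => CatMouse.measureReal_meetsAfter_le hp hp' (hX n) hγ h_nonneg h_zero
    h_ne h_eq
  have hmeet' := CatMouse.measureReal_free_meeting_le hX' hγ h_nonneg h_zero h_ne h_eq
  have hM : ∀ᵐ ω ∂ν, Tendsto (fun k => (X' k ω).2) atTop (𝓝 (M' ω)) := by
    rw [hM']
    exact CatMouse.ae_tendsto_asymptoticLocation hX' hγ hγ1 hmeet'
  have hMm : AEMeasurable M' ν := CatMouse.aemeasurable_asymptoticLocation hX' hM
  refine ⟨hM, fun n => ?_, CatMouse.tendstoInDistribution_t₁ hp hp' hX hX' hγ hγ1 hmeet hmeet'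
    hM hE₁ hE₂ hE hME, fun I hI => ?_⟩
  · filter_upwards [CatMouse.ae_s₁_lt_top hp hp' (hX n), CatMouse.ae_t₁_lt_top hp hp' (hX n),
      CatMouse.ae_s₂_lt_top hp hp' (hX n)] with ω h₁ h₂ h₃
    exact ⟨h₁, h₂, h₃⟩
  have hne := CatMouse.ae_limit_ne hc hMm hE₁ hE₂ hE hME (fun m => CatMouse.rho p ^ (-m))
    fun m => (zpow_pos hρ _).ne'
  have hpos : ∀ᵐ ω ∂ν, 0 < E₁ ω + CatMouse.rho p ^ (-(M' ω)) * E₂ ω := by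
    filter_upwards [hne 0, CatMouse.ae_nonneg_of_hasLaw_expMeasure hE₁,
      CatMouse.ae_nonneg_of_hasLaw_expMeasure hE₂] with ω h₀ h₁ h₂
    exact lt_of_le_of_ne (add_nonneg h₁ (mul_nonneg (zpow_pos hρ _).le h₂)) h₀.symm
  have hs := CatMouse.tendstoInDistribution_s₂ hp hp' hX hX' hγ hγ1 hmeet hmeet' hM hE₁ hE₂ hE hME
  have hI₀ : ∀ t ∈ I, (0 : ℝ) ≤ t := by
    rcases hI with rfl | ⟨T, -, rfl⟩
    · exact fun t ht => ht
    · exact fun t ht => ht.1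
  -- The levels at which indicator paths vary continuously; on `[0, T]` the level `T` is removed, at
  -- no cost since the limit has no atoms.
  obtain ⟨O, hO, hgood, hZO⟩ : ∃ O : Set ℝ, MeasurableSet O ∧
      (∀ z ∈ O, CatMouse.HasTimeChanges I z) ∧
      ∀ᵐ ω ∂ν, E₁ ω + CatMouse.rho p ^ (-(M' ω)) * E₂ ω ∈ O := by
    rcases hI with rfl | ⟨T, -, rfl⟩
    · exact ⟨Set.Ioi 0, measurableSet_Ioi, fun z hz => CatMouse.hasTimeChanges_Ici hz, hpos⟩
    · refine ⟨Set.Ioi 0 \ {T}, measurableSet_Ioi.diff (measurableSet_singleton T),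
        fun z hz => CatMouse.hasTimeChanges_Icc hz.1 hz.2, ?_⟩
      filter_upwards [hpos, hne T] with ω h₁ h₂
      exact ⟨h₁, h₂⟩
  exact CatMouse.tendstoInDistribution_indicatorPath hO hgood hs hZO
    (fun n => CatMouse.aemeasurable_scaledMousePath (hX n).measurable hρ
      (CatMouse.ae_s₂_lt_top hp hp' (hX n)))
    (fun η hη => CatMouse.tendsto_measure_path_far hp hp' hX hγ hγ1 hmeet hI₀ hη)
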